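/- **Setting.** Let $M$ be a complete oriented smooth Riemannian manifold without boundary (second countable), $\dim M=3$, with Ricci curvature bounded below: $\langle \mathrm{Ric}\,v,v\rangle\ge-\kappa|v|^2$ for some $\kappa\in\mathbb R$. Let $dx$ be the Riemannian measure, $\nabla$ the Levi-Civita connection, $\square=dd^*+d^*d$ the De Rham–Hodge Laplacian, acting on vector fields by $\square u=(\square\tilde u)^\sharp$, where $\tilde u$ is the $1$-form dual to $u$. Let $\nu>0$, let $J\subset\mathbb R$ be a nondegenerate interval, and let $(u_t,p_t)_{t\in J}$ be a solution of the Navier–Stokes equation $$\partial_t u_t+\nabla_{u_t}u_t+\nu\,\square u_t=-\nabla p_t,\qquad \mathrm{div}(u_t)=0,$$ with $u$ smooth on $J\times M$ and each $p_t$ smooth on $M$. The vorticity is the $1$-form $\omega_t=*\,d\tilde u_t$. The solution is assumed to be *regular*: for every $t\in J$, $|\omega_t|$, $|\nabla\omega_t|$ and $|u_t||\omega_t|$ are in $L^2(M)$, $|\nabla u_t||\omega_t|^2$ is in $L^1(M)$, and $t\mapsto\omega_t$ is differentiable with values in $L^2$, that is, $\int_M|(\omega_s-\omega_t)/(s-t)-\partial_t\omega_t|^2dx\to0$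 as $s\to t$ in $J$. (If $M$ is compact, every smooth solution is regular.) **Intrinsic Ricci tensor.** For a vector field $v$, let $\nabla^v_XY=\nabla_XY-\frac{2}{n-1}(\langle Y,v\rangle X-\langle X,Y\rangle v)$, $n=\dim M=3$, with torsion $T^v$ and Ricci tensor $\mathrm{Ric}^v(X)=\sum_iR^v(X,e_i)e_i$, and put $\widehat{\mathrm{Ric}^v}(X)=\mathrm{Ric}^v(X)+\sum_i(\nabla^v_{e_i}T^v)(X,e_i)$, where $(e_i)$ is an orthonormal frame. Write $\widehat{\mathrm{Ric}^t}$ for $\widehat{\mathrm{Ric}^v}$ with $v=-\frac1{2\nu}u_t$, and define $\widehat{\mathrm{Ric}^t}^\#\omega_t$ by $(\widehat{\mathrm{Ric}^t}^\#\omega_t)(A)=\omega_t(\widehat{\mathrm{Ric}^t}A)$. **Theorem.** For every $t\in J$, $$\widehat{\mathrm{Ric}^t}=\mathrm{Ric}+\frac1{2\nu^2}u_t\otimes u_t-\frac1\nu\nabla^su_t,$$ where $(u_t\otimes u_t)(X)=\langle X,u_t\rangle u_t$ and $\nabla^su_t$ is the symmetric part of $\nabla u_t$. Moreover $(\omega_t,u_t)^2$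 and $\langle\widehat{\mathrm{Ric}^t}^\#\omega_t,\omega_t\rangle$ are integrable on $M$, the function $t\mapsto\int_M|\omega_t|^2dx$ is differentiable on $J$ (one-sidedly at endpoints belonging to $J$), and $$\frac12\frac{d}{dt}\int_M|\omega_t|^2\,dx+\nu\int_M|\nabla\omega_t|^2\,dx=\frac1{2\nu}\int_M(\omega_t,u_t)^2\,dx-\nu\int_M\langle\widehat{\mathrm{Ric}^t}^\#\omega_t,\omega_t\rangle\,dx,$$ where $(\omega_t,u_t)=\omega_t(u_t)$ and $|\nabla\omega_t|$ is the Hilbert–Schmidt norm. -/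

import Mathlib

open Bundle Manifold FiberBundle Module VectorField MeasureTheory Filter
open scoped ContDiff Topology RealInnerProductSpace

noncomputable section

namespace RiemannianFluid

section Geometry

variable {E : Type*} [NormedAddCommGroup E] [NormedSpace ℝ E] [FiniteDimensional ℝ E]
  {H : Type*} [TopologicalSpace H] {I : ModelWithCorners ℝ E H}
  {M : Type*} [TopologicalSpace M] [ChartedSpace H M]

instance finiteDimensional_tangentSpace (x : M) : FiniteDimensional ℝ (TangentSpace I x) :=
  inferInstanceAs (FiniteDimensional ℝ E)

variable [RiemannianBundle (fun x : M => TangentSpace I x)]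

variable (I) in
/-- An orthonormal basis of the tangent space at `x`. -/
def frame (x : M) :
    OrthonormalBasis (Fin (finrank ℝ (TangentSpace I x))) ℝ (TangentSpace I x) :=
  stdOrthonormalBasis ℝ (TangentSpace I x)

/-- The Koszul functional: for the Levi-Civita connection it is `2 ⟪∇_X Y, Z⟫`. Here `d% f` is the
differential of a real function `f` on `M`. -/
def koszul (X Y Z : Π x : M, TangentSpace I x) (x : M) : ℝ :=
  d% (fun y => ⟪Y y, Z y⟫) x (X x) + d% (fun y => ⟪X y, Z y⟫) x (Y x)
    - d% (fun y => ⟪X y, Y y⟫) x (Z x)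
    + ⟪mlieBracket I X Y x, Z x⟫ - ⟪mlieBracket I X Z x, Y x⟫
    - ⟪mlieBracket I Y Z x, X x⟫

variable [IsManifold I ∞ M] [IsContMDiffRiemannianBundle I ∞ E (fun x : M => TangentSpace I x)]
variable {X X' Y Y' Z Z' : Π x : M, TangentSpace I x} {x : M}

theorem mdifferentiableAt_inner (hX : MDiffAt (T% X) x) (hY : MDiffAt (T% Y) x) :
    MDiffAt (fun y => ⟪X y, Y y⟫) x :=
  MDifferentiableAt.inner_bundle (IB := I) (F := E) (E := fun x : M => TangentSpace I x)
    (b := id) (v := X) (w := Y) hX hY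

theorem koszul_smul_left {f : M → ℝ} (hf : MDiffAt f x) (hX : MDiffAt (T% X) x)
    (hY : MDiffAt (T% Y) x) (hZ : MDiffAt (T% Z) x) :
    koszul (f • X) Y Z x = f x * koszul X Y Z x := by
  have h1 : (fun y => ⟪(f • X) y, Z y⟫) = (fun y => f y * ⟪X y, Z y⟫) := by
    ext y; simp [inner_smul_left]
  have h2 : (fun y => ⟪(f • X) y, Y y⟫) = (fun y => f y * ⟪X y, Y y⟫) := by
    ext y; simp [inner_smul_left]
  unfold koszul
  rw [h1, h2, mvfderiv_fun_mul hf (mdifferentiableAt_inner hX hZ), mvfderiv_fun_mul hf (mdifferentiableAt_inner hX hY),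
      mlieBracket_smul_left hf hX, mlieBracket_smul_left hf hX]
  simp [inner_smul_left, inner_smul_right, inner_add_left, inner_neg_left]
  ring

theorem koszul_smul_right {f : M → ℝ} (hf : MDiffAt f x) (hX : MDiffAt (T% X) x)
    (hY : MDiffAt (T% Y) x) (hZ : MDiffAt (T% Z) x) :
    koszul X Y (f • Z) x = f x * koszul X Y Z x := by
  have h1 : (fun y => ⟪Y y, (f • Z) y⟫) = (fun y => f y * ⟪Y y, Z y⟫) := by
    ext y; simp [inner_smul_right]
  have h2 : (fun y => ⟪X y, (f • Z) y⟫) = (fun y => f y * ⟪X y, Z y⟫) := by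
    ext y; simp [inner_smul_right]
  unfold koszul
  rw [h1, h2, mvfderiv_fun_mul hf (mdifferentiableAt_inner hY hZ), mvfderiv_fun_mul hf (mdifferentiableAt_inner hX hZ),
      mlieBracket_smul_right hf hZ, mlieBracket_smul_right hf hZ]
  simp [inner_smul_left, inner_smul_right, inner_add_left, real_inner_comm]
  ring

theorem koszul_smul_middle {f : M → ℝ} (hf : MDiffAt f x) (hX : MDiffAt (T% X) x)
    (hY : MDiffAt (T% Y) x) (hZ : MDiffAt (T% Z) x) :
    koszul X (f • Y) Z x = f x * koszul X Y Z x + 2 * (d% f x (X x) * ⟪Y x, Z x⟫) := by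
  have h1 : (fun y => ⟪(f • Y) y, Z y⟫) = (fun y => f y * ⟪Y y, Z y⟫) := by
    ext y; simp [inner_smul_left]
  have h2 : (fun y => ⟪X y, (f • Y) y⟫) = (fun y => f y * ⟪X y, Y y⟫) := by
    ext y; simp [inner_smul_right]
  unfold koszul
  rw [h1, h2, mvfderiv_fun_mul hf (mdifferentiableAt_inner hY hZ), mvfderiv_fun_mul hf (mdifferentiableAt_inner hX hY),
      mlieBracket_smul_right hf hY, mlieBracket_smul_left hf hY]
  simp [inner_smul_left, inner_smul_right, inner_add_left, inner_neg_left]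
  rw [real_inner_comm (X x) (Y x)]
  ring

theorem koszul_add_left (hX : MDiffAt (T% X) x) (hX' : MDiffAt (T% X') x)
    (hY : MDiffAt (T% Y) x) (hZ : MDiffAt (T% Z) x) :
    koszul (X + X') Y Z x = koszul X Y Z x + koszul X' Y Z x := by
  have h1 : (fun y => ⟪(X + X') y, Z y⟫) = (fun y => ⟪X y, Z y⟫ + ⟪X' y, Z y⟫) := by
    ext y; simp [inner_add_left]
  have h2 : (fun y => ⟪(X + X') y, Y y⟫) = (fun y => ⟪X y, Y y⟫ + ⟪X' y, Y y⟫) := by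
    ext y; simp [inner_add_left]
  unfold koszul
  rw [h1, h2, mvfderiv_fun_add (mdifferentiableAt_inner hX hZ) (mdifferentiableAt_inner hX' hZ),
    mvfderiv_fun_add (mdifferentiableAt_inner hX hY) (mdifferentiableAt_inner hX' hY),
    mlieBracket_add_left hX hX', mlieBracket_add_left hX hX']
  simp [inner_add_left, inner_add_right]
  ring

theorem koszul_add_right (hX : MDiffAt (T% X) x) (hY : MDiffAt (T% Y) x)
    (hZ : MDiffAt (T% Z) x) (hZ' : MDiffAt (T% Z') x) :
    koszul X Y (Z + Z') x = koszul X Y Z x + koszul X Y Z' x := by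
  have h1 : (fun y => ⟪Y y, (Z + Z') y⟫) = (fun y => ⟪Y y, Z y⟫ + ⟪Y y, Z' y⟫) := by
    ext y; simp [inner_add_right]
  have h2 : (fun y => ⟪X y, (Z + Z') y⟫) = (fun y => ⟪X y, Z y⟫ + ⟪X y, Z' y⟫) := by
    ext y; simp [inner_add_right]
  unfold koszul
  rw [h1, h2, mvfderiv_fun_add (mdifferentiableAt_inner hY hZ) (mdifferentiableAt_inner hY hZ'),
    mvfderiv_fun_add (mdifferentiableAt_inner hX hZ) (mdifferentiableAt_inner hX hZ'),
    mlieBracket_add_right hZ hZ', mlieBracket_add_right hZ hZ']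
  simp [inner_add_left, inner_add_right]
  ring

theorem koszul_add_middle (hX : MDiffAt (T% X) x) (hY : MDiffAt (T% Y) x)
    (hY' : MDiffAt (T% Y') x) (hZ : MDiffAt (T% Z) x) :
    koszul X (Y + Y') Z x = koszul X Y Z x + koszul X Y' Z x := by
  have h1 : (fun y => ⟪(Y + Y') y, Z y⟫) = (fun y => ⟪Y y, Z y⟫ + ⟪Y' y, Z y⟫) := by
    ext y; simp [inner_add_left]
  have h2 : (fun y => ⟪X y, (Y + Y') y⟫) = (fun y => ⟪X y, Y y⟫ + ⟪X y, Y' y⟫) := by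
    ext y; simp [inner_add_right]
  unfold koszul
  rw [h1, h2, mvfderiv_fun_add (mdifferentiableAt_inner hY hZ) (mdifferentiableAt_inner hY' hZ),
    mvfderiv_fun_add (mdifferentiableAt_inner hX hY) (mdifferentiableAt_inner hX hY'),
    mlieBracket_add_right hY hY', mlieBracket_add_left hY hY']
  simp [inner_add_left, inner_add_right]
  ring

/-- The Koszul functional as a bilinear form in the two outer arguments. -/
def koszulForm (Y : Π x : M, TangentSpace I x) (x : M) (hY : MDiffAt (T% Y) x) :
    TangentSpace I x →L[ℝ] TangentSpace I x →L[ℝ] ℝ :=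
  TensorialAt.mkHom₂ (I := I) (F := E) (F' := E)
    (fun X Z : Π x : M, TangentSpace I x => koszul X Y Z x) x
    (fun _ hZ => ⟨fun hf hX => koszul_smul_left hf hX hY hZ,
      fun hX hX' => koszul_add_left hX hX' hY hZ⟩)
    (fun _ hX => ⟨fun hf hZ => koszul_smul_right hf hX hY hZ,
      fun hZ hZ' => koszul_add_right hX hY hZ hZ'⟩)

open Classical in
/-- The endomorphism `v ↦ ∇_v Y` of `T_x M` determined by the Koszul formula (with the value `0`
if `Y` is not differentiable at `x`). -/
def leviCivitaFun (Y : Π x : M, TangentSpace I x) (x : M) :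
    TangentSpace I x →L[ℝ] TangentSpace I x :=
  if hY : MDiffAt (T% Y) x then
    (1 / 2 : ℝ) • ∑ i, ((koszulForm Y x hY).flip (frame I x i)).smulRight (frame I x i)
  else 0

theorem inner_leviCivitaFun (hX : MDiffAt (T% X) x) (hY : MDiffAt (T% Y) x)
    (hZ : MDiffAt (T% Z) x) :
    2 * ⟪leviCivitaFun Y x (X x), Z x⟫ = koszul X Y Z x := by
  have h : koszulForm Y x hY (X x) (Z x) = koszul X Y Z x :=
    TensorialAt.mkHom₂_apply _ _ hX hZ
  rw [← h]
  conv_rhs => rw [← (frame I x).sum_repr' (Z x)]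
  simp [leviCivitaFun, hY, inner_smul_left, sum_inner, Finset.mul_sum, mul_comm]

theorem leviCivitaFun_isCovariantDerivativeOn :
    IsCovariantDerivativeOn E (leviCivitaFun (I := I) (M := M)) Set.univ where
  add {Y Y' x} hY hY' _ := by
    ext v
    refine ext_inner_right ℝ fun w => ?_
    have hv := mdifferentiableAt_extend I E v
    have hw := mdifferentiableAt_extend I E w
    have h := inner_leviCivitaFun hv (mdifferentiableAt_add_section hY hY') hw
    rw [koszul_add_middle hv hY hY' hw, ← inner_leviCivitaFun hv hY hw,
      ← inner_leviCivitaFun hv hY' hw] at h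
    simp only [extend_apply_self] at h
    simp only [add_apply, inner_add_left]
    linarith
  leibniz {Y f x} hY hf _ := by
    ext v
    refine ext_inner_right ℝ fun w => ?_
    have hv := mdifferentiableAt_extend I E v
    have hw := mdifferentiableAt_extend I E w
    have h := inner_leviCivitaFun hv (hf.smul_section hY) hw
    rw [koszul_smul_middle hf hv hY hw, ← inner_leviCivitaFun hv hY hw] at h
    simp only [extend_apply_self] at h
    simp only [add_apply, smul_apply, inner_add_left,
      inner_smul_left, ContinuousLinearMap.smulRight_apply, conj_trivial]
    linarith

variable (I M) in
/-- The Levi-Civita connection; `leviCivita I M Y x v` is `∇_v Y` at `x`. -/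
def leviCivita : CovariantDerivative I E (fun x : M => TangentSpace I x) :=
  ⟨leviCivitaFun, leviCivitaFun_isCovariantDerivativeOn⟩

theorem leviCivita_isMetricCompatible : 
    CovariantDerivative.IsMetricCompatible (V := fun x : M => TangentSpace I x) (leviCivita I M) := by
  rw [CovariantDerivative.isMetricCompatible_iff]
  intro x X Y Z hX hY hZ
  have h1 := inner_leviCivitaFun hX hY hZ
  have h2 := inner_leviCivitaFun hX hZ hY
  have h3 : (fun y => ⟪Y y, Z y⟫) = fun y => ⟪Z y, Y y⟫ := by
    ext y; exact real_inner_comm _ _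
  change _ = ⟪leviCivitaFun Y x (X x), Z x⟫ + ⟪Y x, leviCivitaFun Z x (X x)⟫
  rw [real_inner_comm _ (Y x)]
  unfold koszul at h1 h2
  rw [mlieBracket_swap_apply (V := Z) (W := Y), inner_neg_left, ← h3] at h2
  linarith

theorem leviCivita_torsion : (leviCivita I M).torsion = 0 := by
  rw [CovariantDerivative.torsion_eq_zero_iff]
  intro X Y x hX hY
  refine ext_inner_right ℝ fun w => ?_
  have hw := mdifferentiableAt_extend I E w
  have h1 := inner_leviCivitaFun hX hY hw
  have h2 := inner_leviCivitaFun hY hX hw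
  have h3 : (fun y => ⟪Y y, X y⟫) = fun y => ⟪X y, Y y⟫ := by
    ext y; exact real_inner_comm _ _
  unfold koszul at h1 h2
  rw [mlieBracket_swap_apply (V := Y) (W := X), inner_neg_left, h3] at h2
  simp only [extend_apply_self] at h1 h2
  change ⟪leviCivitaFun Y x (X x) - leviCivitaFun X x (Y x), w⟫ = _
  rw [inner_sub_left]
  linarith

/-! ### Curvature and torsion of an affine connection -/

/-- The curvature `R(X, Y) Z = ∇_X ∇_Y Z - ∇_Y ∇_X Z - ∇_[X, Y] Z`. -/
def curvature (cov : CovariantDerivative I E (fun x : M => TangentSpace I x))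
    (X Y Z : Π x : M, TangentSpace I x) (x : M) : TangentSpace I x :=
  cov (fun y => cov Z y (Y y)) x (X x) - cov (fun y => cov Z y (X y)) x (Y x)
    - cov Z x (mlieBracket I X Y x)

/-- The Ricci tensor `Ric(v) = ∑ i, R(v, e i) (e i)`; tangent vectors at `x` are extended to local
vector fields in order to be differentiated. -/
def ricci (cov : CovariantDerivative I E (fun x : M => TangentSpace I x)) (x : M)
    (v : TangentSpace I x) : TangentSpace I x :=
  ∑ i, curvature cov (extend E v) (extend E (frame I x i)) (extend E (frame I x i)) x

/-- The covariant derivative `(∇_e T)(v, w)` of the torsion tensor `T` of the connection. -/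
def nablaTorsion (cov : CovariantDerivative I E (fun x : M => TangentSpace I x)) (x : M)
    (e v w : TangentSpace I x) : TangentSpace I x :=
  cov (fun y => cov.torsion y (extend E v y) (extend E w y)) x e
    - cov.torsion x (cov (extend E v) x e) w - cov.torsion x v (cov (extend E w) x e)

/-- The tensor `Y ↦ X ↦ K_v(X, Y) = ⟪Y, v⟫ X - ⟪X, Y⟫ v`. -/
def driftTensor (v : Π x : M, TangentSpace I x) (x : M) :
    TangentSpace I x →L[ℝ] TangentSpace I x →L[ℝ] TangentSpace I x :=
  LinearMap.toContinuousLinearMap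
    { toFun := fun Y => ⟪Y, v x⟫ • ContinuousLinearMap.id ℝ (TangentSpace I x)
        - (innerSL ℝ Y).smulRight (v x)
      map_add' := fun Y Y' => by
        ext X
        simp [inner_add_left]
        module
      map_smul' := fun c Y => by
        ext X
        simp [inner_smul_left]
        module }

@[simp]
theorem driftTensor_apply (v : Π x : M, TangentSpace I x) (x : M) (X Y : TangentSpace I x) :
    driftTensor v x Y X = ⟪Y, v x⟫ • X - ⟪X, Y⟫ • v x := by
  simp [driftTensor, real_inner_comm]

/-- The metric connection `∇^v_X Y = ∇_X Y - 2 / (n - 1) K_v(X, Y)`, `n = dim M`. -/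
def driftConnection (v : Π x : M, TangentSpace I x) :
    CovariantDerivative I E (fun x : M => TangentSpace I x) :=
  (leviCivita I M).addOneForm fun x => (-(2 / ((finrank ℝ E : ℝ) - 1))) • driftTensor v x

/-- The intrinsic Ricci tensor `Ric^v(X) + ∑ i, (∇^v_{e i} T^v)(X, e i)` of the connection `∇^v`. -/
def intrinsicRicci (v : Π x : M, TangentSpace I x) (x : M) (X : TangentSpace I x) :
    TangentSpace I x :=
  ricci (driftConnection v) x X + ∑ i, nablaTorsion (driftConnection v) x (frame I x i) X (frame I x i)

/-! ### Differential forms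

A `1`-form is a section of the cotangent bundle, a `2`-form is a family of bilinear forms on the
tangent spaces. -/

/-- The vector `α^♯` of a linear form `α` on `T_x M`. -/
def sharp (x : M) (α : TangentSpace I x → ℝ) : TangentSpace I x :=
  ∑ i, α (frame I x i) • frame I x i

/-- The inner product of two linear forms on `T_x M`. -/
def formInner (x : M) (α β : TangentSpace I x → ℝ) : ℝ :=
  ∑ i, α (frame I x i) * β (frame I x i)

/-- The `1`-form of a vector field. -/
def flat (u : Π x : M, TangentSpace I x) (x : M) : TangentSpace I x →L[ℝ] ℝ :=
  innerSL ℝ (u x)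

/-- The exterior derivative of a `1`-form, `dα(V, W) = V(α(W)) - W(α(V)) - α([V, W])`. -/
def dOne (α : Π x : M, TangentSpace I x →L[ℝ] ℝ) (x : M) (v w : TangentSpace I x) : ℝ :=
  d% (fun y => α y (extend E w y)) x v - d% (fun y => α y (extend E v y)) x w
    - α x (mlieBracket I (extend E v) (extend E w) x)

/-- The covariant derivative `(∇_v α)(w)` of a `1`-form. -/
def nablaOne (α : Π x : M, TangentSpace I x →L[ℝ] ℝ) (x : M) (v w : TangentSpace I x) : ℝ :=
  d% (fun y => α y (extend E w y)) x v - α x (leviCivita I M (extend E w) x v)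

/-- The covariant derivative `(∇_e β)(v, w)` of a `2`-form. -/
def nablaTwo (β : Π x : M, TangentSpace I x → TangentSpace I x → ℝ) (x : M)
    (e v w : TangentSpace I x) : ℝ :=
  d% (fun y => β y (extend E v y) (extend E w y)) x e
    - β x (leviCivita I M (extend E v) x e) w - β x v (leviCivita I M (extend E w) x e)

/-- The codifferential `d* α = - ∑ i, (∇_{e i} α)(e i)` of a `1`-form. -/
def codiffOne (α : Π x : M, TangentSpace I x →L[ℝ] ℝ) (x : M) : ℝ :=
  -∑ i, nablaOne α x (frame I x i) (frame I x i)

/-- The codifferential `(d* β)(w) = - ∑ i, (∇_{e i} β)(e i, w)` of a `2`-form. -/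
def codiffTwo (β : Π x : M, TangentSpace I x → TangentSpace I x → ℝ) (x : M)
    (w : TangentSpace I x) : ℝ :=
  -∑ i, nablaTwo β x (frame I x i) (frame I x i) w

/-- The De Rham-Hodge Laplacian `□ = d d* + d* d` on `1`-forms. -/
def hodgeLaplacianOne (α : Π x : M, TangentSpace I x →L[ℝ] ℝ) (x : M) (w : TangentSpace I x) : ℝ :=
  d% (codiffOne α) x w + codiffTwo (dOne α) x w

/-- The De Rham-Hodge Laplacian on vector fields, `□ u = (□ u^♭)^♯`. -/
def hodgeLaplacian (u : Π x : M, TangentSpace I x) (x : M) : TangentSpace I x :=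
  sharp x (hodgeLaplacianOne (flat u) x)

/-- The gradient `(df)^♯` of a function. -/
def grad (f : M → ℝ) (x : M) : TangentSpace I x :=
  sharp x (d% f x)

/-- The divergence of a vector field. -/
def divergence (u : Π x : M, TangentSpace I x) (x : M) : ℝ :=
  ∑ i, ⟪leviCivita I M u x (frame I x i), frame I x i⟫

/-- The symmetric part `∇^s_X u` of `∇ u`, that is
`⟪∇^s_X u, Y⟫ = (⟪∇_X u, Y⟫ + ⟪∇_Y u, X⟫) / 2`. -/
def symGrad (u : Π x : M, TangentSpace I x) (x : M) (X : TangentSpace I x) : TangentSpace I x :=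
  (1 / 2 : ℝ) • (leviCivita I M u x X + sharp x fun Y => ⟪leviCivita I M u x Y, X⟫)

/-- The squared Hilbert-Schmidt norm `|∇ u|²` of the covariant derivative of a vector field. -/
def normSqNabla (u : Π x : M, TangentSpace I x) (x : M) : ℝ :=
  ∑ i, ‖leviCivita I M u x (frame I x i)‖ ^ 2

/-- The squared Hilbert-Schmidt norm `|∇ α|²` of the covariant derivative of a `1`-form. -/
def normSqNablaOne (α : Π x : M, TangentSpace I x →L[ℝ] ℝ) (x : M) : ℝ :=
  ∑ i, ∑ j, nablaOne α x (frame I x i) (frame I x j) ^ 2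

end Geometry

section Volume

variable {n : ℕ} {M : Type*} [TopologicalSpace M] [ChartedSpace (EuclideanSpace ℝ (Fin n)) M]

instance fact_finrank_tangentSpace (x : M) : Fact (finrank ℝ (TangentSpace (𝓡 n) x) = n) :=
  ⟨finrank_euclideanSpace_fin (𝕜 := ℝ) (n := n)⟩

variable [RiemannianBundle (fun x : M => TangentSpace (𝓡 n) x)]

/-- The volume density `√ (det g_ij)` in the chart at `x₀`, at the coordinates `y`. -/
def volumeDensity (x₀ : M) (y : EuclideanSpace ℝ (Fin n)) : ℝ :=
  √ (Matrix.of fun i j : Fin n =>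
    ⟪mfderiv 𝓘(ℝ, EuclideanSpace ℝ (Fin n)) (𝓡 n)
        (chartAt (EuclideanSpace ℝ (Fin n)) x₀).symm y (EuclideanSpace.single i (1 : ℝ)),
      mfderiv 𝓘(ℝ, EuclideanSpace ℝ (Fin n)) (𝓡 n)
        (chartAt (EuclideanSpace ℝ (Fin n)) x₀).symm y (EuclideanSpace.single j (1 : ℝ))⟫).det

/-- The Riemannian measure on the domain of the chart at `x₀`, extended by `0`. -/
def chartVolume [MeasurableSpace M] (x₀ : M) : Measure M :=
  ((volume.restrict (chartAt (EuclideanSpace ℝ (Fin n)) x₀).target).withDensity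
    fun y => ENNReal.ofReal (volumeDensity x₀ y)).map
      (chartAt (EuclideanSpace ℝ (Fin n)) x₀).symm

variable (n M) in
/-- The Riemannian measure: the chart pieces agree on overlaps, and their supremum is the measure
which restricts to each of them. -/
def riemannianVolume [MeasurableSpace M] : Measure M :=
  ⨆ x₀ : M, chartVolume (n := n) x₀

variable [IsManifold (𝓡 n) ∞ M]

/-- A choice of orientations of the tangent spaces is an orientation of `M` if the associated
volume form is continuous. -/
def IsOrientation (o : ∀ x : M, Orientation ℝ (TangentSpace (𝓡 n) x) (Fin n)) : Prop :=
  ∀ (x₀ : M) (X : Fin n → Π x : M, TangentSpace (𝓡 n) x),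
    (∀ i, ContinuousAt (fun x => TotalSpace.mk' (EuclideanSpace ℝ (Fin n)) x (X i x)) x₀) →
    ContinuousAt (fun x => (o x).volumeForm fun i => X i x) x₀

end Volume

section Fluid

variable {M : Type*} [TopologicalSpace M] [ChartedSpace (EuclideanSpace ℝ (Fin 3)) M]
  [RiemannianBundle (fun x : M => TangentSpace (𝓡 3) x)]

variable [IsManifold (𝓡 3) ∞ M]
  [IsContMDiffRiemannianBundle (𝓡 3) ∞ (EuclideanSpace ℝ (Fin 3))
    (fun x : M => TangentSpace (𝓡 3) x)]

/-- The Hodge star `*β = ∑ k, (∑ i j, β(e i, e j) vol(e i, e j, e k) / 2) e_k^♭` of a `2`-form in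
dimension three. -/
def hodgeStarTwo (o : ∀ x : M, Orientation ℝ (TangentSpace (𝓡 3) x) (Fin 3))
    (β : Π x : M, TangentSpace (𝓡 3) x → TangentSpace (𝓡 3) x → ℝ) (x : M) :
    TangentSpace (𝓡 3) x →L[ℝ] ℝ :=
  ∑ k, ((1 / 2 : ℝ) * ∑ i, ∑ j, β x (frame (𝓡 3) x i) (frame (𝓡 3) x j) *
    (o x).volumeForm ![frame (𝓡 3) x i, frame (𝓡 3) x j, frame (𝓡 3) x k]) •
      innerSL ℝ (frame (𝓡 3) x k)

/-- The vorticity `ω = * d u^♭`, a `1`-form. -/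
def vorticity (o : ∀ x : M, Orientation ℝ (TangentSpace (𝓡 3) x) (Fin 3))
    (u : Π x : M, TangentSpace (𝓡 3) x) : Π x : M, TangentSpace (𝓡 3) x →L[ℝ] ℝ :=
  hodgeStarTwo o (dOne (flat u))

/-- A smooth solution on the time interval `J` of the Navier-Stokes equation
`∂_t u + ∇_u u + ν □ u = - ∇ p`, `div u = 0`. -/
structure IsNavierStokesSolution (ν : ℝ) (J : Set ℝ) (u : ℝ → Π x : M, TangentSpace (𝓡 3) x)
    (p : ℝ → M → ℝ) : Prop where
  contMDiffOn_velocity : ContMDiffOn (𝓘(ℝ, ℝ).prod (𝓡 3)) (𝓡 3).tangent ∞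
    (fun q : ℝ × M => (⟨q.2, u q.1 q.2⟩ : TangentBundle (𝓡 3) M)) (J ×ˢ Set.univ)
  contMDiff_pressure : ∀ t ∈ J, ContMDiff (𝓡 3) 𝓘(ℝ, ℝ) ∞ (p t)
  momentum : ∀ t ∈ J, ∀ x, derivWithin (fun s => u s x) J t
    + leviCivita (𝓡 3) M (u t) x (u t x) + ν • hodgeLaplacian (u t) x = -grad (p t) x
  incompressible : ∀ t ∈ J, ∀ x, divergence (u t) x = 0

/-- A regular solution: a smooth solution whose vorticity `ω` satisfies, at each time,
`ω, ∇ω, |u| |ω| ∈ L²` and `|∇u| |ω|² ∈ L¹`, and is differentiable in time as a map into `L²`.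
On a compact manifold every smooth solution is regular. -/
structure IsRegularSolution [MeasurableSpace M]
    (o : ∀ x : M, Orientation ℝ (TangentSpace (𝓡 3) x) (Fin 3)) (ν : ℝ) (J : Set ℝ)
    (u : ℝ → Π x : M, TangentSpace (𝓡 3) x) (p : ℝ → M → ℝ) : Prop
    extends IsNavierStokesSolution ν J u p where
  integrable_vorticity : ∀ t ∈ J,
    Integrable (fun x => ‖vorticity o (u t) x‖ ^ 2) (riemannianVolume 3 M)
  integrable_nabla_vorticity : ∀ t ∈ J,
    Integrable (fun x => normSqNablaOne (vorticity o (u t)) x) (riemannianVolume 3 M)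
  integrable_velocity_vorticity : ∀ t ∈ J,
    Integrable (fun x => ‖u t x‖ ^ 2 * ‖vorticity o (u t) x‖ ^ 2) (riemannianVolume 3 M)
  integrable_nabla_velocity_vorticity : ∀ t ∈ J,
    Integrable (fun x => √ (normSqNabla (u t) x) * ‖vorticity o (u t) x‖ ^ 2)
      (riemannianVolume 3 M)
  differentiable_vorticity : ∀ t ∈ J,
    Tendsto (fun s => ∫⁻ x, ‖(s - t)⁻¹ • (vorticity o (u s) x - vorticity o (u t) x)
        - derivWithin (fun r => vorticity o (u r) x) J t‖ₑ ^ 2 ∂(riemannianVolume 3 M))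
      (𝓝[J \ {t}] t) (𝓝 0)

end Fluid

end RiemannianFluid

end

/-!
# The enstrophy identity for regular Navier-Stokes solutions on a three-manifold

Every statement is reduced to vector fields: on a differentiable field `u` the vorticity `ω` is the
`1`-form dual to `w = curl u` (`vorticity_eq`), so that `|ω| = |w|` and `|∇ω| = |∇w|`.

*The intrinsic Ricci tensor.* The connection `∇^v` differs from the Levi-Civita connection by a
tensor which is explicit in `v`. The second derivatives `∇^v_X ∇^v_Y Z` and the torsion are expanded
by the product rule; in `R^v(a, f) f + (∇^v_f T^v)(a, f)` with `|f| = 1` most of the terms cancel,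
and the sum over an orthonormal frame gives
`Ric + 2 v ⊗ v + 2 ∇^s v` in dimension three (`intrinsicRicci_eq`). The choice `v = -u / (2 ν)` is
`intrinsicRicci_velocity`.

*The pointwise balance.* On a divergence free field `□ = curl curl` (`hodgeLaplacian_eq`), and
`curl (∇_u u) = ∇_u w - ∇_w u` (`curl_leviCivita_self`); hence the curl of the momentum equation is
the vorticity equation. Its inner product with `w`, together with the Bochner formula in divergence
form (`inner_curl_curl`), gives
`⟪∂_t w, w⟫ + ν |∇w|² = ⟪∇_w u, w⟫ - ν Ric(w, w) - div Φ`
with the flux `Φ = |w|² u / 2 + ν (curl w × w - ∇_w w)` (`divergence_enstrophyFlux`).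

*The divergence integrates to zero.* By the regularity assumptions `Φ` is integrable, but `div Φ` is
not integrable a priori, because nothing is assumed about the upper bound of the Ricci curvature.
The lower bound of the Ricci curvature and the balance itself show that `div (-Φ)` is bounded below
by an integrable function. On a complete manifold closed balls are compact
(`isCompact_closedEBall`, the Hopf-Rinow theorem), so there are compactly supported cutoff functions
`χ_k → 1` with Lipschitz constants tending to zero (`exists_cutoff`). For these
`|∫ χ_k div Φ| ≤ Lip(χ_k) ∫ |Φ| → 0` (`abs_integral_mul_divergence_le`, proved in charts with
Rademacher's theorem and a partition of unity). Fatou's lemma applied to the part of `div (-Φ)`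
above its lower bound gives integrability, and dominated convergence gives `∫ div Φ = 0`
(`integrable_divergence_of_le`). In particular `Ric(w, w)` is integrable.

*The time derivative.* Time derivatives commute with the curl (`hasDerivWithinAt_curl`), so the `L²`
derivative of the vorticity is dual to `curl ∂_t u`, and the derivative of `∫ |w|²` is
`2 ∫ ⟪curl ∂_t u, w⟫` (`hasDerivWithinAt_integral_norm_sq`). The remaining terms recombine into the
intrinsic Ricci tensor by `formInner_intrinsicRicci`.
-/

open Bundle Manifold FiberBundle Module VectorField MeasureTheory Filter
open scoped ContDiff Topology RealInnerProductSpace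

set_option linter.unusedSectionVars false
set_option linter.style.haveILetI false

noncomputable section

namespace RiemannianFluid

/-! ### Metric traces -/

section Traces

variable {V : Type*} [NormedAddCommGroup V] [InnerProductSpace ℝ V] {ι κ : Type*} [Fintype ι]
  [Fintype κ] {W : Type*} [AddCommGroup W] [Module ℝ W]

/-- The metric trace of a bilinear map does not depend on the orthonormal basis. -/
theorem sum_orthonormalBasis_eq (B : V →ₗ[ℝ] V →ₗ[ℝ] W) (b : OrthonormalBasis ι ℝ V)
    (c : OrthonormalBasis κ ℝ V) : ∑ i, B (b i) (b i) = ∑ k, B (c k) (c k) := by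
  have h1 : ∀ i, B (b i) (b i) = ∑ k, ∑ l, (⟪c k, b i⟫ * ⟪b i, c l⟫) • B (c k) (c l) := by
    intro i
    conv_lhs => rw [← c.sum_repr' (b i)]
    simp only [map_sum, map_smul, LinearMap.sum_apply, LinearMap.smul_apply, Finset.smul_sum,
      smul_smul]
    rw [Finset.sum_comm]
    simp only [real_inner_comm (b i)]
    refine Finset.sum_congr rfl fun k _ => Finset.sum_congr rfl fun l _ => by rw [mul_comm]
  simp only [h1]
  rw [Finset.sum_comm]
  refine Finset.sum_congr rfl fun k _ => ?_
  rw [Finset.sum_comm]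
  classical
  simp only [← Finset.sum_smul, b.sum_inner_mul_inner, c.inner_eq_ite, ite_smul, one_smul,
    zero_smul, Finset.sum_ite_eq, Finset.mem_univ, if_true]

end Traces

section General

variable {E : Type*} [NormedAddCommGroup E] [NormedSpace ℝ E] [FiniteDimensional ℝ E]
  {H : Type*} [TopologicalSpace H] {I : ModelWithCorners ℝ E H}
  {M : Type*} [TopologicalSpace M] [ChartedSpace H M] [IsManifold I ∞ M]

/-! ### Calculus of functions and vector fields -/

theorem mdiffAt_of_smoothAt {X : Π x : M, TangentSpace I x} {x : M}
    (hX : CMDiffAt ∞ (T% X) x) : MDiffAt (T% X) x :=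
  hX.mdifferentiableAt (by simp)

theorem eventually_mdiffAt {X : Π x : M, TangentSpace I x} {x : M}
    (hX : CMDiffAt ∞ (T% X) x) : ∀ᶠ y in 𝓝 x, MDiffAt (T% X) y := by
  have h : CMDiffAt 1 (T% X) x := hX.of_le (by simp)
  filter_upwards [(contMDiffAt_iff_contMDiffAt_nhds (by simp)).1 h] with y hy
  exact hy.mdifferentiableAt one_ne_zero

theorem eventually_mdiffAt_fun {f : M → ℝ} {x : M}
    (hf : CMDiffAt ∞ f x) : ∀ᶠ y in 𝓝 x, MDiffAt f y := by
  have h : CMDiffAt 1 f x := hf.of_le (by simp)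
  filter_upwards [(contMDiffAt_iff_contMDiffAt_nhds (by simp)).1 h] with y hy
  exact hy.mdifferentiableAt one_ne_zero

/-- The differential of a real function, as a linear form on the tangent space, is local. -/
theorem mvfderiv_congr {f g : M → ℝ} {x : M} (h : f =ᶠ[𝓝 x] g) : d% f x = d% g x := by
  ext v
  have h1 : (mfderiv% f x : TangentSpace I x → ℝ) v = (mfderiv% g x : TangentSpace I x → ℝ) v := by
    rw [h.mfderiv_eq]; rfl
  exact h1

theorem mvfderiv_fun_sum {ι : Type*} (s : Finset ι) {f : ι → M → ℝ} {x : M}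
    (hf : ∀ i ∈ s, MDiffAt (f i) x) :
    d% (fun y => ∑ i ∈ s, f i y) x = ∑ i ∈ s, d% (f i) x := by
  have h : MDiffAt (fun y => ∑ i ∈ s, f i y) x ∧
      d% (fun y => ∑ i ∈ s, f i y) x = ∑ i ∈ s, d% (f i) x := by
    classical
    induction s using Finset.induction_on with
    | empty => simpa using ⟨mdifferentiableAt_const, mvfderiv_const (I := I) (M := M) (0 : ℝ)⟩
    | insert i s hi ih =>
      have h1 := hf i (Finset.mem_insert_self i s)
      obtain ⟨h2, h3⟩ := ih fun j hj => hf j (Finset.mem_insert_of_mem hj)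
      simp only [Finset.sum_insert hi]
      exact ⟨h1.add h2, by rw [mvfderiv_fun_add h1 h2, h3]⟩
  exact h.2

/-- The directional derivative of a smooth function along a smooth vector field is smooth. -/
theorem smoothAt_dir {f : M → ℝ} {X : Π x : M, TangentSpace I x} {x : M}
    (hf : CMDiffAt ∞ f x) (hX : CMDiffAt ∞ (T% X) x) :
    CMDiffAt ∞ (fun y => d% f y (X y)) x := by
  have h1 := hf.mfderiv_const (m := ∞) (by simp)
  have h2 := ContMDiffAt.clm_apply_of_inCoordinates (E₁ := fun x : M => TangentSpace I x)
    (E₂ := fun x : ℝ => TangentSpace 𝓘(ℝ, ℝ) x)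
    (b₁ := id) (b₂ := f) (v := X) (ϕ := fun y => mfderiv% f y) h1 hX hf
  rw [contMDiffAt_totalSpace] at h2
  have h3 := h2.2
  refine h3.congr_of_eventuallyEq ?_
  filter_upwards with y
  simp [mvfderiv]
  rfl

theorem smoothAt_mlieBracket {X Y : Π x : M, TangentSpace I x} {x : M}
    (hX : CMDiffAt ∞ (T% X) x) (hY : CMDiffAt ∞ (T% Y) x) :
    CMDiffAt ∞ (T% (mlieBracket I X Y)) x := by
  haveI : IsManifold I (((⊤ : ℕ∞) : WithTop ℕ∞) + 1) M := ‹IsManifold I ∞ M›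
  haveI : IsManifold I (minSmoothness ℝ 2) M :=
    IsManifold.of_le (n := ∞) (by simpa using ENat.LEInfty.out)
  haveI : CompleteSpace E := FiniteDimensional.complete ℝ E
  exact ContMDiffAt.mlieBracket_vectorField (n := (⊤ : ℕ∞)) (m := ⊤) hX hY (by simp)

/-- `[X, Y] f = X (Y f) - Y (X f)`. Both sides are the coefficient of `Z` in the Jacobi identity for
`X`, `Y`, `f Z`, where `Z` does not vanish at `x`. -/
theorem mvfderiv_mlieBracket {f : M → ℝ} {X Y : Π x : M, TangentSpace I x} {x : M}
    (hf : CMDiffAt ∞ f x) (hX : CMDiffAt ∞ (T% X) x) (hY : CMDiffAt ∞ (T% Y) x) :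
    d% f x (mlieBracket I X Y x) =
      d% (fun y => d% f y (Y y)) x (X x) - d% (fun y => d% f y (X y)) x (Y x) := by
  haveI : CompleteSpace E := FiniteDimensional.complete ℝ E
  -- in dimension zero there is no such `Z`, but then all fields vanish
  by_cases hE : ∀ v : TangentSpace I x, v = 0
  · rw [hE (mlieBracket I X Y x), hE (X x), hE (Y x)]; simp
  push Not at hE
  obtain ⟨v, hv⟩ := hE
  set Z : Π y : M, TangentSpace I y := extend E v
  have hZ : CMDiffAt ∞ (T% Z) x := contMDiffAt_extend I E v
  have hZx : Z x = v := extend_apply_self E v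
  have h2 : minSmoothness ℝ 2 ≤ (∞ : WithTop ℕ∞) := by simpa using ENat.LEInfty.out
  haveI : IsManifold I (minSmoothness ℝ 3) M :=
    IsManifold.of_le (n := ∞) (by simpa using ENat.LEInfty.out)
  have J1 := leibniz_identity_mlieBracket_apply (hX.of_le h2) (hY.of_le h2) (hZ.of_le h2)
  have J2 := leibniz_identity_mlieBracket_apply (hX.of_le h2) (hY.of_le h2)
    ((hf.smul_section hZ).of_le h2)
  have key : ∀ {X : Π x : M, TangentSpace I x}, mlieBracket I X (f • Z) =ᶠ[𝓝 x]
      (fun y => d% f y (X y)) • Z + f • mlieBracket I X Z := by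
    intro X
    filter_upwards [eventually_mdiffAt hZ, eventually_mdiffAt_fun hf] with y h1 h2
    rw [mlieBracket_smul_right h2 h1]; rfl
  have hfd := hf.mdifferentiableAt (by simp)
  -- the coefficients of `Z` are compared after expanding each double bracket by the Leibniz rule
  have exp : ∀ {X Y : Π x : M, TangentSpace I x}, CMDiffAt ∞ (T% X) x → CMDiffAt ∞ (T% Y) x →
      mlieBracket I X (mlieBracket I Y (f • Z)) x =
      (d% (fun y => d% f y (Y y)) x (X x) • v + d% f x (Y x) • mlieBracket I X Z x) +
      (d% f x (X x) • mlieBracket I Y Z x + f x • mlieBracket I X (mlieBracket I Y Z) x) := by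
    intro X Y hX hY
    have hd := (smoothAt_dir hf hY).mdifferentiableAt (by simp)
    have hb := mdiffAt_of_smoothAt (smoothAt_mlieBracket hY hZ)
    rw [Filter.EventuallyEq.mlieBracket_vectorField_eq (EventuallyEq.refl _ X) key,
      mlieBracket_add_right (hd.smul_section (mdiffAt_of_smoothAt hZ)) (hfd.smul_section hb),
      mlieBracket_smul_right hd (mdiffAt_of_smoothAt hZ), mlieBracket_smul_right hfd hb, hZx]
  rw [exp hX hY, exp hY hX, key.self_of_nhds, J1] at J2
  simp only [Pi.add_apply, Pi.smul_apply', hZx] at J2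
  have : (d% f x (mlieBracket I X Y x) - (d% (fun y => d% f y (Y y)) x (X x)
    - d% (fun y => d% f y (X y)) x (Y x))) • v = 0 := by
    linear_combination (norm := module) (-1 : ℝ) • J2
  rcases smul_eq_zero.1 this with h | h
  · linarith
  · exact absurd h hv

/-! ### Smooth orthonormal frames -/

variable [RiemannianBundle (fun x : M => TangentSpace I x)]
  [IsContMDiffRiemannianBundle I ∞ E (fun x : M => TangentSpace I x)]

theorem smoothAt_inner {X Y : Π x : M, TangentSpace I x} {x : M}
    (hX : CMDiffAt ∞ (T% X) x) (hY : CMDiffAt ∞ (T% Y) x) :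
    CMDiffAt ∞ (fun y => ⟪X y, Y y⟫) x :=
  ContMDiffAt.inner_bundle (IB := I) (F := E) (E := fun x : M => TangentSpace I x)
    (b := id) (v := X) (w := Y) hX hY

theorem finrank_tangentSpace (x : M) : finrank ℝ (TangentSpace I x) = finrank ℝ E := rfl

/-- A smooth family of bases can be orthonormalized smoothly, by the Gram-Schmidt process. -/
theorem exists_smooth_orthonormalBasis {n : ℕ} {S : Fin n → Π x : M, TangentSpace I x} {x : M}
    (hS : ∀ i, CMDiffAt ∞ (T% (S i)) x) (hli : ∀ᶠ y in 𝓝 x, LinearIndependent ℝ fun i => S i y)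
    (hn : finrank ℝ E = n) :
    ∃ F : Fin n → Π x : M, TangentSpace I x, (∀ i, CMDiffAt ∞ (T% (F i)) x) ∧
      ∀ᶠ y in 𝓝 x, ∃ b : OrthonormalBasis (Fin n) ℝ (TangentSpace I y), ∀ i, b i = F i y := by
  let G : Fin n → Π y : M, TangentSpace I y := fun i y =>
    InnerProductSpace.gramSchmidt ℝ (fun j => S j y) i
  -- the denominators of the Gram-Schmidt process do not vanish near `x`
  have hG0 : ∀ i, G i x ≠ 0 := fun i => InnerProductSpace.gramSchmidt_ne_zero i hli.self_of_nhds
  have hG : ∀ i, CMDiffAt ∞ (T% (G i)) x := by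
    intro i
    induction i using WellFoundedLT.induction with
    | ind i ih =>
      have h1 : G i = fun y => (S i - fun y => ∑ j ∈ Finset.Iio i,
          ((fun y => ⟪G j y, S i y⟫ / ⟪G j y, G j y⟫) • G j) y) y := by
        funext y
        have := InnerProductSpace.gramSchmidt_def'' ℝ (fun j => S j y) i
        simp only [Pi.sub_apply, Pi.smul_apply']
        rw [eq_sub_iff_add_eq]
        simp only [real_inner_self_eq_norm_sq]
        exact this.symm
      rw [h1]
      refine ContMDiffAt.sub_section (hS i) (ContMDiffAt.sum_section fun j hj => ?_)
      have hj := ih j (Finset.mem_Iio.1 hj)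
      refine ContMDiffAt.smul_section ?_ hj
      exact (smoothAt_inner hj (hS i)).div₀ (smoothAt_inner hj hj)
        (by simpa using hG0 j)
  refine ⟨fun i => (fun y => (√ ⟪G i y, G i y⟫)⁻¹) • G i, fun i => ?_, ?_⟩
  · refine ContMDiffAt.smul_section ?_ (hG i)
    have h0 : ⟪G i x, G i x⟫ ≠ 0 := by simpa using hG0 i
    have h1 := smoothAt_inner (hG i) (hG i)
    have h2 : CMDiffAt ∞ (fun y => √ ⟪G i y, G i y⟫) x :=
      (Real.contDiffAt_sqrt h0).contMDiffAt.comp x h1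
    refine h2.inv₀ ?_
    rw [Real.sqrt_ne_zero']
    exact lt_of_le_of_ne real_inner_self_nonneg (Ne.symm h0)
  · filter_upwards [hli] with y hy
    have ho := InnerProductSpace.gramSchmidtNormed_orthonormal (𝕜 := ℝ) hy
    have hc : Fintype.card (Fin n) = finrank ℝ (TangentSpace I y) := by
      rw [finrank_tangentSpace, hn, Fintype.card_fin]
    refine ⟨OrthonormalBasis.mk ho ?_, fun i => ?_⟩
    · exact (ho.linearIndependent.span_eq_top_of_card_eq_finrank' hc).ge
    · simp [InnerProductSpace.gramSchmidtNormed, G]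

/-- Around each point there is a smooth orthonormal frame. -/
theorem exists_orthonormal_frame {n : ℕ} (hn : finrank ℝ E = n) (x : M) :
    ∃ F : Fin n → Π x : M, TangentSpace I x, (∀ i, CMDiffAt ∞ (T% (F i)) x) ∧
      ∀ᶠ y in 𝓝 x, ∃ b : OrthonormalBasis (Fin n) ℝ (TangentSpace I y), ∀ i, b i = F i y := by
  let b : Basis (Fin n) ℝ E := finBasisOfFinrankEq ℝ E hn
  let e := trivializationAt E (fun x : M => TangentSpace I x) x
  have he : x ∈ e.baseSet := mem_baseSet_trivializationAt' x
  refine exists_smooth_orthonormalBasis (S := e.localFrame b)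
    (fun i => contMDiffAt_localFrame_of_mem (n := ∞) e b i he) ?_ hn
  filter_upwards [e.open_baseSet.mem_nhds he] with y hy
  exact (e.isLocalFrameOn_localFrame_baseSet I ∞ b).linearIndependent hy

/-- A vector field is smooth if its inner products with smooth vector fields are. -/
theorem smoothAt_of_inner {Y : Π x : M, TangentSpace I x} {x : M}
    (h : ∀ Z : Π x : M, TangentSpace I x, CMDiffAt ∞ (T% Z) x →
      CMDiffAt ∞ (fun y => ⟪Y y, Z y⟫) x) : CMDiffAt ∞ (T% Y) x := by
  obtain ⟨F, hF, hb⟩ := exists_orthonormal_frame (I := I) rfl x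
  have h1 : CMDiffAt ∞ (T% (fun y => ∑ i, ((fun y => ⟪Y y, F i y⟫) • F i) y)) x :=
    ContMDiffAt.sum_section fun i _ => (h _ (hF i)).smul_section (hF i)
  refine h1.congr_of_eventuallyEq ?_
  filter_upwards [hb] with y ⟨b, hb⟩
  congr 1
  conv_lhs => rw [← b.sum_repr' (Y y)]
  refine Finset.sum_congr rfl fun i _ => ?_
  simp [hb, real_inner_comm]

/-! ### The Levi-Civita connection -/

variable {v X Y Z W : Π x : M, TangentSpace I x} {x : M}

local notation "∇ᴸ" => leviCivita I M

theorem inner_leviCivita (hX : MDiffAt (T% X) x) (hY : MDiffAt (T% Y) x)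
    (hZ : MDiffAt (T% Z) x) : 2 * ⟪∇ᴸ Y x (X x), Z x⟫ = koszul X Y Z x :=
  inner_leviCivitaFun hX hY hZ

/-- The Levi-Civita connection preserves smoothness, as its inner products with smooth fields are
given by the Koszul formula. -/
theorem smoothAt_leviCivita (hX : CMDiffAt ∞ (T% X) x) (hY : CMDiffAt ∞ (T% Y) x) :
    CMDiffAt ∞ (T% (fun y => ∇ᴸ Y y (X y))) x := by
  refine smoothAt_of_inner fun Z hZ => ?_
  have h1 : CMDiffAt ∞ (fun y => (1 / 2 : ℝ) * koszul X Y Z y) x := by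
    refine contMDiffAt_const.mul ?_
    unfold koszul
    exact ((((smoothAt_dir (smoothAt_inner hY hZ) hX).add
      (smoothAt_dir (smoothAt_inner hX hZ) hY)).sub
      (smoothAt_dir (smoothAt_inner hX hY) hZ)).add
      (smoothAt_inner (smoothAt_mlieBracket hX hY) hZ)).sub
      (smoothAt_inner (smoothAt_mlieBracket hX hZ) hY) |>.sub
      (smoothAt_inner (smoothAt_mlieBracket hY hZ) hX)
  refine h1.congr_of_eventuallyEq ?_
  filter_upwards [eventually_mdiffAt hX, eventually_mdiffAt hY, eventually_mdiffAt hZ]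
    with y h1 h2 h3
  linarith [inner_leviCivita h1 h2 h3]

/-- The Levi-Civita connection is metric. -/
theorem mvfderiv_inner (hY : MDiffAt (T% Y) x) (hZ : MDiffAt (T% Z) x) (v : TangentSpace I x) :
    d% (fun y => ⟪Y y, Z y⟫) x v = ⟪∇ᴸ Y x v, Z x⟫ + ⟪Y x, ∇ᴸ Z x v⟫ := by
  have h := (CovariantDerivative.isMetricCompatible_iff _).1
    (leviCivita_isMetricCompatible (I := I) (M := M)) (mdifferentiableAt_extend I E v)
    (X := extend E v) hY hZ
  simpa using h

/-- The Levi-Civita connection is torsion free. -/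
theorem mlieBracket_eq_leviCivita (hX : MDiffAt (T% X) x) (hY : MDiffAt (T% Y) x) :
    mlieBracket I X Y x = ∇ᴸ Y x (X x) - ∇ᴸ X x (Y x) :=
  ((CovariantDerivative.torsion_eq_zero_iff _).1 leviCivita_torsion hX hY).symm

theorem leviCivita_add (hY : MDiffAt (T% Y) x) (hZ : MDiffAt (T% Z) x) :
    ∇ᴸ (Y + Z) x = ∇ᴸ Y x + ∇ᴸ Z x :=
  (leviCivita I M).isCovariantDerivativeOnUniv.add hY hZ

theorem leviCivita_smul {f : M → ℝ} (hf : MDiffAt f x) (hY : MDiffAt (T% Y) x)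
    (v : TangentSpace I x) :
    ∇ᴸ (f • Y) x v = f x • ∇ᴸ Y x v + d% f x v • Y x := by
  have := (leviCivita I M).isCovariantDerivativeOnUniv.leibniz hY hf
  change leviCivita I M (f • Y) x = _ at this
  rw [this]; rfl

theorem leviCivita_congr (hY : MDiffAt (T% Y) x) (hZ : MDiffAt (T% Z) x) (h : Y =ᶠ[𝓝 x] Z) :
    ∇ᴸ Y x = ∇ᴸ Z x :=
  (leviCivita I M).isCovariantDerivativeOnUniv.congr_of_eventuallyEq hY hZ univ_mem h

theorem leviCivita_const_smul (c : ℝ) (hY : MDiffAt (T% Y) x) :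
    ∇ᴸ (c • Y) x = c • ∇ᴸ Y x :=
  (leviCivita I M).isCovariantDerivativeOnUniv.smul_const c hY

theorem leviCivita_sub (hY : MDiffAt (T% Y) x) (hZ : MDiffAt (T% Z) x) :
    ∇ᴸ (Y - Z) x = ∇ᴸ Y x - ∇ᴸ Z x := by
  have h : Y - Z = Y + (-1 : ℝ) • Z := by funext y; simp [sub_eq_add_neg]
  rw [h, leviCivita_add hY hZ.smul_const_section, leviCivita_const_smul _ hZ]
  simp [sub_eq_add_neg]

/-! ### Curvature -/

theorem curvature_swap (cov : CovariantDerivative I E (fun x : M => TangentSpace I x)) :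
    curvature cov X Y Z x = -curvature cov Y X Z x := by
  unfold curvature
  rw [mlieBracket_swap_apply (V := X) (W := Y), map_neg]
  module

/-- The curvature operator `R(X, Y)` is skew: the second derivatives of `⟪Z, W⟫` in the directions
`X` and `Y` commute up to the derivative along `[X, Y]`. -/
theorem inner_curvature_swap (hX : CMDiffAt ∞ (T% X) x) (hY : CMDiffAt ∞ (T% Y) x)
    (hZ : CMDiffAt ∞ (T% Z) x) (hW : CMDiffAt ∞ (T% W) x) :
    ⟪curvature ∇ᴸ X Y Z x, W x⟫ = -⟪curvature ∇ᴸ X Y W x, Z x⟫ := by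
  have key : ∀ {X Y : Π x : M, TangentSpace I x}, CMDiffAt ∞ (T% X) x → CMDiffAt ∞ (T% Y) x →
      d% (fun y => d% (fun y => ⟪Z y, W y⟫) y (Y y)) x (X x) =
      (⟪∇ᴸ (fun y => ∇ᴸ Z y (Y y)) x (X x), W x⟫ + ⟪∇ᴸ Z x (Y x), ∇ᴸ W x (X x)⟫) +
      (⟪∇ᴸ Z x (X x), ∇ᴸ W x (Y x)⟫ + ⟪Z x, ∇ᴸ (fun y => ∇ᴸ W y (Y y)) x (X x)⟫) := by
    intro X Y hX hY
    have h1 : (fun y => d% (fun y => ⟪Z y, W y⟫) y (Y y)) =ᶠ[𝓝 x]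
        fun y => ⟪∇ᴸ Z y (Y y), W y⟫ + ⟪Z y, ∇ᴸ W y (Y y)⟫ := by
      filter_upwards [eventually_mdiffAt hZ, eventually_mdiffAt hW] with y h1 h2
      exact mvfderiv_inner h1 h2 _
    have hZY := smoothAt_leviCivita hY hZ
    have hWY := smoothAt_leviCivita hY hW
    rw [mvfderiv_congr h1, mvfderiv_fun_add ((smoothAt_inner hZY hW).mdifferentiableAt (by simp))
      ((smoothAt_inner hZ hWY).mdifferentiableAt (by simp)), add_apply,
      mvfderiv_inner (mdiffAt_of_smoothAt hZY) (mdiffAt_of_smoothAt hW),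
      mvfderiv_inner (mdiffAt_of_smoothAt hZ) (mdiffAt_of_smoothAt hWY)]
  have h := mvfderiv_mlieBracket (smoothAt_inner hZ hW) hX hY
  rw [key hX hY, key hY hX, mvfderiv_inner (mdiffAt_of_smoothAt hZ) (mdiffAt_of_smoothAt hW)] at h
  unfold curvature
  simp only [inner_sub_left]
  simp only [real_inner_comm (Z x)] at h ⊢
  linarith

/-- Here `X` is only differentiable, in contrast to `smoothAt_leviCivita`; this is what the
tensoriality of the curvature requires. -/
theorem mdiffAt_leviCivita (hX : MDiffAt (T% X) x) (hY : CMDiffAt ∞ (T% Y) x) :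
    MDiffAt (T% (fun y => ∇ᴸ Y y (X y))) x := by
  obtain ⟨F, hF, hb⟩ := exists_orthonormal_frame (I := I) rfl x
  have h1 : MDiffAt (T% (fun y => ∑ i, ((fun y => ⟪X y, F i y⟫) • fun y => ∇ᴸ Y y (F i y)) y)) x :=
    MDifferentiableAt.sum_section fun i _ =>
      (mdifferentiableAt_inner hX (mdiffAt_of_smoothAt (hF i))).smul_section
        (mdiffAt_of_smoothAt (smoothAt_leviCivita (hF i) hY))
  refine h1.congr_of_eventuallyEq ?_
  filter_upwards [hb] with y ⟨b, hb⟩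
  congr 1
  conv_lhs => rw [← b.sum_repr' (X y)]
  simp [hb, real_inner_comm]

/-- The curvature is tensorial in its first argument. -/
theorem tensorialAt_curvature (hZ : CMDiffAt ∞ (T% Z) x) :
    TensorialAt I E (fun X : Π x : M, TangentSpace I x => curvature ∇ᴸ X Y Z x) x := by
  have hd := fun (X : Π x : M, TangentSpace I x) (hX : MDiffAt (T% X) x) => mdiffAt_leviCivita hX hZ
  refine ⟨fun {f X} hf hX => ?_, fun {X X'} hX hX' => ?_⟩
  · have h1 : (fun y => ∇ᴸ Z y ((f • X) y)) = f • fun y => ∇ᴸ Z y (X y) := by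
      funext y; simp
    unfold curvature
    rw [h1, leviCivita_smul hf (hd X hX), mlieBracket_smul_left hf hX]
    simp
    module
  · have h1 : (fun y => ∇ᴸ Z y ((X + X') y)) =
        (fun y => ∇ᴸ Z y (X y)) + fun y => ∇ᴸ Z y (X' y) := by
      funext y; simp
    unfold curvature
    rw [h1, leviCivita_add (hd X hX) (hd X' hX'), mlieBracket_add_left hX hX']
    simp
    module

/-! ### The Ricci tensor -/

/-- The trace of an endomorphism of a tangent space may be computed in any orthonormal basis. -/
theorem sum_inner_orthonormalBasis_eq {ι κ : Type*} [Fintype ι] [Fintype κ]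
    (b : OrthonormalBasis ι ℝ (TangentSpace I x)) (c : OrthonormalBasis κ ℝ (TangentSpace I x))
    (A : TangentSpace I x →L[ℝ] TangentSpace I x) :
    ∑ i, ⟪A (b i), b i⟫ = ∑ i, ⟪A (c i), c i⟫ :=
  sum_orthonormalBasis_eq
    ((innerₗ (TangentSpace I x)).comp (A : TangentSpace I x →ₗ[ℝ] TangentSpace I x)) b c

theorem divergence_eq {ι : Type*} [Fintype ι] (b : OrthonormalBasis ι ℝ (TangentSpace I x)) :
    divergence X x = ∑ i, ⟪∇ᴸ X x (b i), b i⟫ :=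
  sum_inner_orthonormalBasis_eq _ b _

/-- The Ricci curvature `Ric(W, W)` in any smooth frame which is orthonormal at `x`. The definition
of `ricci` uses the local extensions of tangent vectors; tensoriality allows to replace them. -/
theorem inner_ricci_self {ι : Type*} [Fintype ι] (hW : CMDiffAt ∞ (T% W) x)
    {F : ι → Π x : M, TangentSpace I x} (hF : ∀ i, CMDiffAt ∞ (T% (F i)) x)
    (b : OrthonormalBasis ι ℝ (TangentSpace I x)) (hb : ∀ i, b i = F i x) :
    ⟪ricci ∇ᴸ x (W x), W x⟫ = -∑ i, ⟪curvature ∇ᴸ W (F i) W x, b i⟫ := by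
  have hWm := mdiffAt_of_smoothAt hW
  have hext : ∀ v : TangentSpace I x, CMDiffAt ∞ (T% (extend E v : Π y : M, TangentSpace I y)) x :=
    fun v => contMDiffAt_extend I E v
  set R := TensorialAt.mkHom (I := I) (F := E)
    (fun X : Π x : M, TangentSpace I x => curvature ∇ᴸ X W W x) x (tensorialAt_curvature hW)
  have hR : ∀ Y : Π x : M, TangentSpace I x, CMDiffAt ∞ (T% Y) x →
      curvature ∇ᴸ W Y W x = -R (Y x) := fun Y hY => by
    rw [curvature_swap, TensorialAt.mkHom_apply _ (mdiffAt_of_smoothAt hY)]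
  have h1 : ∑ i, ⟪curvature ∇ᴸ W (F i) W x, b i⟫ = -∑ i, ⟪R (b i), b i⟫ := by
    simp [hR _ (hF _), hb]
  rw [h1, sum_inner_orthonormalBasis_eq b (frame I x), neg_neg, ricci, sum_inner]
  refine Finset.sum_congr rfl fun i _ => ?_
  have h2 := (tensorialAt_curvature (Y := extend E (frame I x i)) (hext (frame I x i))).pointwise
    (mdifferentiableAt_extend I E (W x)) hWm (extend_apply_self E (W x))
  rw [h2, inner_curvature_swap hW (hext _) (hext _) hW, hR _ (hext _), extend_apply_self]
  simp

/-- `div (∇_W W) = Ric(W, W) + tr ((∇ W)²) + W (div W)`: contraction of the Ricci identity. The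
divergence is computed in a smooth orthonormal frame, whose connection coefficients drop out because
they are skew. -/
theorem divergence_leviCivita_self {ι : Type*} [Fintype ι]
    (b : OrthonormalBasis ι ℝ (TangentSpace I x)) (hW : CMDiffAt ∞ (T% W) x) :
    divergence (fun y => ∇ᴸ W y (W y)) x =
      ⟪ricci ∇ᴸ x (W x), W x⟫ + ∑ i, ⟪∇ᴸ W x (∇ᴸ W x (b i)), b i⟫
        + d% (divergence W) x (W x) := by
  obtain ⟨F, hF, hFb⟩ := exists_orthonormal_frame (I := I) rfl x
  obtain ⟨c, hc⟩ := hFb.self_of_nhds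
  have hFm := fun i => mdiffAt_of_smoothAt (hF i)
  have hWm := mdiffAt_of_smoothAt hW
  have hWF := fun i => mdiffAt_of_smoothAt (smoothAt_leviCivita (hF i) hW)
  have htr := sum_inner_orthonormalBasis_eq b c ((∇ᴸ W x).comp (∇ᴸ W x))
  simp only [ContinuousLinearMap.comp_apply] at htr
  rw [htr, inner_ricci_self hW hF c hc,
    divergence_eq c]
  have hdiv : d% (divergence W) x (W x) =
      ∑ i, (⟪∇ᴸ (fun y => ∇ᴸ W y (F i y)) x (W x), F i x⟫ +
        ⟪∇ᴸ W x (F i x), ∇ᴸ (F i) x (W x)⟫) := by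
    have h1 : divergence W =ᶠ[𝓝 x] fun y => ∑ i, ⟪∇ᴸ W y (F i y), F i y⟫ := by
      filter_upwards [hFb] with y ⟨b', hb'⟩
      simp [divergence_eq b', hb']
    rw [mvfderiv_congr h1]
    rw [mvfderiv_fun_sum _ fun i _ => mdifferentiableAt_inner (hWF i) (hFm i), sum_apply]
    exact Finset.sum_congr rfl fun i _ => mvfderiv_inner (hWF i) (hFm i) _
  -- the connection coefficients `⟪∇_W F i, F j⟫` are antisymmetric
  have hθ : ∀ i j, ⟪∇ᴸ (F i) x (W x), c j⟫ = -⟪∇ᴸ (F j) x (W x), c i⟫ := by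
    intro i j
    have h1 := mvfderiv_inner (hFm i) (hFm j) (W x)
    have h2 : (fun y => ⟪F i y, F j y⟫) =ᶠ[𝓝 x] fun _ => if i = j then 1 else 0 := by
      filter_upwards [hFb] with y ⟨b', hb'⟩
      rw [← hb', ← hb', b'.inner_eq_ite]
    rw [mvfderiv_congr h2, mvfderiv_const, real_inner_comm _ (F i x)] at h1
    simp only [hc, zero_apply] at h1 ⊢
    linarith
  have hskew : ∑ i, (⟪∇ᴸ W x (∇ᴸ (F i) x (W x)), c i⟫ + ⟪∇ᴸ W x (c i), ∇ᴸ (F i) x (W x)⟫) = 0 := by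
    have e1 : ∀ i, ⟪∇ᴸ W x (∇ᴸ (F i) x (W x)), c i⟫ + ⟪∇ᴸ W x (c i), ∇ᴸ (F i) x (W x)⟫ =
        ∑ j, (⟪∇ᴸ (F i) x (W x), c j⟫ * ⟪∇ᴸ W x (c j), c i⟫ +
          ⟪∇ᴸ (F i) x (W x), c j⟫ * ⟪∇ᴸ W x (c i), c j⟫) := by
      intro i
      conv_lhs => rw [← c.sum_repr' (∇ᴸ (F i) x (W x))]
      simp only [map_sum, map_smul, sum_inner, inner_sum, inner_smul_left, inner_smul_right,
        Finset.sum_add_distrib, conj_trivial]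
      simp only [real_inner_comm (c _) (∇ᴸ (F i) x (W x))]
    simp only [e1, Finset.sum_add_distrib]
    rw [Finset.sum_comm (f := fun i j => ⟪∇ᴸ (F i) x (W x), c j⟫ * ⟪∇ᴸ W x (c i), c j⟫),
      ← Finset.sum_add_distrib]
    refine Finset.sum_eq_zero fun i _ => ?_
    rw [← Finset.sum_add_distrib]
    refine Finset.sum_eq_zero fun j _ => ?_
    rw [hθ j i]; ring
  rw [hdiv]
  have hcurv : ∀ i, ⟪curvature ∇ᴸ W (F i) W x, c i⟫ =
      ⟪∇ᴸ (fun y => ∇ᴸ W y (F i y)) x (W x), F i x⟫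
      - ⟪∇ᴸ (fun y => ∇ᴸ W y (W y)) x (c i), c i⟫
      - (⟪∇ᴸ W x (∇ᴸ (F i) x (W x)), c i⟫ - ⟪∇ᴸ W x (∇ᴸ W x (c i)), c i⟫) := by
    intro i
    unfold curvature
    rw [mlieBracket_eq_leviCivita hWm (hFm i), map_sub, inner_sub_left, inner_sub_left,
      inner_sub_left, hc]
  simp only [hcurv, Finset.sum_add_distrib, Finset.sum_sub_distrib] at hskew ⊢
  simp only [← hc] at *
  linarith

/-! ### The intrinsic Ricci tensor of the drift connection -/

/-- In dimension three the coefficient `2 / (n - 1)` is `1`. -/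
theorem driftConnection_apply (hE : finrank ℝ E = 3) (y : M) (a : TangentSpace I y) :
    driftConnection v Y y a = ∇ᴸ Y y a - (⟪Y y, v y⟫ • a - ⟪a, Y y⟫ • v y) := by
  have h : driftConnection v Y y a = ∇ᴸ Y y a +
      (-(2 / ((finrank ℝ E : ℝ) - 1))) • driftTensor v y (Y y) a := rfl
  rw [h, hE, driftTensor_apply]
  norm_num
  module

/-- The derivative of `∇^v_Y Z` in terms of the Levi-Civita connection. -/
theorem driftConnection_driftConnection (hE : finrank ℝ E = 3) (hv : CMDiffAt ∞ (T% v) x)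
    (hY : CMDiffAt ∞ (T% Y) x) (hZ : CMDiffAt ∞ (T% Z) x) (a : TangentSpace I x) :
    driftConnection v (fun y => driftConnection v Z y (Y y)) x a =
      ∇ᴸ (fun y => ∇ᴸ Z y (Y y)) x a
      - (⟪Z x, v x⟫ • ∇ᴸ Y x a + (⟪∇ᴸ Z x a, v x⟫ + ⟪Z x, ∇ᴸ v x a⟫) • Y x)
      + (⟪Y x, Z x⟫ • ∇ᴸ v x a + (⟪∇ᴸ Y x a, Z x⟫ + ⟪Y x, ∇ᴸ Z x a⟫) • v x)
      - (⟪driftConnection v Z x (Y x), v x⟫ • a - ⟪a, driftConnection v Z x (Y x)⟫ • v x) := by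
  have h1 : (fun y => driftConnection v Z y (Y y)) =
      ((fun y => ∇ᴸ Z y (Y y)) - (fun y => ⟪Z y, v y⟫) • Y) + (fun y => ⟪Y y, Z y⟫) • v := by
    funext y
    rw [driftConnection_apply hE]
    simp [sub_add]
  have hZY := mdiffAt_of_smoothAt (smoothAt_leviCivita hY hZ)
  have hf := (smoothAt_inner hZ hv).mdifferentiableAt (n := ∞) (by simp)
  have hg := (smoothAt_inner hY hZ).mdifferentiableAt (n := ∞) (by simp)
  have hvm := mdiffAt_of_smoothAt hv
  have hYm := mdiffAt_of_smoothAt hY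
  have hZm := mdiffAt_of_smoothAt hZ
  rw [driftConnection_apply hE]
  conv_lhs => rw [h1]
  rw [leviCivita_add (mdifferentiableAt_sub_section hZY (hf.smul_section hYm))
      (hg.smul_section hvm), leviCivita_sub hZY (hf.smul_section hYm), add_apply, sub_apply,
    leviCivita_smul hf hYm, leviCivita_smul hg hvm, mvfderiv_inner hZm hvm, mvfderiv_inner hYm hZm]

/-- The torsion of `∇^v` is `T^v(a, b) = ⟪a, v⟫ b - ⟪b, v⟫ a`. -/
theorem driftConnection_torsion (hE : finrank ℝ E = 3) (a b : TangentSpace I x) :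
    (driftConnection v).torsion x a b = ⟪a, v x⟫ • b - ⟪b, v x⟫ • a := by
  have ha := mdifferentiableAt_extend I E a
  have hb := mdifferentiableAt_extend I E b
  have h := (driftConnection v).torsion_apply ha hb
  rw [driftConnection_apply hE, driftConnection_apply hE, mlieBracket_eq_leviCivita ha hb] at h
  simp only [extend_apply_self] at h
  rw [h, real_inner_comm a b]
  module

/-- As `∇^v` is a metric connection, the derivative of its torsion falls on `v` alone. -/
theorem nablaTorsion_driftConnection (hE : finrank ℝ E = 3) (hv : CMDiffAt ∞ (T% v) x)
    (e a b : TangentSpace I x) :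
    nablaTorsion (driftConnection v) x e a b =
      ⟪a, driftConnection v v x e⟫ • b - ⟪b, driftConnection v v x e⟫ • a := by
  have ha := mdifferentiableAt_extend I E a
  have hb := mdifferentiableAt_extend I E b
  have hvm := mdiffAt_of_smoothAt hv
  have h1 : (fun y => (driftConnection v).torsion y (extend E a y) (extend E b y)) =
      (fun y => ⟪extend E a y, v y⟫) • extend E b - (fun y => ⟪extend E b y, v y⟫) • extend E a := by
    funext y
    rw [driftConnection_torsion hE]
    simp
  have hf := mdifferentiableAt_inner ha hvm
  have hg := mdifferentiableAt_inner hb hvm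
  unfold nablaTorsion
  rw [driftConnection_torsion hE, driftConnection_torsion hE, driftConnection_apply hE]
  conv_lhs => rw [h1]
  rw [leviCivita_sub (hf.smul_section hb) (hg.smul_section ha), sub_apply,
    leviCivita_smul hf hb, leviCivita_smul hg ha, mvfderiv_inner ha hvm, mvfderiv_inner hb hvm]
  simp only [driftConnection_apply hE, driftConnection_torsion hE, extend_apply_self,
    inner_sub_left, inner_sub_right, inner_smul_left, inner_smul_right, conj_trivial]
  simp only [real_inner_comm a e, real_inner_comm b e]
  module

/-- The summand of the intrinsic Ricci tensor which belongs to a unit vector `f`. The local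
extensions of `a` and `f` enter the curvature of `∇^v` and of `∇` in the same way, so their
derivatives cancel. -/
theorem curvature_add_nablaTorsion_driftConnection (hE : finrank ℝ E = 3)
    (hv : CMDiffAt ∞ (T% v) x) (a f : TangentSpace I x) (hf : ⟪f, f⟫ = 1) :
    curvature (driftConnection v) (extend E a) (extend E f) (extend E f) x +
      nablaTorsion (driftConnection v) x f a f =
    curvature ∇ᴸ (extend E a) (extend E f) (extend E f) x
      - ⟪f, ∇ᴸ v x a⟫ • f + ∇ᴸ v x a - ⟪a, f⟫ • ∇ᴸ v x f - (⟪f, v x⟫ * ⟪a, f⟫) • v x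
      + ⟪a, v x⟫ • v x + ⟪∇ᴸ v x f, a⟫ • f := by
  have ha : CMDiffAt ∞ (T% (extend E a : Π y : M, TangentSpace I y)) x := contMDiffAt_extend I E a
  have hf' : CMDiffAt ∞ (T% (extend E f : Π y : M, TangentSpace I y)) x := contMDiffAt_extend I E f
  rw [nablaTorsion_driftConnection hE hv]
  unfold curvature
  rw [driftConnection_driftConnection hE hv hf' hf', driftConnection_driftConnection hE hv ha hf',
    mlieBracket_eq_leviCivita (mdiffAt_of_smoothAt ha) (mdiffAt_of_smoothAt hf')]
  simp only [driftConnection_apply hE, extend_apply_self, map_sub,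
    inner_sub_left, inner_sub_right, inner_smul_left, inner_smul_right, conj_trivial, hf]
  simp only [real_inner_comm (∇ᴸ v x f) a, real_inner_comm a f]
  module

/-- The intrinsic Ricci tensor is `Ric^v + ∑ ∇^v T^v = Ric + 2 v ⊗ v + 2 ∇^s v` in dimension three.
-/
theorem intrinsicRicci_eq (hE : finrank ℝ E = 3) (hv : CMDiffAt ∞ (T% v) x)
    (a : TangentSpace I x) :
    intrinsicRicci v x a = ricci ∇ᴸ x a + (2 * ⟪a, v x⟫) • v x + (2 : ℝ) • symGrad v x a := by
  unfold intrinsicRicci ricci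
  rw [← Finset.sum_add_distrib]
  have hcard : Fintype.card (Fin (finrank ℝ (TangentSpace I x))) = 3 := by
    rw [Fintype.card_fin]; exact hE
  have h1 : ∀ i, ⟪frame I x i, frame I x i⟫ = 1 := fun i => by
    simp
  simp only [curvature_add_nablaTorsion_driftConnection hE hv a _ (h1 _)]
  simp only [Finset.sum_add_distrib, Finset.sum_sub_distrib, Finset.sum_const, Finset.card_univ, hcard,
    ← Finset.sum_smul]
  have h2 : ∑ i, ⟪frame I x i, ∇ᴸ v x a⟫ • frame I x i = ∇ᴸ v x a := (frame I x).sum_repr' _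
  have h3 : ∑ i, ⟪a, frame I x i⟫ • ∇ᴸ v x (frame I x i) = ∇ᴸ v x a := by
    conv_rhs => rw [← (frame I x).sum_repr' a]
    simp [real_inner_comm]
  have h4 : ∑ i, ⟪frame I x i, v x⟫ * ⟪a, frame I x i⟫ = ⟪a, v x⟫ := by
    rw [← (frame I x).sum_inner_mul_inner]
    exact Finset.sum_congr rfl fun i _ => mul_comm _ _
  rw [h2, h3, h4]
  unfold symGrad sharp
  module

/-! ### Forms and vector fields -/

theorem inner_sharp (α : TangentSpace I x →L[ℝ] ℝ) (v : TangentSpace I x) :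
    ⟪sharp x α, v⟫ = α v := by
  conv_rhs => rw [← (frame I x).sum_repr' v]
  simp [sharp, sum_inner, inner_smul_left, mul_comm]

theorem inner_grad (f : M → ℝ) (v : TangentSpace I x) : ⟪grad f x, v⟫ = d% f x v :=
  inner_sharp _ v

theorem smoothAt_grad {f : M → ℝ} (hf : CMDiffAt ∞ f x) : CMDiffAt ∞ (T% (grad (I := I) f)) x := by
  refine smoothAt_of_inner fun Z hZ => ?_
  simp only [inner_grad]
  exact smoothAt_dir hf hZ

theorem nablaOne_flat (hX : MDiffAt (T% X) x) (a b : TangentSpace I x) :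
    nablaOne (flat X) x a b = ⟪∇ᴸ X x a, b⟫ := by
  have h := mvfderiv_inner hX (mdifferentiableAt_extend I E b) a
  simp only [extend_apply_self] at h
  simp only [nablaOne, flat, innerSL_apply_apply, h]
  ring

theorem dOne_flat (hX : MDiffAt (T% X) x) (a b : TangentSpace I x) :
    dOne (flat X) x a b = ⟪∇ᴸ X x a, b⟫ - ⟪∇ᴸ X x b, a⟫ := by
  have ha := mdifferentiableAt_extend I E a
  have hb := mdifferentiableAt_extend I E b
  have h1 := mvfderiv_inner hX hb a
  have h2 := mvfderiv_inner hX ha b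
  have h3 := mlieBracket_eq_leviCivita ha hb
  simp only [extend_apply_self] at h1 h2 h3
  simp only [dOne, flat, innerSL_apply_apply, h1, h2, h3, inner_sub_right]
  ring

theorem codiffOne_flat (hX : MDiffAt (T% X) x) : codiffOne (flat X) x = -divergence X x := by
  simp only [codiffOne, divergence, nablaOne_flat hX]

theorem normSqNablaOne_flat (hX : MDiffAt (T% X) x) :
    normSqNablaOne (flat X) x = normSqNabla X x := by
  simp only [normSqNablaOne, normSqNabla, nablaOne_flat hX]
  exact Finset.sum_congr rfl fun i _ => (frame I x).sum_sq_inner_left _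

/-- The first Bianchi identity: for a torsion free connection it is the Jacobi identity. -/
theorem curvature_cyclic (hX : CMDiffAt ∞ (T% X) x) (hY : CMDiffAt ∞ (T% Y) x)
    (hZ : CMDiffAt ∞ (T% Z) x) :
    curvature ∇ᴸ X Y Z x + curvature ∇ᴸ Y Z X x + curvature ∇ᴸ Z X Y x = 0 := by
  have key : ∀ {X Y Z : Π x : M, TangentSpace I x}, CMDiffAt ∞ (T% X) x → CMDiffAt ∞ (T% Y) x →
      CMDiffAt ∞ (T% Z) x → mlieBracket I X (mlieBracket I Y Z) x =
      ∇ᴸ (fun y => ∇ᴸ Z y (Y y)) x (X x) - ∇ᴸ (fun y => ∇ᴸ Y y (Z y)) x (X x)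
        - ∇ᴸ X x (mlieBracket I Y Z x) := by
    intro X Y Z hX hY hZ
    have hb := smoothAt_mlieBracket hY hZ
    have h1 := mdiffAt_of_smoothAt (smoothAt_leviCivita hY hZ)
    have h2 := mdiffAt_of_smoothAt (smoothAt_leviCivita hZ hY)
    rw [mlieBracket_eq_leviCivita (mdiffAt_of_smoothAt hX) (mdiffAt_of_smoothAt hb),
      leviCivita_congr (mdiffAt_of_smoothAt hb)
        (mdifferentiableAt_sub_section h1 h2) ?_, leviCivita_sub h1 h2, sub_apply]
    filter_upwards [eventually_mdiffAt hY, eventually_mdiffAt hZ] with y hy hz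
    exact mlieBracket_eq_leviCivita hy hz
  haveI : CompleteSpace E := FiniteDimensional.complete ℝ E
  have h2 : minSmoothness ℝ 2 ≤ (∞ : WithTop ℕ∞) := by simpa using ENat.LEInfty.out
  haveI : IsManifold I (minSmoothness ℝ 3) M :=
    IsManifold.of_le (n := ∞) (by simpa using ENat.LEInfty.out)
  have J := leibniz_identity_mlieBracket_apply (hX.of_le h2) (hY.of_le h2) (hZ.of_le h2)
  have hbX := smoothAt_mlieBracket hX hY
  rw [mlieBracket_swap_apply (V := mlieBracket I X Y), key hX hY hZ, key hY hX hZ, key hZ hX hY] at J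
  unfold curvature
  rw [mlieBracket_swap_apply (V := Z) (W := X), map_neg]
  linear_combination (norm := module) J

end General

/-! ### The cross product in oriented three-space -/

section CrossProduct

variable {V : Type*} [NormedAddCommGroup V] [InnerProductSpace ℝ V] [Fact (finrank ℝ V = 3)]
  (o : Orientation ℝ V (Fin 3))

/-- The cross product on an oriented three-dimensional Euclidean space: `⟪a × b, c⟫` is the volume
of `a, b, c`. -/
def cross : V →ₗ[ℝ] V →ₗ[ℝ] V :=
  letI := FiniteDimensional.of_fact_finrank_eq_succ (K := ℝ) (V := V) 2
  LinearMap.mk₂ ℝ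
    (fun a b => ∑ i, o.volumeForm ![a, b, stdOrthonormalBasis ℝ V i] • stdOrthonormalBasis ℝ V i)
    (fun a a' b => by
      simp only [← Finset.sum_add_distrib, ← add_smul]
      congr! 2 with i
      exact o.volumeForm.toMultilinearMap.cons_add ![b, stdOrthonormalBasis ℝ V i] a a')
    (fun c a b => by
      simp only [Finset.smul_sum, smul_smul]
      congr! 2 with i
      exact o.volumeForm.toMultilinearMap.cons_smul ![b, stdOrthonormalBasis ℝ V i] c a)
    (fun a b b' => by
      simp only [← Finset.sum_add_distrib, ← add_smul]
      congr! 2 with i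
      have h : ∀ c, ![a, c, stdOrthonormalBasis ℝ V i] =
          Function.update ![a, b, stdOrthonormalBasis ℝ V i] 1 c := fun c => by
        ext j; fin_cases j <;> rfl
      rw [h, o.volumeForm.map_update_add, ← h, ← h])
    (fun c a b => by
      simp only [Finset.smul_sum, smul_smul]
      congr! 2 with i
      have h : ∀ d, ![a, d, stdOrthonormalBasis ℝ V i] =
          Function.update ![a, b, stdOrthonormalBasis ℝ V i] 1 d := fun c => by
        ext j; fin_cases j <;> rfl
      rw [h, o.volumeForm.map_update_smul, ← h]
      rfl)

variable {o}

theorem volumeForm_eq {b : OrthonormalBasis (Fin 3) ℝ V} (hb : b.toBasis.orientation = o)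
    (x y z : V) : o.volumeForm ![x, y, z] =
      ⟪b 0, x⟫ * (⟪b 1, y⟫ * ⟪b 2, z⟫ - ⟪b 2, y⟫ * ⟪b 1, z⟫)
      - ⟪b 1, x⟫ * (⟪b 0, y⟫ * ⟪b 2, z⟫ - ⟪b 2, y⟫ * ⟪b 0, z⟫)
      + ⟪b 2, x⟫ * (⟪b 0, y⟫ * ⟪b 1, z⟫ - ⟪b 1, y⟫ * ⟪b 0, z⟫) := by
  rw [o.volumeForm_robust b hb, Basis.det_apply, Matrix.det_fin_three]
  simp [Basis.toMatrix_apply, b.repr_apply_apply]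
  ring

variable (o) in
/-- An oriented orthonormal basis; identities between volume forms follow by expansion in its
coordinates. -/
theorem exists_oriented_orthonormalBasis :
    ∃ b : OrthonormalBasis (Fin 3) ℝ V, b.toBasis.orientation = o :=
  ⟨o.finOrthonormalBasis (by norm_num) Fact.out, o.finOrthonormalBasis_orientation _ _⟩

theorem inner_cross (a b c : V) : ⟪cross o a b, c⟫ = o.volumeForm ![a, b, c] := by
  letI := FiniteDimensional.of_fact_finrank_eq_succ (K := ℝ) (V := V) 2
  have h : ∀ c, ⟪cross o a b, c⟫ = ∑ i, o.volumeForm ![a, b, stdOrthonormalBasis ℝ V i] *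
      ⟪stdOrthonormalBasis ℝ V i, c⟫ := fun c => by
    simp [cross, sum_inner, inner_smul_left]
  obtain ⟨e, he⟩ := exists_oriented_orthonormalBasis o
  have h1 : ∀ x y z : V, ∑ i, (⟪x, stdOrthonormalBasis ℝ V i⟫ *
      ⟪stdOrthonormalBasis ℝ V i, z⟫) = ⟪x, z⟫ :=
    fun x y z => (stdOrthonormalBasis ℝ V).sum_inner_mul_inner _ _
  rw [h, volumeForm_eq he, ← h1 (e 0) a c, ← h1 (e 1) a c, ← h1 (e 2) a c]
  simp only [volumeForm_eq he, Finset.mul_sum, ← Finset.sum_sub_distrib, ← Finset.sum_add_distrib]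
  exact Finset.sum_congr rfl fun i _ => by ring

theorem volumeForm_rotate (a b c : V) : o.volumeForm ![a, b, c] = o.volumeForm ![b, c, a] := by
  obtain ⟨e, he⟩ := exists_oriented_orthonormalBasis o
  simp only [volumeForm_eq he]; ring

theorem volumeForm_swap (a b c : V) : o.volumeForm ![a, b, c] = -o.volumeForm ![b, a, c] := by
  obtain ⟨e, he⟩ := exists_oriented_orthonormalBasis o
  simp only [volumeForm_eq he]; ring

theorem norm_cross_le (a b : V) : ‖cross o a b‖ ≤ ‖a‖ * ‖b‖ := by
  have h := o.abs_volumeForm_apply_le ![a, b, cross o a b]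
  rw [← inner_cross, real_inner_self_eq_norm_sq, abs_of_nonneg (by positivity)] at h
  simp only [Fin.prod_univ_three, Matrix.cons_val] at h
  by_contra! hc
  have h0 : 0 < ‖cross o a b‖ := lt_of_le_of_lt (by positivity) hc
  nlinarith

theorem cross_cross (a b c : V) : cross o a (cross o b c) = ⟪a, c⟫ • b - ⟪a, b⟫ • c := by
  obtain ⟨e, he⟩ := exists_oriented_orthonormalBasis o
  have hin : ∀ x y : V, ⟪x, y⟫ = ⟪e 0, x⟫ * ⟪e 0, y⟫ + ⟪e 1, x⟫ * ⟪e 1, y⟫ + ⟪e 2, x⟫ * ⟪e 2, y⟫ := by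
    intro x y
    rw [← e.sum_inner_mul_inner, Fin.sum_univ_three]
    simp only [real_inner_comm x]
  have hcr : ∀ i, ⟪e i, cross o b c⟫ = o.volumeForm ![b, c, e i] := fun i => by
    rw [real_inner_comm, inner_cross]
  refine ext_inner_right ℝ fun z => ?_
  rw [inner_cross, inner_sub_left, inner_smul_left, inner_smul_left, hin a c, hin a b, hin b z,
    hin c z, volumeForm_eq he]
  simp only [hcr, volumeForm_eq he, e.inner_eq_ite, conj_trivial]
  simp
  ring

variable (o) in
/-- The axial vector `∑ i, e i × A (e i)` of an endomorphism; for `A = ∇ u` it is the curl of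
`u`. -/
def axial (A : V →L[ℝ] V) : V :=
  letI := FiniteDimensional.of_fact_finrank_eq_succ (K := ℝ) (V := V) 2
  ∑ i, cross o (stdOrthonormalBasis ℝ V i) (A (stdOrthonormalBasis ℝ V i))

theorem axial_eq {ι : Type*} [Fintype ι] (b : OrthonormalBasis ι ℝ V) (A : V →L[ℝ] V) :
    axial o A = ∑ i, cross o (b i) (A (b i)) :=
  sum_orthonormalBasis_eq ((cross o).compl₂ (A : V →ₗ[ℝ] V)) _ b

theorem axial_add (A B : V →L[ℝ] V) : axial o (A + B) = axial o A + axial o B := by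
  simp [axial, Finset.sum_add_distrib]

theorem axial_smul (r : ℝ) (A : V →L[ℝ] V) : axial o (r • A) = r • axial o A := by
  simp [axial, Finset.smul_sum]

theorem inner_axial {ι : Type*} [Fintype ι] (b : OrthonormalBasis ι ℝ V) (A : V →L[ℝ] V) (z : V) :
    ⟪axial o A, z⟫ = ∑ i, o.volumeForm ![b i, A (b i), z] := by
  simp [axial_eq b, sum_inner, inner_cross]

theorem apply_eq_sum {ι : Type*} [Fintype ι] (b : OrthonormalBasis ι ℝ V) (A : V →L[ℝ] V) (z : V) :
    A z = ∑ i, ⟪b i, z⟫ • A (b i) := by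
  conv_lhs => rw [← b.sum_repr' z]
  simp

/-- The skew part of an endomorphism is the cross product with its axial vector. -/
theorem volumeForm_axial (A : V →L[ℝ] V) (y z : V) :
    o.volumeForm ![axial o A, y, z] = ⟪A y, z⟫ - ⟪A z, y⟫ := by
  obtain ⟨e, he⟩ := exists_oriented_orthonormalBasis o
  rw [apply_eq_sum e A y, apply_eq_sum e A z]
  have hz : ∀ i, ⟪A (e i), z⟫ = ∑ j, ⟪e j, A (e i)⟫ * ⟪e j, z⟫ := fun i => by
    rw [← e.sum_inner_mul_inner]; simp only [real_inner_comm]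
  have hy : ∀ i, ⟪A (e i), y⟫ = ∑ j, ⟪e j, A (e i)⟫ * ⟪e j, y⟫ := fun i => by
    rw [← e.sum_inner_mul_inner]; simp only [real_inner_comm]
  simp only [sum_inner, inner_smul_left, hz, hy, conj_trivial]
  rw [volumeForm_eq he]
  simp only [real_inner_comm (axial o A), inner_axial e, volumeForm_eq he, Fin.sum_univ_three,
    e.inner_eq_ite]
  simp
  ring

/-- `|axial A|² = |A|² - tr (A²)`. -/
theorem norm_sq_axial {ι : Type*} [Fintype ι] (b : OrthonormalBasis ι ℝ V) (A : V →L[ℝ] V) :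
    ‖axial o A‖ ^ 2 = ∑ i, ‖A (b i)‖ ^ 2 - ∑ i, ⟪A (A (b i)), b i⟫ := by
  have h : ∀ i, o.volumeForm ![b i, A (b i), axial o A] = ‖A (b i)‖ ^ 2 - ⟪A (A (b i)), b i⟫ := by
    intro i
    rw [volumeForm_rotate, volumeForm_rotate, volumeForm_axial]
    simp
  rw [← real_inner_self_eq_norm_sq, inner_axial b, ← Finset.sum_sub_distrib]
  exact Finset.sum_congr rfl fun i _ => h i

/-- An endomorphism acts on the volume form as a derivation by multiplication by its trace. -/
theorem sum_volumeForm_eq_trace {ι : Type*} [Fintype ι] (b : OrthonormalBasis ι ℝ V)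
    (A : V →L[ℝ] V) (x y z : V) :
    o.volumeForm ![A x, y, z] + o.volumeForm ![x, A y, z] + o.volumeForm ![x, y, A z] =
      (∑ i, ⟪A (b i), b i⟫) * o.volumeForm ![x, y, z] := by
  obtain ⟨e, he⟩ := exists_oriented_orthonormalBasis o
  have h1 : ∑ i, ⟪A (b i), b i⟫ = ∑ i, ⟪A (e i), e i⟫ :=
    sum_orthonormalBasis_eq ((innerₗ V).comp (A : V →ₗ[ℝ] V)) b e
  rw [h1, apply_eq_sum e A x, apply_eq_sum e A y, apply_eq_sum e A z]
  simp only [volumeForm_eq he, inner_add_right, inner_smul_right, Fin.sum_univ_three,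
    real_inner_comm (e _) (A _)]
  ring

/-- The contraction of two volume forms over two arguments: the double Hodge star of a linear form.
-/
theorem sum_volumeForm_mul_volumeForm {ι : Type*} [Fintype ι] (b : OrthonormalBasis ι ℝ V)
    (w z : V) : ∑ i, ∑ j, o.volumeForm ![w, b i, b j] * o.volumeForm ![b i, b j, z] =
      2 * ⟪w, z⟫ := by
  have h1 : ∀ i, ∑ j, o.volumeForm ![w, b i, b j] * o.volumeForm ![b i, b j, z] =
      ⟪w, z⟫ - ⟪w, b i⟫ * ⟪b i, z⟫ := fun i => by
    have h2 : ∀ j, o.volumeForm ![w, b i, b j] * o.volumeForm ![b i, b j, z] =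
        ⟪cross o w (b i), b j⟫ * ⟪b j, cross o z (b i)⟫ := fun j => by
      rw [← volumeForm_rotate z, ← inner_cross, ← inner_cross, real_inner_comm (cross o z (b i))]
    simp only [h2]
    rw [b.sum_inner_mul_inner, real_inner_comm, inner_cross, volumeForm_rotate, ← inner_cross,
      cross_cross]
    simp [inner_sub_left, inner_smul_left, real_inner_comm]
  have hc : (Fintype.card ι : ℝ) = 3 := by
    rw [← finrank_eq_card_basis b.toBasis, (Fact.out : finrank ℝ V = 3)]; norm_num
  simp only [h1, Finset.sum_sub_distrib, b.sum_inner_mul_inner, Finset.sum_const, Finset.card_univ,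
    nsmul_eq_mul, hc]
  ring

theorem eq_of_volumeForm_eq {w w' : V}
    (h : ∀ a b, o.volumeForm ![w, a, b] = o.volumeForm ![w', a, b]) : w = w' := by
  obtain ⟨b, -⟩ := exists_oriented_orthonormalBasis o
  refine ext_inner_right ℝ fun z => ?_
  have h1 := sum_volumeForm_mul_volumeForm (o := o) b w z
  rw [← mul_right_inj' (two_ne_zero (α := ℝ)), ← h1, ← sum_volumeForm_mul_volumeForm (o := o) b w' z]
  simp only [h]

theorem orientation_eq_of_volumeForm_pos {b : OrthonormalBasis (Fin 3) ℝ V}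
    (h : 0 < o.volumeForm b) : b.toBasis.orientation = o := by
  by_contra hne
  rw [o.volumeForm_robust_neg b hne] at h
  have := b.toBasis.det_self
  rw [b.coe_toBasis] at this
  simp [this] at h
  linarith

theorem orientation_reindex_eq_of_volumeForm_neg {b : OrthonormalBasis (Fin 3) ℝ V}
    (h : o.volumeForm b < 0) :
    (b.reindex (Equiv.swap 0 1)).toBasis.orientation = o := by
  refine orientation_eq_of_volumeForm_pos ?_
  have h1 : ⇑(b.reindex (Equiv.swap 0 1)) = b ∘ Equiv.swap (0 : Fin 3) 1 := by
    funext i; simp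
  rw [h1, o.volumeForm.map_swap _ (by decide)]
  linarith

theorem vec_three_eta {α : Type*} (v : Fin 3 → α) : ![v 0, v 1, v 2] = v := by
  funext i; fin_cases i <;> rfl

/-- The Gram determinant is the square of the volume. -/
theorem det_gram_eq (v : Fin 3 → V) :
    (Matrix.of fun i j => ⟪v i, v j⟫).det = o.volumeForm v ^ 2 := by
  obtain ⟨b, hb⟩ := exists_oriented_orthonormalBasis o
  have h1 : (Matrix.of fun i j => ⟪v i, v j⟫) =
      (b.toBasis.toMatrix v).transpose * b.toBasis.toMatrix v := by
    ext i j
    rw [Matrix.mul_apply, Matrix.of_apply, ← b.sum_inner_mul_inner]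
    refine Finset.sum_congr rfl fun k _ => ?_
    simp [Basis.toMatrix_apply, b.repr_apply_apply, real_inner_comm]
  rw [h1, Matrix.det_mul, Matrix.det_transpose, o.volumeForm_robust b hb, Basis.det_apply, sq]

theorem volumeForm_comp_linearMap (L : EuclideanSpace ℝ (Fin 3) →ₗ[ℝ] V)
    (A : EuclideanSpace ℝ (Fin 3) →ₗ[ℝ] EuclideanSpace ℝ (Fin 3)) :
    (o.volumeForm fun i => L (A (EuclideanSpace.single i (1 : ℝ)))) =
      LinearMap.det A * o.volumeForm fun i => L (EuclideanSpace.single i (1 : ℝ)) := by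
  set e := (EuclideanSpace.basisFun (Fin 3) ℝ).toBasis
  have he : ⇑e = fun i => EuclideanSpace.single i (1 : ℝ) := by
    funext i; simp [e]
  have h1 := congrArg (fun f => f (A ∘ e)) (AlternatingMap.eq_smul_basis_det e
    (o.volumeForm.compLinearMap L))
  simp only [AlternatingMap.smul_apply, Basis.det_comp, e.det_self, mul_one, smul_eq_mul] at h1
  rw [mul_comm] at h1
  simpa [he, AlternatingMap.compLinearMap_apply, Function.comp_def] using h1

end CrossProduct

/-! ### Derivatives in time and space -/

section TimeDerivative

/-- A nondegenerate interval has unique derivatives and is contained in the closure of its interior,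
which is what symmetry of second derivatives up to the boundary needs. -/
theorem uniqueDiffOn_interval {J : Set ℝ} (hJ : J.OrdConnected) (hJ' : J.Nontrivial) :
    (interior J).Nonempty ∧ UniqueDiffOn ℝ J ∧ J ⊆ closure (interior J) := by
  obtain ⟨a, ha, b, hb, hab⟩ := hJ'.exists_lt
  have hi : (interior J).Nonempty := by
    refine ⟨(a + b) / 2, mem_interior.2 ⟨Set.Ioo a b, fun x hx => hJ.out ha hb ⟨hx.1.le, hx.2.le⟩,
      isOpen_Ioo, ?_, ?_⟩⟩ <;> linarith
  refine ⟨hi, uniqueDiffOn_convex hJ.convex hi, ?_⟩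
  rw [Convex.closure_interior_eq_closure_of_nonempty_interior (𝕜 := ℝ) hJ.convex hi]
  exact subset_closure

variable {F : Type*} [NormedAddCommGroup F] [NormedSpace ℝ F] {J : Set ℝ} {T : Set F}
  {b : ℝ × F → ℝ} {t : ℝ} {y : F}

/-- The time derivative at time `t`, which is one-sided at the endpoints of `J`. -/
theorem hasDerivWithinAt_fst (hb : ContDiffOn ℝ ∞ b (J ×ˢ T)) (ht : t ∈ J) (hy : y ∈ T) :
    HasDerivWithinAt (fun s => b (s, y)) (fderivWithin ℝ b (J ×ˢ T) (t, y) (1, 0)) J t := by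
  have h1 := (hb.differentiableOn (by simp) (t, y) ⟨ht, hy⟩).hasFDerivWithinAt
  have h2 : HasFDerivWithinAt (fun s : ℝ => (s, y)) (.inl ℝ ℝ F) J t :=
    (hasFDerivAt_prodMk_left t y).hasFDerivWithinAt
  have hm : Set.MapsTo (fun s : ℝ => (s, y)) J (J ×ˢ T) := fun s hs => ⟨hs, hy⟩
  exact (h1.comp t h2 hm).hasDerivWithinAt.congr_deriv (by simp)

theorem hasFDerivAt_snd (hT : IsOpen T) (hb : ContDiffOn ℝ ∞ b (J ×ˢ T)) (ht : t ∈ J) (hy : y ∈ T) :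
    HasFDerivAt (fun z => b (t, z))
      ((fderivWithin ℝ b (J ×ˢ T) (t, y)).comp (.inr ℝ ℝ F)) y := by
  have h1 := (hb.differentiableOn (by simp) (t, y) ⟨ht, hy⟩).hasFDerivWithinAt
  have h2 : HasFDerivWithinAt (fun z : F => (t, z)) (.inr ℝ ℝ F) T y :=
    (hasFDerivAt_prodMk_right t y).hasFDerivWithinAt
  exact (h1.comp y h2 fun s hs => ⟨ht, hs⟩).hasFDerivAt (hT.mem_nhds hy)

/-- Derivatives in time and space commute, up to the boundary of the time interval. -/
theorem hasDerivWithinAt_fderiv (hJ : J.OrdConnected) (hJ' : J.Nontrivial) (hT : IsOpen T)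
    (hb : ContDiffOn ℝ ∞ b (J ×ˢ T)) (ht : t ∈ J) (hy : y ∈ T) (e : F) :
    HasDerivWithinAt (fun s => fderiv ℝ (fun z => b (s, z)) y e)
      (fderiv ℝ (fun z => fderivWithin ℝ b (J ×ˢ T) (t, z) (1, 0)) y e) J t := by
  obtain ⟨hi, hu, hc⟩ := uniqueDiffOn_interval hJ hJ'
  have hU : UniqueDiffOn ℝ (J ×ˢ T) := hu.prod hT.uniqueDiffOn
  set S := J ×ˢ T
  have hD : ContDiffOn ℝ ∞ (fderivWithin ℝ b S) S := hb.fderivWithin hU (by simp)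
  have h1 := (hD.differentiableOn (by simp) (t, y) ⟨ht, hy⟩).hasFDerivWithinAt
  -- symmetry of second derivatives holds up to the boundary, by continuity from the interior
  have hsymm : IsSymmSndFDerivWithinAt ℝ b S (t, y) := by
    refine ContDiffWithinAt.isSymmSndFDerivWithinAt (hb (t, y) ⟨ht, hy⟩)
      (by
        rw [minSmoothness_of_isRCLikeNormedField]
        exact WithTop.coe_le_coe.2 (le_top : (2 : ℕ∞) ≤ ⊤)) hU ?_ ⟨ht, hy⟩
    rw [interior_prod_eq, closure_prod_eq, hT.interior_eq]
    exact ⟨hc ht, subset_closure hy⟩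
  have h2 : HasFDerivWithinAt (fun s : ℝ => (s, y)) (.inl ℝ ℝ F) J t :=
    (hasFDerivAt_prodMk_left t y).hasFDerivWithinAt
  have h3 : HasFDerivWithinAt (fun z : F => (t, z)) (.inr ℝ ℝ F) T y :=
    (hasFDerivAt_prodMk_right t y).hasFDerivWithinAt
  have hm : Set.MapsTo (fun s : ℝ => (s, y)) J S := fun s hs => ⟨hs, hy⟩
  have hm' : Set.MapsTo (fun z : F => (t, z)) T S := fun z hz => ⟨ht, hz⟩
  have h4 := (((h1.comp t h2 hm).clm_apply
    (hasFDerivWithinAt_const ((0, e) : ℝ × F) t J))).hasDerivWithinAt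
  have h5 := (((h1.comp y h3 hm').clm_apply
    (hasFDerivWithinAt_const ((1, 0) : ℝ × F) y T))).hasFDerivAt (hT.mem_nhds hy)
  rw [show (fun z => fderivWithin ℝ b S (t, z) (1, 0)) = fun z =>
    (fderivWithin ℝ b S ∘ fun z => (t, z)) z (1, 0) from rfl, h5.fderiv]
  refine (h4.congr_of_mem (fun s hs => ?_) ht).congr_deriv ?_
  · rw [(hasFDerivAt_snd hT hb hs hy).fderiv]
    simp [S]
  · simpa using hsymm (1, 0) (0, e)

end TimeDerivative

section Threefold

/-! Abbreviations for the calculus on a three-manifold: the model space, smoothness and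
differentiability of vector fields and of functions at a point, and the differential of a
function. -/

local notation "E₃" => EuclideanSpace ℝ (Fin 3)
local notation:max "SmoothVF" X:max => ContMDiffAt (𝓡 3) (ModelWithCorners.prod (𝓡 3) 𝓘(ℝ, E₃)) ∞ (fun y => TotalSpace.mk' E₃ y (X y))
local notation:max "SmoothFn" f:max => ContMDiffAt (𝓡 3) 𝓘(ℝ, ℝ) ∞ f
local notation:max "DiffVF" X:max => MDifferentiableAt (𝓡 3) (ModelWithCorners.prod (𝓡 3) 𝓘(ℝ, E₃)) (fun y => TotalSpace.mk' E₃ y (X y))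
local notation:max "DiffFn" f:max => MDifferentiableAt (𝓡 3) 𝓘(ℝ, ℝ) f
local notation:max "d₃" f:max => mvfderiv (𝓡 3) f

section Smooth

variable {M : Type*} [TopologicalSpace M] [ChartedSpace (EuclideanSpace ℝ (Fin 3)) M]
  [IsManifold (𝓡 3) ∞ M] [RiemannianBundle (fun x : M => TangentSpace (𝓡 3) x)]
  [IsContMDiffRiemannianBundle (𝓡 3) ∞ (EuclideanSpace ℝ (Fin 3))
    (fun x : M => TangentSpace (𝓡 3) x)]
  {o : ∀ x : M, Orientation ℝ (TangentSpace (𝓡 3) x) (Fin 3)}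
  {X Y Z W : Π x : M, TangentSpace (𝓡 3) x} {x x₀ x₁ : M}

local notation "∇ᴸ" => leviCivita (𝓡 3) M

/-! ### Oriented frames and the volume form -/

/-- Around each point there is a smooth positively oriented orthonormal frame. -/
theorem exists_oriented_frame (ho : IsOrientation o) (x : M) :
    ∃ F : Fin 3 → Π x : M, TangentSpace (𝓡 3) x, (∀ i, SmoothVF (F i) x) ∧
      ∀ᶠ y in 𝓝 x, ∃ b : OrthonormalBasis (Fin 3) ℝ (TangentSpace (𝓡 3) y),
        b.toBasis.orientation = o y ∧ ∀ i, b i = F i y := by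
  obtain ⟨F, hF, hb⟩ := exists_orthonormal_frame (I := 𝓡 3) (finrank_euclideanSpace_fin (𝕜 := ℝ)) x
  have hc : ContinuousAt (fun y => (o y).volumeForm fun i => F i y) x :=
    ho x F fun i => (hF i).continuousAt
  have habs : ∀ (y : M) (b : OrthonormalBasis (Fin 3) ℝ (TangentSpace (𝓡 3) y)),
      |(o y).volumeForm b| = 1 := fun y b => (o y).abs_volumeForm_apply_of_orthonormal b
  obtain ⟨b, hbx⟩ := hb.self_of_nhds
  have hbx' : (fun i => F i x) = b := funext fun i => (hbx i).symm
  have hx := habs x b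
  rw [← hbx'] at hx
  -- an orthonormal frame has volume `1` or `-1`, and by continuity the sign is the same nearby; a
  -- negative frame is corrected by a transposition
  rcases lt_or_gt_of_ne (show (o x).volumeForm (fun i => F i x) ≠ 0 by
    intro h; simp [h] at hx) with h | h
  · refine ⟨fun i => F (Equiv.swap 0 1 i), fun i => hF _, ?_⟩
    filter_upwards [hb, hc.eventually (gt_mem_nhds h)] with y ⟨b, hb⟩ hy
    refine ⟨b.reindex (Equiv.swap 0 1), orientation_reindex_eq_of_volumeForm_neg ?_,
      fun i => by simp [hb]⟩
    rwa [show ⇑b = fun i => F i y from funext hb]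
  · refine ⟨F, hF, ?_⟩
    filter_upwards [hb, hc.eventually (lt_mem_nhds h)] with y ⟨b, hb⟩ hy
    refine ⟨b, orientation_eq_of_volumeForm_pos ?_, hb⟩
    rwa [show ⇑b = fun i => F i y from funext hb]

/-- The coordinate expression of the volume form in an orthonormal frame. -/
def volumeExpr (p q r : Fin 3 → ℝ) : ℝ :=
  p 0 * (q 1 * r 2 - q 2 * r 1) - p 1 * (q 0 * r 2 - q 2 * r 0) + p 2 * (q 0 * r 1 - q 1 * r 0)

/-- The coordinate expression of the volume form satisfies the product rule. -/
theorem mvfderiv_volumeExpr {p q r : Fin 3 → M → ℝ} (hp : ∀ i, DiffFn (p i) x)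
    (hq : ∀ i, DiffFn (q i) x) (hr : ∀ i, DiffFn (r i) x) (v : TangentSpace (𝓡 3) x) :
    d₃ (fun y => volumeExpr (fun i => p i y) (fun i => q i y) (fun i => r i y)) x v =
      volumeExpr (fun i => d₃ (p i) x v) (fun i => q i x) (fun i => r i x) +
      volumeExpr (fun i => p i x) (fun i => d₃ (q i) x v) (fun i => r i x) +
      volumeExpr (fun i => p i x) (fun i => q i x) (fun i => d₃ (r i) x v) := by
  have h1 : ∀ i j, DiffFn (fun y => q i y * r j y) x := fun i j => (hq i).mul (hr j)
  have h2 : ∀ i j, DiffFn (fun y => q i y * r j y - q j y * r i y) x := fun i j =>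
    (h1 i j).sub (h1 j i)
  have h3 : ∀ i j k, DiffFn (fun y => p k y * (q i y * r j y - q j y * r i y)) x := fun i j k =>
    (hp k).mul (h2 i j)
  have h4 : ∀ i j k, d₃ (fun y => p k y * (q i y * r j y - q j y * r i y)) x v =
      p k x * ((q i x * d₃ (r j) x v + r j x * d₃ (q i) x v) -
        (q j x * d₃ (r i) x v + r i x * d₃ (q j) x v)) +
      (q i x * r j x - q j x * r i x) * d₃ (p k) x v := fun i j k => by
    rw [mvfderiv_fun_mul (hp k) (h2 i j), mvfderiv_fun_sub (h1 i j) (h1 j i),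
      mvfderiv_fun_mul (hq i) (hr j), mvfderiv_fun_mul (hq j) (hr i)]
    simp
  have h5 : DiffFn (fun y => p 0 y * (q 1 y * r 2 y - q 2 y * r 1 y) -
      p 1 y * (q 0 y * r 2 y - q 2 y * r 0 y)) x := (h3 1 2 0).sub (h3 0 2 1)
  unfold volumeExpr
  rw [mvfderiv_fun_add h5 (h3 0 1 2), add_apply,
    mvfderiv_fun_sub (h3 1 2 0) (h3 0 2 1), sub_apply, h4, h4, h4]
  ring

theorem volumeForm_eq_volumeExpr {b : OrthonormalBasis (Fin 3) ℝ (TangentSpace (𝓡 3) x)}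
    (hb : b.toBasis.orientation = o x) (u v w : TangentSpace (𝓡 3) x) :
    (o x).volumeForm ![u, v, w] =
      volumeExpr (fun i => ⟪b i, u⟫) (fun i => ⟪b i, v⟫) (fun i => ⟪b i, w⟫) := by
  rw [volumeForm_eq hb]; rfl

theorem eventually_volumeForm_eq {F : Fin 3 → Π x : M, TangentSpace (𝓡 3) x}
    (hb : ∀ᶠ y in 𝓝 x, ∃ b : OrthonormalBasis (Fin 3) ℝ (TangentSpace (𝓡 3) y),
      b.toBasis.orientation = o y ∧ ∀ i, b i = F i y) :
    (fun y => (o y).volumeForm ![X y, Y y, Z y]) =ᶠ[𝓝 x] fun y =>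
      volumeExpr (fun i => ⟪F i y, X y⟫) (fun i => ⟪F i y, Y y⟫) (fun i => ⟪F i y, Z y⟫) := by
  filter_upwards [hb] with y ⟨b, hb, hF⟩
  simp only [volumeForm_eq_volumeExpr hb, hF]

theorem smoothAt_volumeForm (ho : IsOrientation o) (hX : SmoothVF X x)
    (hY : SmoothVF Y x) (hZ : SmoothVF Z x) :
    SmoothFn (fun y => (o y).volumeForm ![X y, Y y, Z y]) x := by
  obtain ⟨F, hF, hb⟩ := exists_oriented_frame ho x
  refine ContMDiffAt.congr_of_eventuallyEq ?_ (eventually_volumeForm_eq hb)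
  have hp := fun i => smoothAt_inner (hF i) hX
  have hq := fun i => smoothAt_inner (hF i) hY
  have hr := fun i => smoothAt_inner (hF i) hZ
  exact (((hp 0).mul (((hq 1).mul (hr 2)).sub ((hq 2).mul (hr 1)))).sub
    ((hp 1).mul (((hq 0).mul (hr 2)).sub ((hq 2).mul (hr 0))))).add
    ((hp 2).mul (((hq 0).mul (hr 1)).sub ((hq 1).mul (hr 0))))

/-- The Riemannian volume form is parallel. -/
theorem mvfderiv_volumeForm (ho : IsOrientation o) (hX : DiffVF X x)
    (hY : DiffVF Y x) (hZ : DiffVF Z x) (v : TangentSpace (𝓡 3) x) :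
    d₃ (fun y => (o y).volumeForm ![X y, Y y, Z y]) x v =
      (o x).volumeForm ![∇ᴸ X x v, Y x, Z x] + (o x).volumeForm ![X x, ∇ᴸ Y x v, Z x] +
      (o x).volumeForm ![X x, Y x, ∇ᴸ Z x v] := by
  obtain ⟨F, hF, hb⟩ := exists_oriented_frame ho x
  have hFm := fun i => mdiffAt_of_smoothAt (hF i)
  rw [mvfderiv_congr (eventually_volumeForm_eq hb),
    mvfderiv_volumeExpr (fun i => mdifferentiableAt_inner (hFm i) hX)
      (fun i => mdifferentiableAt_inner (hFm i) hY) (fun i => mdifferentiableAt_inner (hFm i) hZ)]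
  obtain ⟨b, hbo, hbF⟩ := hb.self_of_nhds
  -- the connection coefficients `a i j = ⟪∇_v F i, F j⟫` of the frame form a skew matrix
  set a : Fin 3 → Fin 3 → ℝ := fun i j => ⟪∇ᴸ (F i) x v, b j⟫ with ha
  have hskew : ∀ i j, a i j = -a j i := fun i j => by
    have h1 : (fun y => ⟪F i y, F j y⟫) =ᶠ[𝓝 x] fun _ => if i = j then (1 : ℝ) else 0 := by
      filter_upwards [hb] with y ⟨b, _, hb⟩
      simp only [← hb, b.inner_eq_ite]
    have h2 := mvfderiv_inner (hFm i) (hFm j) v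
    rw [mvfderiv_congr h1, ← hbF, ← hbF, real_inner_comm _ (b i)] at h2
    simp only [mvfderiv_const, zero_apply] at h2
    simp only [ha]
    linarith
  have h0 : ∀ i, a i i = 0 := fun i => by linarith [hskew i i]
  have hd : ∀ {X : Π x : M, TangentSpace (𝓡 3) x}, DiffVF X x → ∀ i,
      d₃ (fun y => ⟪F i y, X y⟫) x v = ∑ j, a i j * ⟪b j, X x⟫ + ⟪b i, ∇ᴸ X x v⟫ :=
    fun hX i => by
    rw [mvfderiv_inner (hFm i) hX, ← hbF, b.sum_inner_mul_inner]
  simp only [volumeForm_eq_volumeExpr hbo, hd hX, hd hY, hd hZ, ← hbF]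
  simp only [volumeExpr, Fin.sum_univ_three, h0, hskew 1 0, hskew 2 0, hskew 2 1]
  ring

theorem smoothAt_cross (ho : IsOrientation o) (hX : SmoothVF X x)
    (hY : SmoothVF Y x) : SmoothVF (fun y => cross (o y) (X y) (Y y)) x := by
  refine smoothAt_of_inner fun Z hZ => ?_
  simp only [inner_cross]
  exact smoothAt_volumeForm ho hX hY hZ

/-- The cross product is parallel. -/
theorem leviCivita_cross (ho : IsOrientation o) (hX : SmoothVF X x)
    (hY : SmoothVF Y x) (v : TangentSpace (𝓡 3) x) :
    ∇ᴸ (fun y => cross (o y) (X y) (Y y)) x v =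
      cross (o x) (∇ᴸ X x v) (Y x) + cross (o x) (X x) (∇ᴸ Y x v) := by
  refine ext_inner_right ℝ fun z => ?_
  set Z : Π y : M, TangentSpace (𝓡 3) y := extend (EuclideanSpace ℝ (Fin 3)) z
  have hZ : SmoothVF Z x := contMDiffAt_extend (𝓡 3) _ z
  have hZx : Z x = z := extend_apply_self _ z
  have h1 := mvfderiv_inner (mdiffAt_of_smoothAt (smoothAt_cross ho hX hY))
    (mdiffAt_of_smoothAt hZ) v
  simp only [inner_cross] at h1
  rw [mvfderiv_volumeForm ho (mdiffAt_of_smoothAt hX) (mdiffAt_of_smoothAt hY)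
    (mdiffAt_of_smoothAt hZ), hZx] at h1
  rw [inner_add_left, inner_cross, inner_cross]
  linarith

/-! ### The curl and its Laplacian -/

/-- The curl of a vector field, the axial vector `∑ i, e i × ∇_{e i} u` of its covariant derivative.
-/
def curl (o : ∀ x : M, Orientation ℝ (TangentSpace (𝓡 3) x) (Fin 3))
    (u : Π x : M, TangentSpace (𝓡 3) x) (x : M) : TangentSpace (𝓡 3) x :=
  axial (o x) (∇ᴸ u x)

/-- `vol(curl X, a, b) = dX^♭(a, b)`. -/
theorem volumeForm_curl (a b : TangentSpace (𝓡 3) x) :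
    (o x).volumeForm ![curl o X x, a, b] = ⟪∇ᴸ X x a, b⟫ - ⟪∇ᴸ X x b, a⟫ :=
  volumeForm_axial _ a b

theorem smoothAt_curl (ho : IsOrientation o) (hX : SmoothVF X x) : SmoothVF (curl o X) x := by
  obtain ⟨F, hF, hb⟩ := exists_oriented_frame ho x
  have h1 : SmoothVF (fun y => ∑ i, cross (o y) (F i y) (∇ᴸ X y (F i y))) x :=
    ContMDiffAt.sum_section fun i _ => smoothAt_cross ho (hF i) (smoothAt_leviCivita (hF i) hX)
  refine h1.congr_of_eventuallyEq ?_
  filter_upwards [hb] with y ⟨b, _, hb⟩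
  rw [curl, axial_eq b]
  simp only [hb]

/-- The vorticity `* du^♭` is the `1`-form dual to the curl. -/
theorem vorticity_eq (hX : DiffVF X x) : vorticity o X x = flat (curl o X) x := by
  ext v
  simp only [vorticity, hodgeStarTwo, dOne_flat hX, ← volumeForm_curl (o := o),
    sum_volumeForm_mul_volumeForm, sum_apply, smul_apply, innerSL_apply_apply,
    flat, smul_eq_mul]
  rw [← (frame (𝓡 3) x).sum_inner_mul_inner]
  exact Finset.sum_congr rfl fun i _ => by ring

/-- `div (Z × W) = ⟪curl Z, W⟫ - ⟪Z, curl W⟫`. -/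
theorem divergence_cross (ho : IsOrientation o) (hZ : SmoothVF Z x) (hW : SmoothVF W x) :
    divergence (fun y => cross (o y) (Z y) (W y)) x =
      ⟪curl o Z x, W x⟫ - ⟪Z x, curl o W x⟫ := by
  rw [real_inner_comm (curl o W x), curl, curl, inner_axial (frame (𝓡 3) x),
    inner_axial (frame (𝓡 3) x),
    divergence, ← Finset.sum_sub_distrib]
  refine Finset.sum_congr rfl fun i _ => ?_
  rw [leviCivita_cross ho hZ hW, inner_add_left, inner_cross, inner_cross,
    ← volumeForm_rotate, volumeForm_rotate (Z x), volumeForm_swap (∇ᴸ W x _)]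
  ring

theorem curl_add (hX : DiffVF X x) (hY : DiffVF Y x) :
    curl o (X + Y) x = curl o X x + curl o Y x := by
  rw [curl, leviCivita_add hX hY, axial_add]; rfl

theorem curl_const_smul (c : ℝ) (hX : DiffVF X x) : curl o (c • X) x = c • curl o X x := by
  rw [curl, leviCivita_const_smul c hX, axial_smul]; rfl

theorem curl_congr (hX : DiffVF X x) (hY : DiffVF Y x) (h : X =ᶠ[𝓝 x] Y) :
    curl o X x = curl o Y x := by
  rw [curl, leviCivita_congr hX hY h]; rfl

/-- The curl of a gradient vanishes, because the Hessian is symmetric. -/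
theorem curl_grad {f : M → ℝ} (hf : SmoothFn f x) : curl o (grad f) x = 0 := by
  refine eq_of_volumeForm_eq (o := o x) fun a b => ?_
  set A : Π y : M, TangentSpace (𝓡 3) y := extend E₃ a
  set B : Π y : M, TangentSpace (𝓡 3) y := extend E₃ b
  have hA : SmoothVF A x := contMDiffAt_extend (𝓡 3) E₃ a
  have hB : SmoothVF B x := contMDiffAt_extend (𝓡 3) E₃ b
  have hAx : A x = a := extend_apply_self E₃ a
  have hBx : B x = b := extend_apply_self E₃ b
  have hg := mdiffAt_of_smoothAt (smoothAt_grad hf)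
  have h1 := mvfderiv_inner hg (mdiffAt_of_smoothAt hA) b
  have h2 := mvfderiv_inner hg (mdiffAt_of_smoothAt hB) a
  have h3 := mvfderiv_mlieBracket hf hA hB
  rw [mlieBracket_eq_leviCivita (mdiffAt_of_smoothAt hA) (mdiffAt_of_smoothAt hB), map_sub] at h3
  simp only [inner_grad, hAx, hBx] at h1 h2 h3
  rw [volumeForm_curl]
  have h4 : (o x).volumeForm ![0, a, b] = 0 := by
    rw [← inner_cross]; simp
  rw [h4]
  linarith

/-- The convective term is `∇_u u = curl u × u + grad (|u|² / 2)`. -/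
theorem leviCivita_self_eq (hX : DiffVF X x) :
    ∇ᴸ X x (X x) = cross (o x) (curl o X x) (X x) + grad (fun y => (1 / 2 : ℝ) * ⟪X y, X y⟫) x := by
  refine ext_inner_right ℝ fun z => ?_
  rw [inner_add_left, inner_cross, volumeForm_curl, inner_grad,
    mvfderiv_fun_mul mdifferentiableAt_const (mdifferentiableAt_inner hX hX)]
  simp only [add_apply, smul_apply, mvfderiv_inner hX hX, real_inner_comm (X x), mvfderiv_const,
    smul_eq_mul, zero_apply]
  ring

/-- The curl of the convective term of a divergence free field: `curl (∇_u u) = ∇_u w - ∇_w u` with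
`w = curl u`. -/
theorem curl_leviCivita_self (ho : IsOrientation o) (hX : SmoothVF X x)
    (hdiv : divergence X x = 0) (hdiv' : divergence (curl o X) x = 0) :
    curl o (fun y => ∇ᴸ X y (X y)) x = ∇ᴸ (curl o X) x (X x) - ∇ᴸ X x (curl o X x) := by
  have hw := smoothAt_curl ho hX
  have hc := smoothAt_cross ho hw hX
  have hf : SmoothFn (fun y => (1 / 2 : ℝ) * ⟪X y, X y⟫) x :=
    contMDiffAt_const.mul (smoothAt_inner hX hX)
  have hg := smoothAt_grad hf
  rw [curl_congr (mdiffAt_of_smoothAt (smoothAt_leviCivita hX hX))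
    (mdiffAt_of_smoothAt (hc.add_section hg))
    (by filter_upwards [eventually_mdiffAt hX] with y hy using leviCivita_self_eq hy),
    curl_add (mdiffAt_of_smoothAt hc) (mdiffAt_of_smoothAt hg), curl_grad hf, add_zero]
  set b := frame (𝓡 3) x
  have h1 : ∀ i, cross (o x) (b i) (∇ᴸ (fun y => cross (o y) (curl o X y) (X y)) x (b i)) =
      ⟪b i, X x⟫ • ∇ᴸ (curl o X) x (b i) - ⟪∇ᴸ (curl o X) x (b i), b i⟫ • X x +
      ⟪∇ᴸ X x (b i), b i⟫ • curl o X x - ⟪b i, curl o X x⟫ • ∇ᴸ X x (b i) := fun i => by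
    rw [leviCivita_cross ho hw hX, map_add, cross_cross, cross_cross, real_inner_comm (b i),
      real_inner_comm (b i) (∇ᴸ X x _)]
    module
  rw [divergence_eq b] at hdiv hdiv'
  rw [curl, axial_eq b]
  simp only [h1, Finset.sum_sub_distrib, Finset.sum_add_distrib, ← Finset.sum_smul, hdiv, hdiv',
    ← apply_eq_sum b]
  module

/-! ### The pointwise enstrophy balance -/

/-- The derivative of the identity `volumeForm_curl`. -/
theorem volumeForm_leviCivita_curl (ho : IsOrientation o) (hW : SmoothVF W x) (hY : SmoothVF Y x)
    (hZ : SmoothVF Z x) (v : TangentSpace (𝓡 3) x) :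
    (o x).volumeForm ![∇ᴸ (curl o W) x v, Y x, Z x] =
      ⟪∇ᴸ (fun y => ∇ᴸ W y (Y y)) x v - ∇ᴸ W x (∇ᴸ Y x v), Z x⟫ -
      ⟪∇ᴸ (fun y => ∇ᴸ W y (Z y)) x v - ∇ᴸ W x (∇ᴸ Z x v), Y x⟫ := by
  have h1 : (fun y => (o y).volumeForm ![curl o W y, Y y, Z y]) =
      fun y => ⟪∇ᴸ W y (Y y), Z y⟫ - ⟪∇ᴸ W y (Z y), Y y⟫ := by
    funext y; exact volumeForm_curl _ _
  have h2 := mvfderiv_volumeForm ho (mdiffAt_of_smoothAt (smoothAt_curl ho hW))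
    (mdiffAt_of_smoothAt hY) (mdiffAt_of_smoothAt hZ) v
  have hWY := smoothAt_leviCivita hY hW
  have hWZ := smoothAt_leviCivita hZ hW
  rw [h1, mvfderiv_fun_sub ((smoothAt_inner hWY hZ).mdifferentiableAt (by simp))
    ((smoothAt_inner hWZ hY).mdifferentiableAt (by simp)), sub_apply,
    mvfderiv_inner (mdiffAt_of_smoothAt hWY) (mdiffAt_of_smoothAt hZ),
    mvfderiv_inner (mdiffAt_of_smoothAt hWZ) (mdiffAt_of_smoothAt hY),
    volumeForm_curl, volumeForm_curl] at h2
  simp only [inner_sub_left]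
  linarith

/-- The curl is divergence free. In the sum over a cyclic permutation of a frame only curvature
terms remain, which cancel by the first Bianchi identity. -/
theorem divergence_curl (ho : IsOrientation o) (hX : SmoothVF X x) :
    divergence (curl o X) x = 0 := by
  obtain ⟨F, hF, hb⟩ := exists_oriented_frame ho x
  obtain ⟨b, hbo, hbF⟩ := hb.self_of_nhds
  have h1 := sum_volumeForm_eq_trace (o := o x) b (∇ᴸ (curl o X) x) (b 0) (b 1) (b 2)
  have h2 : (o x).volumeForm ![b 0, b 1, b 2] = 1 := by
    rw [volumeForm_eq hbo]; simp [b.inner_eq_ite]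
  rw [h2, mul_one, ← divergence_eq b, ← volumeForm_rotate (∇ᴸ (curl o X) x (b 2)),
    volumeForm_rotate (b 0)] at h1
  rw [← h1, hbF, hbF, hbF, volumeForm_leviCivita_curl ho hX (hF _) (hF _),
    volumeForm_leviCivita_curl ho hX (hF _) (hF _),
    volumeForm_leviCivita_curl ho hX (hF _) (hF _)]
  have hR : ∀ i j k, ⟪curvature ∇ᴸ (F i) (F j) X x, F k x⟫ =
      ⟪∇ᴸ (fun y => ∇ᴸ X y (F j y)) x (F i x) - ∇ᴸ X x (∇ᴸ (F j) x (F i x)), F k x⟫ -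
      ⟪∇ᴸ (fun y => ∇ᴸ X y (F i y)) x (F j x) - ∇ᴸ X x (∇ᴸ (F i) x (F j x)), F k x⟫ := by
    intro i j k
    rw [curvature, mlieBracket_eq_leviCivita (mdiffAt_of_smoothAt (hF i))
      (mdiffAt_of_smoothAt (hF j)), map_sub, ← inner_sub_left]
    congr 1
    module
  have h3 : ⟪curvature ∇ᴸ (F 0) (F 1) X x, F 2 x⟫ + ⟪curvature ∇ᴸ (F 1) (F 2) X x, F 0 x⟫ +
      ⟪curvature ∇ᴸ (F 2) (F 0) X x, F 1 x⟫ = 0 := by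
    rw [inner_curvature_swap (hF _) (hF _) hX (hF _), inner_curvature_swap (hF _) (hF _) hX (hF _),
      inner_curvature_swap (hF _) (hF _) hX (hF _), ← neg_add, ← neg_add, ← inner_add_left,
      ← inner_add_left, curvature_cyclic (hF _) (hF _) (hF _)]
    simp
  rw [hR, hR, hR] at h3
  linarith

/-- `d* d u^♭ = (curl curl u)^♭`, since the volume form is parallel. -/
theorem codiffTwo_dOne_flat (ho : IsOrientation o) (hX : SmoothVF X x)
    (z : TangentSpace (𝓡 3) x) :
    codiffTwo (dOne (flat X)) x z = ⟪curl o (curl o X) x, z⟫ := by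
  have h1 : ∀ e v w : TangentSpace (𝓡 3) x, nablaTwo (dOne (flat X)) x e v w =
      (o x).volumeForm ![∇ᴸ (curl o X) x e, v, w] := by
    intro e v w
    have hV := mdifferentiableAt_extend (𝓡 3) E₃ v
    have hW := mdifferentiableAt_extend (𝓡 3) E₃ w
    have h2 : (fun y => dOne (flat X) y (extend E₃ v y) (extend E₃ w y)) =ᶠ[𝓝 x]
        fun y => (o y).volumeForm ![curl o X y, extend E₃ v y, extend E₃ w y] := by
      filter_upwards [eventually_mdiffAt hX] with y hy
      rw [dOne_flat hy, volumeForm_curl]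
    have hXm := mdiffAt_of_smoothAt hX
    rw [nablaTwo, mvfderiv_congr h2, mvfderiv_volumeForm ho
      (mdiffAt_of_smoothAt (smoothAt_curl ho hX)) hV hW, dOne_flat hXm, dOne_flat hXm,
      ← volumeForm_curl (o := o), ← volumeForm_curl (o := o)]
    simp only [extend_apply_self]
    ring
  rw [curl, inner_axial (frame (𝓡 3) x), codiffTwo, ← Finset.sum_neg_distrib]
  refine Finset.sum_congr rfl fun i _ => ?_
  rw [h1, volumeForm_swap, neg_neg]

/-- On divergence free fields the De Rham-Hodge Laplacian is `curl curl`. -/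
theorem hodgeLaplacian_eq (ho : IsOrientation o) (hX : SmoothVF X x)
    (hdiv : ∀ᶠ y in 𝓝 x, divergence X y = 0) :
    hodgeLaplacian X x = curl o (curl o X) x := by
  have h1 : codiffOne (flat X) =ᶠ[𝓝 x] fun _ => 0 := by
    filter_upwards [hdiv, eventually_mdiffAt hX] with y hy hd
    rw [codiffOne_flat hd, hy, neg_zero]
  have h2 : hodgeLaplacianOne (flat X) x = innerSL ℝ (curl o (curl o X) x) := by
    funext z
    rw [hodgeLaplacianOne, mvfderiv_congr h1, codiffTwo_dOne_flat ho hX, mvfderiv_const]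
    simp
  rw [hodgeLaplacian, h2]
  refine ext_inner_right ℝ fun z => ?_
  rw [inner_sharp]; simp

theorem divergence_smul {f : M → ℝ} (hf : DiffFn f x) (hX : DiffVF X x) :
    divergence (f • X) x = f x * divergence X x + d₃ f x (X x) := by
  simp only [divergence, leviCivita_smul hf hX, inner_add_left, inner_smul_left,
    Finset.sum_add_distrib, Finset.mul_sum, conj_trivial]
  congr 1
  conv_rhs => rw [← (frame (𝓡 3) x).sum_repr' (X x)]
  simp [real_inner_comm, mul_comm]

theorem divergence_add (hX : DiffVF X x) (hY : DiffVF Y x) :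
    divergence (X + Y) x = divergence X x + divergence Y x := by
  simp [divergence, leviCivita_add hX hY, inner_add_left, Finset.sum_add_distrib]

theorem divergence_const_smul (c : ℝ) (hX : DiffVF X x) :
    divergence (c • X) x = c * divergence X x := by
  simp [divergence, leviCivita_const_smul c hX, inner_smul_left, Finset.mul_sum]

theorem divergence_sub (hX : DiffVF X x) (hY : DiffVF Y x) :
    divergence (X - Y) x = divergence X x - divergence Y x := by
  simp [divergence, leviCivita_sub hX hY, inner_sub_left, Finset.sum_sub_distrib]

/-- The Bochner formula `⟪□ X, X⟫ = |∇ X|² + Ric(X, X) + div (curl X × X - ∇_X X)` for a divergence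
free field. -/
theorem inner_curl_curl (ho : IsOrientation o) (hX : SmoothVF X x)
    (hdiv : ∀ᶠ y in 𝓝 x, divergence X y = 0) :
    ⟪curl o (curl o X) x, X x⟫ =
      divergence ((fun y => cross (o y) (curl o X y) (X y)) - fun y => ∇ᴸ X y (X y)) x +
      normSqNabla X x + ⟪ricci ∇ᴸ x (X x), X x⟫ := by
  have hc := smoothAt_curl ho hX
  have h0 : divergence X =ᶠ[𝓝 x] fun _ => 0 := hdiv
  have h1 := norm_sq_axial (o := o x) (frame (𝓡 3) x) (∇ᴸ X x)
  have h2 := divergence_leviCivita_self (frame (𝓡 3) x) hX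
  rw [mvfderiv_congr h0, mvfderiv_const, zero_apply, add_zero] at h2
  rw [divergence_sub (mdiffAt_of_smoothAt (smoothAt_cross ho hc hX))
    (mdiffAt_of_smoothAt (smoothAt_leviCivita hX hX)), divergence_cross ho hc hX, h2,
    real_inner_self_eq_norm_sq, normSqNabla, show curl o X x = axial (o x) (∇ᴸ X x) from rfl, h1]
  ring

/-- The flux `|w|² u / 2 + ν (curl w × w - ∇_w w)` of the enstrophy density `|w|² / 2`, by transport
and by diffusion. -/
def enstrophyFlux (o : ∀ x : M, Orientation ℝ (TangentSpace (𝓡 3) x) (Fin 3)) (ν : ℝ)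
    (u w : Π x : M, TangentSpace (𝓡 3) x) : Π x : M, TangentSpace (𝓡 3) x :=
  (fun y => (1 / 2 : ℝ) * ⟪w y, w y⟫) • u +
    ν • ((fun y => cross (o y) (curl o w y) (w y)) - fun y => ∇ᴸ w y (w y))

theorem smoothAt_enstrophyFlux (ho : IsOrientation o) (ν : ℝ) (hX : SmoothVF X x)
    (hW : SmoothVF W x) : SmoothVF (enstrophyFlux o ν X W) x := by
  have hf : SmoothFn (fun y => (1 / 2 : ℝ) * ⟪W y, W y⟫) x :=
    contMDiffAt_const.mul (smoothAt_inner hW hW)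
  exact (hf.smul_section hX).add_section
    (((smoothAt_cross ho (smoothAt_curl ho hW) hW).sub_section
      (smoothAt_leviCivita hW hW)).const_smul_section)

/-- The pointwise enstrophy balance for `w = curl u`, where `u'` stands for `∂_t u`: the inner
product of the vorticity equation with `w`. -/
theorem divergence_enstrophyFlux (ho : IsOrientation o) (ν : ℝ) {u u' : Π x : M, TangentSpace (𝓡 3) x}
    {p : M → ℝ} (hu : ∀ y, SmoothVF u y) (hu' : SmoothVF u' x) (hp : SmoothFn p x)
    (hdiv : ∀ y, divergence u y = 0)
    (h : ∀ y, u' y + ∇ᴸ u y (u y) + ν • hodgeLaplacian u y = -grad p y) :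
    divergence (enstrophyFlux o ν u (curl o u)) x =
      ⟪∇ᴸ u x (curl o u x), curl o u x⟫ - ⟪curl o u' x, curl o u x⟫ -
      ν * normSqNabla (curl o u) x - ν * ⟪ricci ∇ᴸ x (curl o u x), curl o u x⟫ := by
  have hdw : ∀ y, divergence (curl o u) y = 0 := fun y => divergence_curl ho (hu y)
  have hucurl := fun y => hodgeLaplacian_eq ho (hu y) (.of_forall hdiv)
  replace hu := hu x
  have hw := smoothAt_curl ho hu
  have hcw := smoothAt_curl ho hw
  have hconv := smoothAt_leviCivita hu hu
  have hg := smoothAt_grad hp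
  have e1 : u' =ᶠ[𝓝 x] (-1 : ℝ) • ((fun y => ∇ᴸ u y (u y)) + (ν • curl o (curl o u) + grad p)) :=
    .of_forall fun y => by
      have h1 := h y
      rw [hucurl, ← eq_sub_iff_add_eq, ← eq_sub_iff_add_eq] at h1
      change u' y = (-1 : ℝ) • (∇ᴸ u y (u y) + (ν • curl o (curl o u) y + grad p y))
      rw [h1]
      module
  have hm := mdiffAt_of_smoothAt hconv
  have hm1 := mdiffAt_of_smoothAt hcw
  have hm2 := mdiffAt_of_smoothAt hg
  have hm3 := mdifferentiableAt_add_section (hm1.smul_const_section (a := ν)) hm2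
  have hm4 := mdifferentiableAt_add_section hm hm3
  -- the vorticity equation
  have e2 : curl o u' x = ∇ᴸ u x (curl o u x) - ∇ᴸ (curl o u) x (u x) -
      ν • curl o (curl o (curl o u)) x := by
    rw [curl_congr (mdiffAt_of_smoothAt hu') hm4.smul_const_section e1, curl_const_smul _ hm4,
      curl_add hm hm3, curl_add hm1.smul_const_section hm2, curl_const_smul _ hm1, curl_grad hp,
      curl_leviCivita_self ho hu (hdiv x) (hdw x)]
    module
  have hf : SmoothFn (fun y => (1 / 2 : ℝ) * ⟪curl o u y, curl o u y⟫) x :=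
    contMDiffAt_const.mul (smoothAt_inner hw hw)
  have hfm := hf.mdifferentiableAt (by simp)
  have hin := inner_curl_curl ho hw (.of_forall hdw)
  have hsm := (smoothAt_cross ho hcw hw).sub_section (smoothAt_leviCivita hw hw)
  have hwm := mdiffAt_of_smoothAt hw
  rw [enstrophyFlux, divergence_add (mdiffAt_of_smoothAt (hf.smul_section hu))
    (mdiffAt_of_smoothAt hsm).smul_const_section, divergence_const_smul _ (mdiffAt_of_smoothAt hsm),
    divergence_smul hfm (mdiffAt_of_smoothAt hu), hdiv x,
    mvfderiv_fun_mul mdifferentiableAt_const (mdifferentiableAt_inner hwm hwm), e2]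
  simp only [inner_sub_left, inner_smul_left, hin, add_apply, smul_apply, mvfderiv_inner hwm hwm,
    mvfderiv_const, zero_apply, smul_eq_mul, conj_trivial]
  rw [real_inner_comm (∇ᴸ (curl o u) x (u x))]
  ring

/-! ### Coordinate fields -/

/-- The constant vector field `e_j` on the coordinate space. -/
def stdField (j : Fin 3) : Π y : E₃, TangentSpace (𝓡 3) y :=
  fun _ => (EuclideanSpace.single j (1 : ℝ) : E₃)

theorem smoothAt_stdField (j : Fin 3) (y : E₃) :
    SmoothVF (stdField j) y :=
  contMDiffAt_vectorSpace_iff_contDiffAt.2 contDiffAt_const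

/-- The coordinate vector field `∂_j` of the chart at `x₀`. -/
def coordField (x₀ : M) (j : Fin 3) : Π x : M, TangentSpace (𝓡 3) x :=
  mpullback (𝓡 3) (𝓡 3) (chartAt E₃ x₀) (stdField j)

/-- The `j`-th component of a vector field in the chart at `x₀`. -/
def coordComp (x₀ : M) (j : Fin 3) (V : Π x : M, TangentSpace (𝓡 3) x) (x : M) : ℝ :=
  d₃ (fun y => (chartAt E₃ x₀ y : E₃) j) x (V x)

theorem smoothAt_chart (hx : x ∈ (chartAt E₃ x₀).source) :
    ContMDiffAt (𝓡 3) (𝓡 3) ∞ (chartAt E₃ x₀) x :=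
  (contMDiffOn_chart (n := ∞) (x := x₀)).contMDiffAt ((chartAt E₃ x₀).open_source.mem_nhds hx)

theorem isInvertible_mfderiv_chart (hx : x ∈ (chartAt E₃ x₀).source) :
    (mfderiv (𝓡 3) (𝓡 3) (chartAt E₃ x₀) x).IsInvertible :=
  isInvertible_mfderiv_extChartAt (I := 𝓡 3) (x := x₀) (by simpa using hx)

theorem mfderiv_chart_coordField (hx : x ∈ (chartAt E₃ x₀).source) (j : Fin 3) :
    mfderiv (𝓡 3) (𝓡 3) (chartAt E₃ x₀) x (coordField x₀ j x) =
      stdField j (chartAt E₃ x₀ x) := by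
  rw [coordField, mpullback_apply]
  exact (isInvertible_mfderiv_chart hx).self_apply_inverse _

theorem smoothAt_coordField (hx : x ∈ (chartAt E₃ x₀).source) (j : Fin 3) :
    SmoothVF (coordField x₀ j) x := by
  exact ContMDiffAt.mpullback_vectorField_preimage (n := ∞) (smoothAt_stdField j _)
    (smoothAt_chart hx) (isInvertible_mfderiv_chart hx) (by simp)

theorem smoothAt_coord (hx : x ∈ (chartAt E₃ x₀).source) (j : Fin 3) :
    SmoothFn (fun y => (chartAt E₃ x₀ y : E₃) j) x :=
  (EuclideanSpace.proj (𝕜 := ℝ) j : E₃ →L[ℝ] ℝ).contMDiff.contMDiffAt.comp x (smoothAt_chart hx)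

theorem coordComp_eq {V : Π x : M, TangentSpace (𝓡 3) x} (hx : x ∈ (chartAt E₃ x₀).source)
    (j : Fin 3) : coordComp x₀ j V x = (EuclideanSpace.proj (𝕜 := ℝ) j : E₃ →L[ℝ] ℝ)
      (mfderiv (𝓡 3) (𝓡 3) (chartAt E₃ x₀) x (V x)) := by
  have h := mfderiv_comp x (I'' := 𝓘(ℝ, ℝ)) (g := (EuclideanSpace.proj (𝕜 := ℝ) j : E₃ →L[ℝ] ℝ))
    (EuclideanSpace.proj (𝕜 := ℝ) j : E₃ →L[ℝ] ℝ).mdifferentiableAt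
    ((smoothAt_chart hx).mdifferentiableAt (by simp))
  have h1 : mfderiv (𝓡 3) 𝓘(ℝ, ℝ) (fun y => (chartAt E₃ x₀ y : E₃) j) x (V x) =
      (EuclideanSpace.proj (𝕜 := ℝ) j : E₃ →L[ℝ] ℝ)
      (mfderiv (𝓡 3) (𝓡 3) (chartAt E₃ x₀) x (V x)) := by
    refine (congrArg (fun A => A (V x)) h).trans ?_
    rw [ContinuousLinearMap.mfderiv_eq]
    rfl
  exact h1

theorem smoothAt_coordComp (hx : x ∈ (chartAt E₃ x₀).source) (hX : SmoothVF X x) (j : Fin 3) :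
    SmoothFn (coordComp x₀ j X) x :=
  smoothAt_dir (smoothAt_coord hx j) hX

theorem coordComp_coordField (hx : x ∈ (chartAt E₃ x₀).source) (i j : Fin 3) :
    coordComp x₀ i (coordField x₀ j) x = if i = j then 1 else 0 := by
  rw [coordComp_eq hx, mfderiv_chart_coordField hx]
  exact (PiLp.single_apply 2 ℝ j (1 : ℝ) i).trans (by simp)

theorem eq_of_coordComp_eq (hx : x ∈ (chartAt E₃ x₀).source)
    (h : ∀ j, coordComp x₀ j X x = coordComp x₀ j Y x) : X x = Y x := by
  refine (mdifferentiable_chart (I := 𝓡 3) x₀).mfderiv_injective hx ?_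
  refine PiLp.ext fun j => ?_
  have := h j
  rwa [coordComp_eq hx, coordComp_eq hx] at this

theorem coordComp_sum_smul (f : Fin 3 → M → ℝ) (F : Fin 3 → Π x : M, TangentSpace (𝓡 3) x)
    (j : Fin 3) : coordComp x₀ j (fun y => ∑ i, f i y • F i y) x =
      ∑ i, f i x * coordComp x₀ j (F i) x := by
  simp [coordComp]

theorem eq_sum_coordField (hx : x ∈ (chartAt E₃ x₀).source) :
    X x = ∑ i, coordComp x₀ i X x • coordField x₀ i x := by
  refine eq_of_coordComp_eq (Y := fun y => ∑ i, coordComp x₀ i X y • coordField x₀ i y) hx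
    fun j => ?_
  rw [coordComp_sum_smul]
  simp [coordComp_coordField hx]

/-- Coordinate fields commute, so the bracket with a coordinate field differentiates components. -/
theorem mlieBracket_coordField (hx : x ∈ (chartAt E₃ x₀).source) (hX : SmoothVF X x) (j : Fin 3) :
    mlieBracket (𝓡 3) (coordField x₀ j) X x =
      ∑ i, d₃ (coordComp x₀ i X) x (coordField x₀ j x) • coordField x₀ i x := by
  refine eq_of_coordComp_eq (Y := fun y => ∑ i, d₃ (coordComp x₀ i X) y (coordField x₀ j y) •
    coordField x₀ i y) hx fun i => ?_
  rw [coordComp_sum_smul]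
  have h1 : (fun y => d₃ (fun y => (chartAt E₃ x₀ y : E₃) i) y (coordField x₀ j y)) =ᶠ[𝓝 x]
      fun _ => if i = j then 1 else 0 := by
    filter_upwards [(chartAt E₃ x₀).open_source.mem_nhds hx] with y hy
    exact coordComp_coordField hy i j
  rw [coordComp, mvfderiv_mlieBracket (smoothAt_coord hx i) (smoothAt_coordField hx j) hX,
    mvfderiv_congr h1, mvfderiv_const]
  simp only [coordComp_coordField hx]
  simp
  rfl

/-- The volume of the coordinate frame of the chart at `x₀`. Up to its sign, which is locally
constant and depends on the orientation of the chart, it is the volume density. -/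
def coordVolume (o : ∀ x : M, Orientation ℝ (TangentSpace (𝓡 3) x) (Fin 3)) (x₀ x : M) : ℝ :=
  (o x).volumeForm ![coordField x₀ 0 x, coordField x₀ 1 x, coordField x₀ 2 x]

theorem smoothAt_coordVolume (ho : IsOrientation o) (hx : x ∈ (chartAt E₃ x₀).source) :
    SmoothFn (coordVolume o x₀) x :=
  smoothAt_volumeForm ho (smoothAt_coordField hx 0) (smoothAt_coordField hx 1)
    (smoothAt_coordField hx 2)

/-- The coordinate formula for the divergence: `D div X = ∑ ∂_j (D X^j)`. -/
theorem coordVolume_mul_divergence (ho : IsOrientation o) (hx : x ∈ (chartAt E₃ x₀).source)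
    (hX : SmoothVF X x) : coordVolume o x₀ x * divergence X x =
      ∑ j, d₃ (fun y => coordVolume o x₀ y * coordComp x₀ j X y) x (coordField x₀ j x) := by
  have hF := fun j => smoothAt_coordField hx j
  have hFm := fun j => mdiffAt_of_smoothAt (hF j)
  have hc := fun j => (smoothAt_coordComp hx hX j).mdifferentiableAt (by simp : (∞ : WithTop ℕ∞) ≠ 0)
  have hD := (smoothAt_coordVolume ho hx).mdifferentiableAt (by simp : (∞ : WithTop ℕ∞) ≠ 0)
  have h1 := sum_volumeForm_eq_trace (o := o x) (frame (𝓡 3) x) (∇ᴸ X x) (coordField x₀ 0 x)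
    (coordField x₀ 1 x) (coordField x₀ 2 x)
  -- `div X` is the action of `∇ X` on the volume of the coordinate frame `∂_j`, and
  -- `∇_{∂_j} X = ∇_X ∂_j + [∂_j, X]`, where the first terms add up to the derivative of that volume
  have h2 : ∀ j, ∇ᴸ X x (coordField x₀ j x) = ∇ᴸ (coordField x₀ j) x (X x) +
      ∑ i, d₃ (coordComp x₀ i X) x (coordField x₀ j x) • coordField x₀ i x := fun j => by
    rw [← mlieBracket_coordField hx hX, mlieBracket_eq_leviCivita (hFm j) (mdiffAt_of_smoothAt hX)]
    module
  have h3 := mvfderiv_volumeForm ho (hFm 0) (hFm 1) (hFm 2) (X x)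
  have h4 : d₃ (coordVolume o x₀) x (X x) =
      ∑ j, coordComp x₀ j X x * d₃ (coordVolume o x₀) x (coordField x₀ j x) := by
    conv_lhs => rw [eq_sum_coordField (X := X) hx]
    simp
  have h5 : ∀ j, d₃ (fun y => coordVolume o x₀ y * coordComp x₀ j X y) x (coordField x₀ j x) =
      coordVolume o x₀ x * d₃ (coordComp x₀ j X) x (coordField x₀ j x) +
      coordComp x₀ j X x * d₃ (coordVolume o x₀) x (coordField x₀ j x) := fun j => by
    rw [mvfderiv_fun_mul hD (hc j)]
    simp
  simp only [h5, Finset.sum_add_distrib, ← h4]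
  rw [show d₃ (coordVolume o x₀) x (X x) = _ from h3, mul_comm,
    show divergence X x * coordVolume o x₀ x = _ from h1.symm, h2, h2, h2]
  obtain ⟨e, he⟩ := exists_oriented_orthonormalBasis (o x)
  simp only [coordVolume, volumeForm_eq he, inner_add_right, inner_smul_right,
    Fin.sum_univ_three]
  ring

/-! ### The Riemannian measure in charts -/

theorem mfderiv_chart_symm_single {y : E₃} (hy : y ∈ (chartAt E₃ x₀).target) (j : Fin 3) :
    mfderiv (𝓡 3) (𝓡 3) (chartAt E₃ x₀).symm y (EuclideanSpace.single j (1 : ℝ)) =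
      coordField x₀ j ((chartAt E₃ x₀).symm y) := by
  have hm := mdifferentiable_chart (I := 𝓡 3) x₀
  have hs := (chartAt E₃ x₀).map_target hy
  refine hm.mfderiv_injective hs ?_
  rw [mfderiv_chart_coordField hs]
  exact congrArg (fun A => A (EuclideanSpace.single j (1 : ℝ))) (hm.comp_symm_deriv hy)

/-- The volume density `√ (det g_ij)` is the absolute volume of the coordinate frame. -/
theorem volumeDensity_eq (o : ∀ x : M, Orientation ℝ (TangentSpace (𝓡 3) x) (Fin 3)) {y : E₃}
    (hy : y ∈ (chartAt E₃ x₀).target) :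
    volumeDensity x₀ y = |coordVolume o x₀ ((chartAt E₃ x₀).symm y)| := by
  rw [coordVolume, vec_three_eta (fun j => coordField x₀ j ((chartAt E₃ x₀).symm y)),
    ← Real.sqrt_sq_eq_abs, ← det_gram_eq, volumeDensity]
  simp only [mfderiv_chart_symm_single hy]

/-- The derivative of the transition map from the chart at `x₁` to the chart at `x₀`. -/
def transitionDeriv (x₀ x₁ : M) (y : E₃) : E₃ →L[ℝ] E₃ :=
  fderiv ℝ (fun y => (chartAt E₃ x₀ ((chartAt E₃ x₁).symm y) : E₃)) y

theorem hasMFDerivAt_transition {y : E₃} (hy : y ∈ (chartAt E₃ x₁).target)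
    (hy' : (chartAt E₃ x₁).symm y ∈ (chartAt E₃ x₀).source) :
    HasMFDerivAt (𝓡 3) (𝓡 3) (fun y => (chartAt E₃ x₀ ((chartAt E₃ x₁).symm y) : E₃)) y
      ((mfderiv (𝓡 3) (𝓡 3) (chartAt E₃ x₀) ((chartAt E₃ x₁).symm y)).comp
        (mfderiv (𝓡 3) (𝓡 3) (chartAt E₃ x₁).symm y)) :=
  HasMFDerivAt.comp y
    ((mdifferentiable_chart (I := 𝓡 3) x₀).mdifferentiableAt hy').hasMFDerivAt
    ((mdifferentiable_chart (I := 𝓡 3) x₁).mdifferentiableAt_symm hy).hasMFDerivAt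

theorem differentiableAt_transition {y : E₃} (hy : y ∈ (chartAt E₃ x₁).target)
    (hy' : (chartAt E₃ x₁).symm y ∈ (chartAt E₃ x₀).source) :
    DifferentiableAt ℝ (fun y => (chartAt E₃ x₀ ((chartAt E₃ x₁).symm y) : E₃)) y :=
  mdifferentiableAt_iff_differentiableAt.1 (hasMFDerivAt_transition hy hy').mdifferentiableAt

theorem transitionDeriv_apply {y : E₃} (hy : y ∈ (chartAt E₃ x₁).target)
    (hy' : (chartAt E₃ x₁).symm y ∈ (chartAt E₃ x₀).source) (v : E₃) :
    transitionDeriv x₀ x₁ y v = mfderiv (𝓡 3) (𝓡 3) (chartAt E₃ x₀) ((chartAt E₃ x₁).symm y)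
      (mfderiv (𝓡 3) (𝓡 3) (chartAt E₃ x₁).symm y v) := by
  have h := (hasMFDerivAt_transition hy hy').mfderiv
  rw [mfderiv_eq_fderiv] at h
  exact DFunLike.congr_fun h v

theorem coordVolume_transition {y : E₃} (hy : y ∈ (chartAt E₃ x₁).target)
    (hy' : (chartAt E₃ x₁).symm y ∈ (chartAt E₃ x₀).source) :
    coordVolume o x₁ ((chartAt E₃ x₁).symm y) =
      (transitionDeriv x₀ x₁ y).det * coordVolume o x₀ ((chartAt E₃ x₁).symm y) := by
  set p := (chartAt E₃ x₁).symm y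
  set L : TangentSpace (𝓡 3) (chartAt E₃ x₀ p) →L[ℝ] TangentSpace (𝓡 3) p :=
    (mfderiv (𝓡 3) (𝓡 3) (chartAt E₃ x₀) p).inverse
  have hinv := isInvertible_mfderiv_chart hy'
  have h2 : ∀ i, L (stdField i (chartAt E₃ x₀ p)) = coordField x₀ i p := fun i => rfl
  have h3 : ∀ i, L (transitionDeriv x₀ x₁ y (EuclideanSpace.single i (1 : ℝ))) =
      coordField x₁ i p := fun i => by
    rw [transitionDeriv_apply hy hy', ← mfderiv_chart_symm_single hy]
    exact hinv.inverse_apply_self _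
  have h4 := volumeForm_comp_linearMap (o := o p) L.toLinearMap
    (transitionDeriv x₀ x₁ y : E₃ →ₗ[ℝ] E₃)
  rw [coordVolume, coordVolume, vec_three_eta (fun j => coordField x₀ j p),
    vec_three_eta (fun j => coordField x₁ j p)]
  refine Eq.trans ?_ h4
  simp only [← h3]
  rfl

section Measure

variable [MeasurableSpace M] [BorelSpace M]

theorem aemeasurable_chart_symm (x₀ : M) :
    AEMeasurable (chartAt E₃ x₀).symm (volume.restrict (chartAt E₃ x₀).target) :=
  (chartAt E₃ x₀).continuousOn_symm.aemeasurable (chartAt E₃ x₀).open_target.measurableSet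

theorem chartVolume_apply (x₀ : M) {A : Set M} (hA : MeasurableSet A) :
    chartVolume (n := 3) x₀ A = ∫⁻ y in (chartAt E₃ x₀).symm ⁻¹' A ∩ (chartAt E₃ x₀).target,
      ENNReal.ofReal (volumeDensity x₀ y) := by
  rw [chartVolume, Measure.map_apply_of_aemeasurable
    ((aemeasurable_chart_symm x₀).mono_ac (withDensity_absolutelyContinuous _ _)) hA,
    withDensity_apply', Measure.restrict_restrict' (chartAt E₃ x₀).open_target.measurableSet]

theorem measurableSet_chart_symm_preimage (x₀ : M) {A : Set M} (hA : MeasurableSet A) :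
    MeasurableSet ((chartAt E₃ x₀).symm ⁻¹' A ∩ (chartAt E₃ x₀).target) := by
  have h := (continuousOn_iff_continuous_domRestrict.1
    (chartAt E₃ x₀).continuousOn_symm).measurable hA
  convert (chartAt E₃ x₀).open_target.measurableSet.subtype_image h using 1
  ext y
  simp [and_comm]

/-- The chart pieces of the Riemannian measure agree on overlaps, by the change of variables
formula. -/
theorem chartVolume_eq {A : Set M} (hA : MeasurableSet A) (h₀ : A ⊆ (chartAt E₃ x₀).source)
    (h₁ : A ⊆ (chartAt E₃ x₁).source) : chartVolume (n := 3) x₁ A = chartVolume (n := 3) x₀ A := by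
  -- the density does not depend on the orientation, any choice will do
  let o : ∀ x : M, Orientation ℝ (TangentSpace (𝓡 3) x) (Fin 3) := fun x =>
    ((stdOrthonormalBasis ℝ (TangentSpace (𝓡 3) x)).reindex
      (finCongr (Fact.out : finrank ℝ (TangentSpace (𝓡 3) x) = 3))).toBasis.orientation
  set S := (chartAt E₃ x₁).symm ⁻¹' A ∩ (chartAt E₃ x₁).target
  have hS : MeasurableSet S := measurableSet_chart_symm_preimage x₁ hA
  set τ : E₃ → E₃ := fun y => chartAt E₃ x₀ ((chartAt E₃ x₁).symm y)
  have him : (chartAt E₃ x₀).symm ⁻¹' A ∩ (chartAt E₃ x₀).target = τ '' S := by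
    ext y
    constructor
    · rintro ⟨hy1, hy2⟩
      refine ⟨chartAt E₃ x₁ ((chartAt E₃ x₀).symm y), ⟨?_, (chartAt E₃ x₁).map_source (h₁ hy1)⟩, ?_⟩
      · rwa [Set.mem_preimage, (chartAt E₃ x₁).left_inv (h₁ hy1)]
      · simp only [τ]
        rw [(chartAt E₃ x₁).left_inv (h₁ hy1), (chartAt E₃ x₀).right_inv hy2]
    · rintro ⟨z, ⟨hz1, hz2⟩, rfl⟩
      refine ⟨?_, (chartAt E₃ x₀).map_source (h₀ hz1)⟩
      rwa [Set.mem_preimage, (chartAt E₃ x₀).left_inv (h₀ hz1)]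
  have hinj : Set.InjOn τ S := fun y hy z hz h =>
    (chartAt E₃ x₁).symm.injOn hy.2 hz.2 ((chartAt E₃ x₀).injOn (h₀ hy.1) (h₀ hz.1) h)
  have hder : ∀ y ∈ S, HasFDerivWithinAt τ (transitionDeriv x₀ x₁ y) S y := fun y hy =>
    (differentiableAt_transition hy.2 (h₀ hy.1)).hasFDerivAt.hasFDerivWithinAt
  rw [chartVolume_apply x₁ hA, chartVolume_apply x₀ hA, him,
    lintegral_image_eq_lintegral_abs_det_fderiv_mul volume hS hder hinj]
  refine setLIntegral_congr_fun hS fun y hy => ?_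
  have h2 : τ y ∈ (chartAt E₃ x₀).target := (chartAt E₃ x₀).map_source (h₀ hy.1)
  rw [← ENNReal.ofReal_mul (abs_nonneg _), volumeDensity_eq o hy.2, volumeDensity_eq o h2,
    coordVolume_transition hy.2 (h₀ hy.1), abs_mul]
  simp only [τ]
  rw [(chartAt E₃ x₀).left_inv (h₀ hy.1)]

theorem chartVolume_inter_source (x₀ : M) {A : Set M} (hA : MeasurableSet A) :
    chartVolume (n := 3) x₀ (A ∩ (chartAt E₃ x₀).source) = chartVolume (n := 3) x₀ A := by
  rw [chartVolume_apply x₀ hA, chartVolume_apply x₀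
    (hA.inter (chartAt E₃ x₀).open_source.measurableSet)]
  congr 2
  ext y
  simp only [Set.preimage_inter, Set.mem_inter_iff, Set.mem_preimage]
  exact ⟨fun h => ⟨h.1.1, h.2⟩, fun h => ⟨⟨h.1, (chartAt E₃ x₀).map_target h.2⟩, h.2⟩⟩

/-- The supremum which defines the Riemannian measure is attained by any chart that contains the
set. -/
theorem riemannianVolume_apply [T1Space M] {A : Set M} (hA : MeasurableSet A)
    (h₀ : A ⊆ (chartAt E₃ x₀).source) : riemannianVolume 3 M A = chartVolume (n := 3) x₀ A := by
  refine le_antisymm ?_ (Measure.le_iff'.1 (le_iSup (fun x : M => chartVolume (n := 3) x) x₀) A)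
  -- the chart measure plus an infinite measure outside the chart bounds all other chart measures
  let m : Measure M := chartVolume (n := 3) x₀ +
    (⊤ : ENNReal) • Measure.count.restrict (chartAt E₃ x₀).sourceᶜ
  have hsrc := (chartAt E₃ x₀).open_source.measurableSet
  have hm : riemannianVolume 3 M ≤ m := by
    refine iSup_le fun x₁ => Measure.le_iff.2 fun B hB => ?_
    rcases (B ∩ (chartAt E₃ x₀).sourceᶜ).eq_empty_or_nonempty with h | h
    · have hB0 : B ⊆ (chartAt E₃ x₀).source := by
        rwa [← Set.sdiff_eq, Set.sdiff_eq_empty] at h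
      have hB1 := hB.inter (chartAt E₃ x₁).open_source.measurableSet
      rw [← chartVolume_inter_source x₁ hB, chartVolume_eq hB1
        (Set.inter_subset_left.trans hB0) Set.inter_subset_right]
      refine (measure_mono Set.inter_subset_left).trans ?_
      simp [m]
    · have : m B = ⊤ := by
        simp only [m, Measure.add_apply, Measure.smul_apply, Measure.restrict_apply hB, smul_eq_mul]
        rw [ENNReal.top_mul, add_top]
        rwa [Ne, Measure.count_eq_zero_iff, ← Ne, ← Set.nonempty_iff_ne_empty]
      rw [this]; exact le_top
  refine (Measure.le_iff'.1 hm A).trans ?_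
  have h : A ∩ (chartAt E₃ x₀).sourceᶜ = ∅ := by
    rwa [← Set.sdiff_eq, Set.sdiff_eq_empty]
  simp [m, Measure.restrict_apply hA, h]

/-- The Riemannian measure restricts to the chart measure on the domain of a chart. -/
theorem riemannianVolume_restrict [T1Space M] (x₀ : M) :
    (riemannianVolume 3 M).restrict (chartAt E₃ x₀).source = chartVolume (n := 3) x₀ := by
  refine Measure.ext fun A hA => ?_
  rw [Measure.restrict_apply hA, riemannianVolume_apply (x₀ := x₀)
    (hA.inter (chartAt E₃ x₀).open_source.measurableSet) Set.inter_subset_right,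
    chartVolume_inter_source x₀ hA]

theorem continuousOn_coordVolume (ho : IsOrientation o) (x₀ : M) :
    ContinuousOn (fun y => |coordVolume o x₀ ((chartAt E₃ x₀).symm y)|) (chartAt E₃ x₀).target := by
  refine continuous_abs.comp_continuousOn fun y hy => ContinuousAt.continuousWithinAt ?_
  exact (smoothAt_coordVolume ho ((chartAt E₃ x₀).map_target hy)).continuousAt.comp
    ((chartAt E₃ x₀).symm.continuousAt hy)

theorem chartVolume_eq_withDensity (o : ∀ x : M, Orientation ℝ (TangentSpace (𝓡 3) x) (Fin 3))
    (x₀ : M) : chartVolume (n := 3) x₀ = ((volume.restrict (chartAt E₃ x₀).target).withDensity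
    fun y => ENNReal.ofReal |coordVolume o x₀ ((chartAt E₃ x₀).symm y)|).map
      (chartAt E₃ x₀).symm := by
  rw [chartVolume]
  congr 1
  refine withDensity_congr_ae ?_
  filter_upwards [ae_restrict_mem (chartAt E₃ x₀).open_target.measurableSet] with y hy
  rw [volumeDensity_eq o hy]

/-- Integration in a chart. -/
theorem integral_riemannianVolume [T1Space M] (ho : IsOrientation o) {f : M → ℝ}
    (hf : Measurable f) (hs : ∀ x ∉ (chartAt E₃ x₀).source, f x = 0) :
    ∫ x, f x ∂(riemannianVolume 3 M) = ∫ y in (chartAt E₃ x₀).target,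
      |coordVolume o x₀ ((chartAt E₃ x₀).symm y)| * f ((chartAt E₃ x₀).symm y) := by
  have hd : AEMeasurable (fun y => ENNReal.ofReal |coordVolume o x₀ ((chartAt E₃ x₀).symm y)|)
      (volume.restrict (chartAt E₃ x₀).target) :=
    ((continuousOn_coordVolume ho x₀).aemeasurable
      (chartAt E₃ x₀).open_target.measurableSet).ennreal_ofReal
  rw [← setIntegral_eq_integral_of_forall_compl_eq_zero hs, riemannianVolume_restrict,
    chartVolume_eq_withDensity o, integral_map ((aemeasurable_chart_symm x₀).mono_ac
      (withDensity_absolutelyContinuous _ _)) hf.aestronglyMeasurable,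
    integral_withDensity_eq_integral_toReal_smul₀ hd (by simp)]
  simp

/-- Near a point the Riemannian measure has a continuous density in a chart. -/
theorem isLocallyFiniteMeasure_riemannianVolume [T1Space M] (ho : IsOrientation o) :
    IsLocallyFiniteMeasure (riemannianVolume 3 M) := by
  refine ⟨fun x₀ => ?_⟩
  have hx := mem_chart_source E₃ x₀
  obtain ⟨K, hK, hKt, hKc⟩ := local_compact_nhds (x := chartAt E₃ x₀ x₀)
    ((chartAt E₃ x₀).open_target.mem_nhds (mem_chart_target E₃ x₀))
  obtain ⟨U, hU, hUo, hxU⟩ := mem_nhds_iff.1 (Filter.inter_mem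
    ((chartAt E₃ x₀).continuousAt hx hK) ((chartAt E₃ x₀).open_source.mem_nhds hx))
  refine ⟨U, hUo.mem_nhds hxU, ?_⟩
  rw [riemannianVolume_apply hUo.measurableSet (hU.trans Set.inter_subset_right),
    chartVolume_apply x₀ hUo.measurableSet]
  have hsub : (chartAt E₃ x₀).symm ⁻¹' U ∩ (chartAt E₃ x₀).target ⊆ K := fun y hy => by
    have := (hU hy.1).1
    rwa [Set.mem_preimage, (chartAt E₃ x₀).right_inv hy.2] at this
  have hint := ((continuousOn_coordVolume ho x₀).mono hKt).integrableOn_compact hKc (μ := volume)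
  refine lt_of_le_of_lt ?_ hint.lintegral_lt_top
  refine (lintegral_mono_set hsub).trans_eq (setLIntegral_congr_fun hKc.measurableSet fun y hy => ?_)
  rw [volumeDensity_eq o (hKt hy)]

end Measure

/-! ### The divergence in coordinates -/

theorem continuous_divergence (hX : ∀ y, SmoothVF X y) : Continuous (divergence X) := by
  refine continuous_iff_continuousAt.2 fun x => ?_
  obtain ⟨F, hF, hFb⟩ := exists_orthonormal_frame (I := 𝓡 3) rfl x
  have h : SmoothFn (fun y => ∑ i, ⟪∇ᴸ X y (F i y), F i y⟫) x :=
    ContMDiffAt.sum fun i _ => smoothAt_inner (smoothAt_leviCivita (hF i) (hX x)) (hF i)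
  refine h.continuousAt.congr ?_
  filter_upwards [hFb] with y ⟨b, hb⟩
  simp [divergence_eq b, hb]

theorem coordVolume_ne_zero (o : ∀ x : M, Orientation ℝ (TangentSpace (𝓡 3) x) (Fin 3))
    (hx : x ∈ (chartAt E₃ x₀).source) : coordVolume o x₀ x ≠ 0 := by
  obtain ⟨b, hb⟩ := exists_oriented_orthonormalBasis (o x)
  rw [coordVolume, vec_three_eta (fun j => coordField x₀ j x), (o x).volumeForm_robust b hb]
  have hsp : ⊤ ≤ Submodule.span ℝ (Set.range fun j => coordField x₀ j x) := fun v _ => by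
    rw [← extend_apply_self (F := E₃) v, eq_sum_coordField (X := extend E₃ v) hx]
    exact Submodule.sum_mem _ fun i _ =>
      Submodule.smul_mem _ _ (Submodule.subset_span ⟨i, rfl⟩)
  have hli := linearIndependent_of_top_le_span_of_card_eq_finrank hsp
    (by rw [(Fact.out : finrank ℝ (TangentSpace (𝓡 3) x) = 3)]; rfl)
  exact ((Module.Basis.is_basis_iff_det b.toBasis).1 ⟨hli, top_le_iff.1 hsp⟩).ne_zero

theorem mfderiv_chart_symm_apply {y : E₃} (hy : y ∈ (chartAt E₃ x₀).target) (w : E₃) :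
    mfderiv (𝓡 3) (𝓡 3) (chartAt E₃ x₀).symm y w =
      ∑ j, w j • coordField x₀ j ((chartAt E₃ x₀).symm y) := by
  have hw : w = ∑ j, w j • (EuclideanSpace.single j (1 : ℝ) : E₃) := by
    refine PiLp.ext fun i => ?_
    simp [Pi.single_apply]
  have h := map_sum (mfderiv (𝓡 3) (𝓡 3) (chartAt E₃ x₀).symm y)
    (fun j => w j • (EuclideanSpace.single j (1 : ℝ) : E₃)) Finset.univ
  refine (congrArg _ hw).trans (h.trans (Finset.sum_congr rfl fun j _ => ?_))
  rw [← mfderiv_chart_symm_single hy]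
  exact map_smul (mfderiv (𝓡 3) (𝓡 3) (chartAt E₃ x₀).symm y) (w j)
    (EuclideanSpace.single j (1 : ℝ) : E₃)

/-- The Riemannian norm of a constant vector field on the coordinate space is continuous. -/
theorem continuousAt_norm_mfderiv_chart_symm {y : E₃} (hy : y ∈ (chartAt E₃ x₀).target) (w : E₃) :
    ContinuousAt (fun z => ‖mfderiv (𝓡 3) (𝓡 3) (chartAt E₃ x₀).symm z w‖) y := by
  have hs := (chartAt E₃ x₀).map_target hy
  have h1 : SmoothVF (fun x => ∑ j, w j • coordField x₀ j x) ((chartAt E₃ x₀).symm y) :=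
    .sum_section fun j _ => (smoothAt_coordField hs j).const_smul_section
  have h2 : ContinuousAt (fun z => ‖∑ j, w j • coordField x₀ j ((chartAt E₃ x₀).symm z)‖) y := by
    simp only [norm_eq_sqrt_real_inner]
    exact ((smoothAt_inner h1 h1).continuousAt.comp
      ((chartAt E₃ x₀).symm.continuousAt hy)).sqrt
  refine h2.congr ?_
  filter_upwards [(chartAt E₃ x₀).open_target.mem_nhds hy] with z hz
  rw [mfderiv_chart_symm_apply hz]

theorem continuous_norm_section (hX : ∀ y, SmoothVF X y) : Continuous fun y => ‖X y‖ := by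
  simp only [norm_eq_sqrt_real_inner]
  exact (continuous_iff_continuousAt.2 fun y => (smoothAt_inner (hX y) (hX y)).continuousAt).sqrt

theorem divergence_congr (hX : DiffVF X x) (hY : DiffVF Y x) (h : X =ᶠ[𝓝 x] Y) :
    divergence X x = divergence Y x := by
  simp only [divergence, leviCivita_congr hX hY h]

theorem divergence_eq_zero_of_eventuallyEq (hX : DiffVF X x) (h : X =ᶠ[𝓝 x] 0) :
    divergence X x = 0 := by
  have h0 := divergence_const_smul 0 hX
  rw [zero_mul] at h0
  rw [← h0]
  refine divergence_congr hX hX.smul_const_section ?_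
  filter_upwards [h] with y hy
  rw [Pi.smul_apply, zero_smul]
  exact hy

theorem fderiv_comp_chart_symm {f : M → ℝ} {y : E₃} (hy : y ∈ (chartAt E₃ x₀).target)
    (hf : DiffFn f ((chartAt E₃ x₀).symm y)) (j : Fin 3) :
    fderiv ℝ (fun z => f ((chartAt E₃ x₀).symm z)) y (EuclideanSpace.single j 1) =
      d₃ f ((chartAt E₃ x₀).symm y) (coordField x₀ j ((chartAt E₃ x₀).symm y)) := by
  have h := mfderiv_comp (I := 𝓡 3) (I' := 𝓡 3) (I'' := 𝓘(ℝ, ℝ)) y (g := f)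
    (f := (chartAt E₃ x₀).symm) hf ((mdifferentiable_chart (I := 𝓡 3) x₀).mdifferentiableAt_symm hy)
  rw [mfderiv_eq_fderiv] at h
  rw [← mfderiv_chart_symm_single hy]
  exact congrArg (fun A => A (EuclideanSpace.single j (1 : ℝ))) h

/-! ### Evolution of the vorticity -/

/-- The Leibniz rule with the differential of the function expanded in coordinates. -/
theorem leviCivita_smul_coord (hx : x ∈ (chartAt E₃ x₀).source) {f : M → ℝ} (hf : DiffFn f x)
    (hX : DiffVF X x) : ∇ᴸ (f • X) x = f x • ∇ᴸ X x + ∑ i, d₃ f x (coordField x₀ i x) •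
      (d₃ (fun y => (chartAt E₃ x₀ y : E₃) i) x).smulRight (X x) := by
  refine ContinuousLinearMap.ext fun v => ?_
  have hv := eq_sum_coordField (X := extend E₃ v) hx
  simp only [extend_apply_self, coordComp] at hv
  rw [leviCivita_smul hf hX]
  conv_lhs => enter [2]; rw [hv]
  simp [Finset.sum_smul, smul_smul, mul_comm]

theorem curl_smul_coord (hx : x ∈ (chartAt E₃ x₀).source) {f : M → ℝ} (hf : DiffFn f x)
    (hX : DiffVF X x) : curl o (f • X) x = f x • curl o X x + ∑ i, d₃ f x (coordField x₀ i x) •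
      axial (o x) ((d₃ (fun y => (chartAt E₃ x₀ y : E₃) i) x).smulRight (X x)) := by
  rw [curl, leviCivita_smul_coord hx hf hX, Fin.sum_univ_three, Fin.sum_univ_three]
  simp only [axial_add, axial_smul]
  rfl

theorem eventually_eq_sum_coordField (hx : x ∈ (chartAt E₃ x₀).source) :
    X =ᶠ[𝓝 x] fun y => ∑ i, coordComp x₀ i X y • coordField x₀ i y := by
  filter_upwards [(chartAt E₃ x₀).open_source.mem_nhds hx] with y hy using eq_sum_coordField hy

/-- The curl in coordinates is a fixed linear combination of the components of the field and of
their first derivatives. -/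
theorem curl_eq_sum_coord (hx : x ∈ (chartAt E₃ x₀).source) (hX : SmoothVF X x) :
    curl o X x = ∑ j, (coordComp x₀ j X x • curl o (coordField x₀ j) x +
      ∑ i, d₃ (coordComp x₀ j X) x (coordField x₀ i x) •
        axial (o x) ((d₃ (fun y => (chartAt E₃ x₀ y : E₃) i) x).smulRight (coordField x₀ j x))) := by
  have hc := fun j => smoothAt_coordComp hx hX j
  have hF := fun j => smoothAt_coordField hx j
  have hs : ∀ j, SmoothVF (coordComp x₀ j X • coordField x₀ j) x := fun j =>
    (hc j).smul_section (hF j)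
  have hm := fun j => mdiffAt_of_smoothAt (hs j)
  have h1 : X =ᶠ[𝓝 x] coordComp x₀ 0 X • coordField x₀ 0 + coordComp x₀ 1 X • coordField x₀ 1 +
      coordComp x₀ 2 X • coordField x₀ 2 := by
    filter_upwards [eventually_eq_sum_coordField (X := X) hx] with y hy
    exact hy.trans (Fin.sum_univ_three fun i => coordComp x₀ i X y • coordField x₀ i y)
  have h01 := mdifferentiableAt_add_section (hm 0) (hm 1)
  rw [curl_congr (mdiffAt_of_smoothAt hX) (mdifferentiableAt_add_section h01 (hm 2)) h1,
    curl_add h01 (hm 2), curl_add (hm 0) (hm 1), Fin.sum_univ_three]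
  simp only [curl_smul_coord hx ((hc _).mdifferentiableAt (by simp)) (mdiffAt_of_smoothAt (hF _))]

variable {J : Set ℝ} {u : ℝ → Π x : M, TangentSpace (𝓡 3) x} {t : ℝ}

/-- Smoothness of a time dependent vector field on `J × M`. -/
abbrev IsSmoothOn (J : Set ℝ) (u : ℝ → Π x : M, TangentSpace (𝓡 3) x) : Prop :=
  ContMDiffOn (𝓘(ℝ, ℝ).prod (𝓡 3)) (𝓡 3).tangent ∞
    (fun q : ℝ × M => (⟨q.2, u q.1 q.2⟩ : TangentBundle (𝓡 3) M)) (J ×ˢ Set.univ)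

theorem smoothAt_velocity (hu : IsSmoothOn J u) (ht : t ∈ J) (x : M) : SmoothVF (u t) x := by
  have h1 : ContMDiff (𝓡 3) (𝓘(ℝ, ℝ).prod (𝓡 3)) ∞ (fun y : M => (t, y)) :=
    contMDiff_const.prodMk contMDiff_id
  have h2 := hu.comp (t := J ×ˢ Set.univ) (s := Set.univ) h1.contMDiffOn
    fun y _ => ⟨ht, Set.mem_univ y⟩
  exact h2.contMDiffAt Filter.univ_mem

/-- The velocity components in a chart, as functions of time and of the coordinates. -/
theorem contDiffOn_coordComp (hu : IsSmoothOn J u) (x₀ : M) (j : Fin 3) :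
    ContDiffOn ℝ ∞ (fun q : ℝ × E₃ => coordComp x₀ j (u q.1) ((chartAt E₃ x₀).symm q.2))
      (J ×ˢ (chartAt E₃ x₀).target) := by
  set e := trivializationAt E₃ (TangentSpace (𝓡 3) : M → Type _) x₀
  set φ := chartAt E₃ x₀
  have h1 : ContMDiffOn (𝓘(ℝ, ℝ).prod (𝓡 3)) 𝓘(ℝ, E₃) ∞
      (fun q : ℝ × M => (e (⟨q.2, u q.1 q.2⟩ : TangentBundle (𝓡 3) M)).2) (J ×ˢ φ.source) :=
    ((e.contMDiffOn_iff (fun q hq => by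
      rw [e.mem_source]; exact hq.2)).1 (hu.mono (Set.prod_mono_right (Set.subset_univ _)))).2
  have h2 : ContMDiffOn (𝓘(ℝ, ℝ).prod (𝓡 3)) (𝓘(ℝ, ℝ).prod (𝓡 3)) ∞
      (fun q : ℝ × E₃ => (q.1, φ.symm q.2)) (J ×ˢ φ.target) :=
    contMDiffOn_fst.prodMk ((contMDiffOn_chart_symm (n := ∞) (x := x₀)).comp contMDiffOn_snd
      fun q hq => hq.2)
  have h3 := h1.comp h2 fun q hq => ⟨hq.1, φ.map_target hq.2⟩
  have h4 : ContDiffOn ℝ ∞ (fun q : ℝ × E₃ =>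
      (e (⟨φ.symm q.2, u q.1 (φ.symm q.2)⟩ : TangentBundle (𝓡 3) M)).2) (J ×ˢ φ.target) := by
    rw [← contMDiffOn_iff_contDiffOn, modelWithCornersSelf_prod, ← chartedSpaceSelf_prod]
    exact h3
  refine ((EuclideanSpace.proj (𝕜 := ℝ) j : E₃ →L[ℝ] ℝ).contDiff.comp_contDiffOn h4).congr
    fun q hq => ?_
  have hs := φ.map_target hq.2
  rw [coordComp_eq hs]
  have h5 := DFunLike.congr_fun
    (TangentBundle.continuousLinearMapAt_trivializationAt (I := 𝓡 3) hs) (u q.1 (φ.symm q.2))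
  have h6 : e.continuousLinearMapAt ℝ (φ.symm q.2) (u q.1 (φ.symm q.2)) =
      (e (⟨φ.symm q.2, u q.1 (φ.symm q.2)⟩ : TangentBundle (𝓡 3) M)).2 := by
    rw [Trivialization.continuousLinearMapAt_apply, Trivialization.coe_linearMapAt_of_mem]
    exact hs
  exact congrArg (EuclideanSpace.proj (𝕜 := ℝ) j : E₃ →L[ℝ] ℝ) (h5.symm.trans h6)

/-- The time derivative of a vector field, one-sided at the endpoints of `J`. -/
def timeDeriv (J : Set ℝ) (u : ℝ → Π x : M, TangentSpace (𝓡 3) x) (t : ℝ) (x : M) :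
    TangentSpace (𝓡 3) x :=
  derivWithin (fun s => u s x) J t

/-- The time derivative of the `j`-th velocity component in the chart at `x₀`, as a function of the
coordinates. -/
def timeDerivComp (J : Set ℝ) (u : ℝ → Π x : M, TangentSpace (𝓡 3) x) (t : ℝ) (x₀ : M) (j : Fin 3)
    (y : E₃) : ℝ :=
  fderivWithin ℝ (fun q : ℝ × E₃ => coordComp x₀ j (u q.1) ((chartAt E₃ x₀).symm q.2))
    (J ×ˢ (chartAt E₃ x₀).target) (t, y) (1, 0)

/-- The time derivative of the components is smooth in space, also at the endpoints of the time
interval. -/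
theorem contDiffOn_timeDerivComp (hJ : J.OrdConnected) (hJ' : J.Nontrivial) (hu : IsSmoothOn J u)
    (ht : t ∈ J) (x₀ : M) (j : Fin 3) :
    ContDiffOn ℝ ∞ (timeDerivComp J u t x₀ j) (chartAt E₃ x₀).target := by
  have hU : UniqueDiffOn ℝ (J ×ˢ (chartAt E₃ x₀).target) :=
    (uniqueDiffOn_interval hJ hJ').2.1.prod (chartAt E₃ x₀).open_target.uniqueDiffOn
  have h1 := (contDiffOn_coordComp hu x₀ j).fderivWithin (m := ∞) hU (by simp)
  have h2 : ContDiffOn ℝ ∞ (fun y : E₃ => (t, y)) (chartAt E₃ x₀).target := by fun_prop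
  exact (h1.comp h2 fun y hy => ⟨ht, hy⟩).clm_apply contDiffOn_const

theorem smoothAt_timeDerivComp (hJ : J.OrdConnected) (hJ' : J.Nontrivial) (hu : IsSmoothOn J u)
    (ht : t ∈ J) (hx : x ∈ (chartAt E₃ x₀).source) (j : Fin 3) :
    SmoothFn (fun x => timeDerivComp J u t x₀ j (chartAt E₃ x₀ x)) x := by
  have h1 := (contDiffOn_timeDerivComp hJ hJ' hu ht x₀ j).contDiffAt
    ((chartAt E₃ x₀).open_target.mem_nhds ((chartAt E₃ x₀).map_source hx))
  exact ContMDiffAt.comp x h1.contMDiffAt (smoothAt_chart hx)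

theorem hasDerivWithinAt_coordComp (hu : IsSmoothOn J u) (ht : t ∈ J)
    (hx : x ∈ (chartAt E₃ x₀).source) (j : Fin 3) :
    HasDerivWithinAt (fun s => coordComp x₀ j (u s) x)
      (timeDerivComp J u t x₀ j (chartAt E₃ x₀ x)) J t := by
  have h := hasDerivWithinAt_fst (contDiffOn_coordComp hu x₀ j) ht ((chartAt E₃ x₀).map_source hx)
  simp only [(chartAt E₃ x₀).left_inv hx] at h
  exact h

/-- Smoothness on `J × M` gives differentiability in time at each point, within the fixed tangent
space. -/
theorem hasDerivWithinAt_velocity (hu : IsSmoothOn J u) (ht : t ∈ J)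
    (hx : x ∈ (chartAt E₃ x₀).source) : HasDerivWithinAt (fun s => u s x)
      (∑ j, timeDerivComp J u t x₀ j (chartAt E₃ x₀ x) • coordField x₀ j x) J t := by
  have h : HasDerivWithinAt (fun s => ∑ j, coordComp x₀ j (u s) x • coordField x₀ j x)
      (∑ j, timeDerivComp J u t x₀ j (chartAt E₃ x₀ x) • coordField x₀ j x) J t :=
    HasDerivWithinAt.fun_sum fun j _ => (hasDerivWithinAt_coordComp hu ht hx j).smul_const _
  exact h.congr_of_mem (fun s _ => eq_sum_coordField hx) ht

theorem timeDeriv_eq (hJ : J.OrdConnected) (hJ' : J.Nontrivial) (hu : IsSmoothOn J u) (ht : t ∈ J)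
    (hx : x ∈ (chartAt E₃ x₀).source) : timeDeriv J u t x =
      ∑ j, timeDerivComp J u t x₀ j (chartAt E₃ x₀ x) • coordField x₀ j x :=
  (hasDerivWithinAt_velocity hu ht hx).derivWithin ((uniqueDiffOn_interval hJ hJ').2.1 t ht)

theorem smoothAt_timeDeriv (hJ : J.OrdConnected) (hJ' : J.Nontrivial) (hu : IsSmoothOn J u)
    (ht : t ∈ J) (x : M) : SmoothVF (timeDeriv J u t) x := by
  have hx := mem_chart_source E₃ x
  have h1 : SmoothVF (fun y => ∑ j, timeDerivComp J u t x j (chartAt E₃ x y) • coordField x j y) x :=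
    .sum_section fun j _ => (smoothAt_timeDerivComp hJ hJ' hu ht hx j).smul_section
      (smoothAt_coordField hx j)
  refine h1.congr_of_eventuallyEq ?_
  filter_upwards [(chartAt E₃ x).open_source.mem_nhds hx] with y hy
  rw [timeDeriv_eq hJ hJ' hu ht hy]

theorem coordComp_timeDeriv (hJ : J.OrdConnected) (hJ' : J.Nontrivial) (hu : IsSmoothOn J u)
    (ht : t ∈ J) (hx : x ∈ (chartAt E₃ x₀).source) (j : Fin 3) :
    coordComp x₀ j (timeDeriv J u t) x = timeDerivComp J u t x₀ j (chartAt E₃ x₀ x) := by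
  rw [coordComp, timeDeriv_eq hJ hJ' hu ht hx]
  have h := coordComp_sum_smul (x₀ := x₀) (x := x)
    (fun j x => timeDerivComp J u t x₀ j (chartAt E₃ x₀ x)) (fun j => coordField x₀ j) j
  rw [coordComp] at h
  rw [h]
  simp [coordComp_coordField hx]

theorem mvfderiv_coord_eq_fderiv {f : M → ℝ} (hx : x ∈ (chartAt E₃ x₀).source) (hf : DiffFn f x)
    (i : Fin 3) : d₃ f x (coordField x₀ i x) =
      fderiv ℝ (fun z => f ((chartAt E₃ x₀).symm z)) (chartAt E₃ x₀ x)
        (EuclideanSpace.single i 1) := by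
  have hl := (chartAt E₃ x₀).left_inv hx
  rw [fderiv_comp_chart_symm ((chartAt E₃ x₀).map_source hx) (by rwa [hl]), hl]

/-- The curl commutes with the time derivative: in a chart it is a combination of components and
their first derivatives, with coefficients independent of time. -/
theorem hasDerivWithinAt_curl (hJ : J.OrdConnected) (hJ' : J.Nontrivial) (hu : IsSmoothOn J u)
    (ht : t ∈ J) (x : M) :
    HasDerivWithinAt (fun s => curl o (u s) x) (curl o (timeDeriv J u t) x) J t := by
  have hx := mem_chart_source E₃ x
  have hy := (chartAt E₃ x).map_source hx
  have hdu := smoothAt_timeDeriv hJ hJ' hu ht x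
  have h1 : ∀ i j, HasDerivWithinAt (fun s => d₃ (coordComp x j (u s)) x (coordField x i x))
      (d₃ (coordComp x j (timeDeriv J u t)) x (coordField x i x)) J t := fun i j => by
    have h2 := hasDerivWithinAt_fderiv hJ hJ' (chartAt E₃ x).open_target
      (contDiffOn_coordComp hu x j) ht hy (EuclideanSpace.single i 1)
    refine (h2.congr_of_mem (fun s hs => ?_) ht).congr_deriv ?_
    · exact mvfderiv_coord_eq_fderiv hx ((smoothAt_coordComp hx (smoothAt_velocity hu hs x)
        j).mdifferentiableAt (by simp)) i
    · rw [mvfderiv_coord_eq_fderiv hx ((smoothAt_coordComp hx hdu j).mdifferentiableAt (by simp))]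
      congr 1
      refine Filter.EventuallyEq.fderiv_eq ?_
      filter_upwards [(chartAt E₃ x).open_target.mem_nhds hy] with z hz
      rw [coordComp_timeDeriv hJ hJ' hu ht ((chartAt E₃ x).map_target hz),
        (chartAt E₃ x).right_inv hz]
      rfl
  have h3 : ∀ j, HasDerivWithinAt (fun s => coordComp x j (u s) x)
      (coordComp x j (timeDeriv J u t) x) J t := fun j => by
    rw [coordComp_timeDeriv hJ hJ' hu ht hx]
    exact hasDerivWithinAt_coordComp hu ht hx j
  have h4 : HasDerivWithinAt (fun s => ∑ j, (coordComp x j (u s) x • curl o (coordField x j) x +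
      ∑ i, d₃ (coordComp x j (u s)) x (coordField x i x) •
        axial (o x) ((d₃ (fun y => (chartAt E₃ x y : E₃) i) x).smulRight (coordField x j x))))
      (∑ j, (coordComp x j (timeDeriv J u t) x • curl o (coordField x j) x +
      ∑ i, d₃ (coordComp x j (timeDeriv J u t)) x (coordField x i x) •
        axial (o x) ((d₃ (fun y => (chartAt E₃ x y : E₃) i) x).smulRight (coordField x j x)))) J t :=
    HasDerivWithinAt.fun_sum fun j _ => ((h3 j).smul_const _).add
      (HasDerivWithinAt.fun_sum fun i _ => (h1 i j).smul_const _)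
  rw [← curl_eq_sum_coord hx hdu] at h4
  exact h4.congr_of_mem (fun s hs => curl_eq_sum_coord hx (smoothAt_velocity hu hs x)) ht

/-- The time derivative of the vorticity is dual to the curl of the time derivative of the velocity.
-/
theorem derivWithin_vorticity (hJ : J.OrdConnected) (hJ' : J.Nontrivial) (hu : IsSmoothOn J u)
    (ht : t ∈ J) (x : M) : derivWithin (fun s => vorticity o (u s) x) J t =
      innerSL ℝ (curl o (timeDeriv J u t) x) := by
  have h : HasDerivWithinAt (fun s => innerSL ℝ (curl o (u s) x))
      (innerSL ℝ (curl o (timeDeriv J u t) x)) J t :=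
    (innerSL ℝ (E := TangentSpace (𝓡 3) x)).hasFDerivAt.comp_hasDerivWithinAt t
      (hasDerivWithinAt_curl hJ hJ' hu ht x)
  refine (h.congr_of_mem (fun s hs => ?_) ht).derivWithin ((uniqueDiffOn_interval hJ hJ').2.1 t ht)
  exact vorticity_eq (mdiffAt_of_smoothAt (smoothAt_velocity hu hs x))

/-! ### Differentiating a squared norm in time -/

section SquareIntegrable

variable [MeasurableSpace M] [BorelSpace M] {μ : Measure M}

theorem continuous_inner_section (hX : ∀ y, SmoothVF X y) (hY : ∀ y, SmoothVF Y y) :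
    Continuous fun x => ⟪X x, Y x⟫ :=
  continuous_iff_continuousAt.2 fun x => (smoothAt_inner (hX x) (hY x)).continuousAt

theorem integrable_norm_mul_norm (hX : ∀ y, SmoothVF X y) (hY : ∀ y, SmoothVF Y y)
    (hXi : Integrable (fun x => ‖X x‖ ^ 2) μ) (hYi : Integrable (fun x => ‖Y x‖ ^ 2) μ) :
    Integrable (fun x => ‖X x‖ * ‖Y x‖) μ := by
  refine (hXi.add hYi).mono' ((continuous_norm_section hX).mul
    (continuous_norm_section hY)).aestronglyMeasurable (Eventually.of_forall fun x => ?_)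
  rw [Real.norm_of_nonneg (by positivity), Pi.add_apply]
  nlinarith [sq_nonneg (‖X x‖ - ‖Y x‖), sq_nonneg (‖X x‖ + ‖Y x‖)]

theorem integrable_inner (hX : ∀ y, SmoothVF X y) (hY : ∀ y, SmoothVF Y y)
    (hXi : Integrable (fun x => ‖X x‖ ^ 2) μ) (hYi : Integrable (fun x => ‖Y x‖ ^ 2) μ) :
    Integrable (fun x => ⟪X x, Y x⟫) μ :=
  (integrable_norm_mul_norm hX hY hXi hYi).mono'
    (continuous_inner_section hX hY).aestronglyMeasurable
    (Eventually.of_forall fun _ => norm_inner_le_norm _ _)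

theorem norm_add_sq_le_two_mul {E : Type*} [SeminormedAddCommGroup E] (a b : E) :
    ‖a + b‖ ^ 2 ≤ 2 * ‖a‖ ^ 2 + 2 * ‖b‖ ^ 2 := by
  nlinarith [norm_add_le a b, norm_nonneg (a + b), norm_nonneg a, norm_nonneg b,
    sq_nonneg (‖a‖ - ‖b‖)]

theorem integrable_norm_add_sq (hX : ∀ y, SmoothVF X y) (hY : ∀ y, SmoothVF Y y)
    (hXi : Integrable (fun x => ‖X x‖ ^ 2) μ) (hYi : Integrable (fun x => ‖Y x‖ ^ 2) μ) :
    Integrable (fun x => ‖X x + Y x‖ ^ 2) μ := by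
  refine ((hXi.const_mul 2).add (hYi.const_mul 2)).mono' ?_ (Eventually.of_forall fun x => ?_)
  · exact ((continuous_norm_section fun y => (hX y).add_section (hY y)).pow 2).aestronglyMeasurable
  · rw [Real.norm_of_nonneg (by positivity)]
    exact norm_add_sq_le_two_mul _ _

theorem integrable_norm_smul_sq (c : ℝ) (hXi : Integrable (fun x => ‖X x‖ ^ 2) μ) :
    Integrable (fun x => ‖c • X x‖ ^ 2) μ := by
  simp only [norm_smul, mul_pow]
  exact hXi.const_mul _

/-- The square of the `L²` norm of a curve of vector fields which is differentiable in `L²`. The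
square integrability of the derivative `w'` is part of the conclusion. -/
theorem hasDerivWithinAt_integral_norm_sq {J : Set ℝ} {t : ℝ} [NeBot (𝓝[J \ {t}] t)]
    {w : ℝ → Π x : M, TangentSpace (𝓡 3) x} {w' : Π x : M, TangentSpace (𝓡 3) x}
    (hw : ∀ s ∈ J, ∀ x, SmoothVF (w s) x) (hw' : ∀ x, SmoothVF w' x) (ht : t ∈ J)
    (hwi : ∀ s ∈ J, Integrable (fun x => ‖w s x‖ ^ 2) μ)
    (hlim : Tendsto (fun s => ∫⁻ x, ‖(s - t)⁻¹ • (w s x - w t x) - w' x‖ₑ ^ 2 ∂μ)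
      (𝓝[J \ {t}] t) (𝓝 0)) :
    Integrable (fun x => ‖w' x‖ ^ 2) μ ∧
      HasDerivWithinAt (fun s => ∫ x, ‖w s x‖ ^ 2 ∂μ) (2 * ∫ x, ⟪w' x, w t x⟫ ∂μ) J t := by
  set d : ℝ → Π x : M, TangentSpace (𝓡 3) x := fun s =>
    (s - t)⁻¹ • (w s - w t) - w'
  have hd : ∀ s ∈ J, ∀ x, SmoothVF (d s) x := fun s hs x =>
    (((hw s hs x).sub_section (hw t ht x)).const_smul_section (a := (s - t)⁻¹)).sub_section (hw' x)
  have hev : ∀ᶠ s in 𝓝[J \ {t}] t, s ∈ J \ {t} ∧ Integrable (fun x => ‖d s x‖ ^ 2) μ := by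
    filter_upwards [self_mem_nhdsWithin, hlim.eventually_lt_const ENNReal.zero_lt_top] with s hs hs'
    refine ⟨hs, ((continuous_norm_section (hd s hs.1)).pow 2).aestronglyMeasurable, ?_⟩
    rw [hasFiniteIntegral_iff_enorm]
    have hs' : ∫⁻ x, ‖d s x‖ₑ ^ 2 ∂μ < ⊤ := hs'
    simpa only [enorm_pow, enorm_norm] using hs'
  set n : ℝ → ℝ := fun s => ∫ x, ‖d s x‖ ^ 2 ∂μ
  have hn0 : ∀ s, 0 ≤ n s := fun s => integral_nonneg fun x => by positivity
  have hn : Tendsto n (𝓝[J \ {t}] t) (𝓝 0) := by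
    have h := (ENNReal.tendsto_toReal ENNReal.zero_ne_top).comp hlim
    rw [ENNReal.toReal_zero] at h
    refine h.congr' ?_
    filter_upwards [hev] with s hs
    have h1 := ofReal_integral_norm_eq_lintegral_enorm hs.2
    simp only [norm_pow, norm_norm, enorm_pow, enorm_norm] at h1
    exact (congrArg ENNReal.toReal h1.symm).trans (ENNReal.toReal_ofReal (hn0 s))
  have hws : ∀ s ∈ J \ {t}, ∀ x, w s x = w t x + (s - t) • (w' x + d s x) := fun s hs x => by
    have h0 : s - t ≠ 0 := sub_ne_zero.2 hs.2
    simp only [d, Pi.sub_apply, Pi.smul_apply]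
    rw [add_sub_cancel, smul_smul, mul_inv_cancel₀ h0, one_smul, add_sub_cancel]
  -- one difference quotient at finite `L²` distance from `w'` suffices
  have hw'i : Integrable (fun x => ‖w' x‖ ^ 2) μ := by
    obtain ⟨s, hs, hds⟩ := hev.exists
    have h1 := integrable_norm_add_sq (hw s hs.1)
      (fun y => (hw t ht y).const_smul_section (a := (-1 : ℝ))) (hwi s hs.1)
      (integrable_norm_smul_sq (-1) (hwi t ht))
    have h2 := integrable_norm_add_sq (fun y => ((hw s hs.1 y).add_section
        ((hw t ht y).const_smul_section (a := (-1 : ℝ)))).const_smul_section (a := (s - t)⁻¹))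
      (fun y => (hd s hs.1 y).const_smul_section (a := (-1 : ℝ)))
      (integrable_norm_smul_sq (s - t)⁻¹ h1) (integrable_norm_smul_sq (-1) hds)
    refine h2.congr (Eventually.of_forall fun x => ?_)
    have : (s - t)⁻¹ • (w s x + (-1 : ℝ) • w t x) + (-1 : ℝ) • d s x = w' x := by
      simp only [d, Pi.sub_apply, Pi.smul_apply]
      module
    exact congrArg (fun v : TangentSpace (𝓡 3) x => ‖v‖ ^ 2) this
  refine ⟨hw'i, hasDerivWithinAt_iff_tendsto_slope.2 ?_⟩
  set A := ∫ x, ⟪w' x, w t x⟫ ∂μ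
  set B := ∫ x, ‖w' x‖ ^ 2 ∂μ
  set N := ∫ x, ‖w t x‖ ^ 2 ∂μ
  have hN : 0 ≤ N := integral_nonneg fun x => by positivity
  have hh : Tendsto (fun s => |s - t|) (𝓝[J \ {t}] t) (𝓝 0) := by
    have : Tendsto (fun s => |s - t|) (𝓝 t) (𝓝 |t - t|) := by
      exact (continuous_abs.comp (continuous_id.sub continuous_const)).tendsto t
    simpa using this.mono_left nhdsWithin_le_nhds
  -- the summand `|s - t|` keeps the root positive, so that it can serve as the weight in the
  -- inequality `2 ⟪d, w⟫ ≤ ε |w|² + ε⁻¹ |d|²` with `ε² = n s + |s - t|`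
  have hbound : Tendsto (fun s => √(n s + |s - t|) * (N + 1) + |s - t| * (2 * B + 2 * n s))
      (𝓝[J \ {t}] t) (𝓝 0) := by
    have h1 := ((hn.add hh).sqrt.mul_const (N + 1)).add (hh.mul ((hn.const_mul 2).const_add (2 * B)))
    simpa using h1
  refine tendsto_iff_norm_sub_tendsto_zero.2 (squeeze_zero' (Eventually.of_forall fun s =>
    norm_nonneg _) ?_ hbound)
  filter_upwards [hev] with s hs
  obtain ⟨hsJ, hds⟩ := hs
  have h0 : s - t ≠ 0 := sub_ne_zero.2 hsJ.2
  have hi1 := integrable_inner hw' (hw t ht) hw'i (hwi t ht)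
  have hi2 := integrable_inner (hd s hsJ.1) (hw t ht) hds (hwi t ht)
  have hi3 := integrable_norm_add_sq hw' (hd s hsJ.1) hw'i hds
  have hexp : ∫ x, ‖w s x‖ ^ 2 ∂μ = N + (2 * (s - t)) * A +
      (2 * (s - t)) * ∫ x, ⟪d s x, w t x⟫ ∂μ + (s - t) ^ 2 * ∫ x, ‖w' x + d s x‖ ^ 2 ∂μ := by
    simp only [N, A, ← integral_const_mul]
    have e1 : Integrable (fun x => ‖w t x‖ ^ 2 + 2 * (s - t) * ⟪w' x, w t x⟫) μ :=
      (hwi t ht).add (hi1.const_mul _)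
    have e2 : Integrable (fun x => ‖w t x‖ ^ 2 + 2 * (s - t) * ⟪w' x, w t x⟫ +
        2 * (s - t) * ⟪d s x, w t x⟫) μ := e1.add (hi2.const_mul _)
    rw [← integral_add (hwi t ht) (hi1.const_mul _), ← integral_add e1 (hi2.const_mul _),
      ← integral_add e2 (hi3.const_mul _)]
    refine integral_congr_ae (Eventually.of_forall fun x => ?_)
    dsimp only
    rw [hws s hsJ x, norm_add_sq_real, norm_smul, inner_smul_right, inner_add_right,
      real_inner_comm (w' x), real_inner_comm (d s x), mul_pow, Real.norm_eq_abs, sq_abs]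
    ring
  have hε : 0 < √(n s + |s - t|) :=
    Real.sqrt_pos.2 (add_pos_of_nonneg_of_pos (hn0 s) (abs_pos.2 h0))
  set ε := √(n s + |s - t|)
  have hcs : |2 * ∫ x, ⟪d s x, w t x⟫ ∂μ| ≤ ε * (N + 1) := by
    calc |2 * ∫ x, ⟪d s x, w t x⟫ ∂μ| = ‖∫ x, 2 * ⟪d s x, w t x⟫ ∂μ‖ := by
          rw [integral_const_mul, Real.norm_eq_abs]
      _ ≤ ∫ x, (ε * ‖w t x‖ ^ 2 + ε⁻¹ * ‖d s x‖ ^ 2) ∂μ := by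
          refine norm_integral_le_of_norm_le (((hwi t ht).const_mul _).add (hds.const_mul _))
            (Eventually.of_forall fun x => ?_)
          rw [norm_mul, Real.norm_ofNat]
          have h1 := norm_inner_le_norm (𝕜 := ℝ) (d s x) (w t x)
          have h2 : 0 ≤ ε⁻¹ * (‖d s x‖ - ε * ‖w t x‖) ^ 2 := by positivity
          have h3 : ε⁻¹ * (‖d s x‖ - ε * ‖w t x‖) ^ 2 =
              ε⁻¹ * ‖d s x‖ ^ 2 - 2 * (‖d s x‖ * ‖w t x‖) + ε * ‖w t x‖ ^ 2 := by
            field_simp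
            ring
          linarith
      _ = ε * N + ε⁻¹ * n s := by
          rw [integral_add ((hwi t ht).const_mul _) (hds.const_mul _), integral_const_mul,
            integral_const_mul]
      _ ≤ ε * N + ε := by
          have : ε⁻¹ * n s ≤ ε := by
            rw [inv_mul_le_iff₀ hε, Real.mul_self_sqrt (by positivity)]
            linarith [abs_nonneg (s - t)]
          linarith
      _ = _ := by ring
  have hq : |∫ x, ‖w' x + d s x‖ ^ 2 ∂μ| ≤ 2 * B + 2 * n s := by
    rw [abs_of_nonneg (integral_nonneg fun x => by positivity)]
    simp only [B, n, ← integral_const_mul]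
    rw [← integral_add (hw'i.const_mul _) (hds.const_mul _)]
    exact integral_mono hi3 ((hw'i.const_mul _).add (hds.const_mul _)) fun x =>
      norm_add_sq_le_two_mul _ _
  have hslope : slope (fun s => ∫ x, ‖w s x‖ ^ 2 ∂μ) t s - 2 * A =
      2 * ∫ x, ⟪d s x, w t x⟫ ∂μ + (s - t) * ∫ x, ‖w' x + d s x‖ ^ 2 ∂μ := by
    rw [slope_def_field, hexp]
    simp only [N]
    field_simp
    ring
  rw [hslope, Real.norm_eq_abs]
  refine (abs_add_le _ _).trans (add_le_add hcs ?_)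
  rw [abs_mul]
  exact mul_le_mul_of_nonneg_left hq (abs_nonneg _)

end SquareIntegrable

/-! ### Pointwise bounds for the enstrophy flux -/

/-- The Ricci tensor is linear, which is not immediate from its definition by local extensions. -/
theorem ricci_eq_clm (x : M) : ∃ R : TangentSpace (𝓡 3) x →L[ℝ] TangentSpace (𝓡 3) x,
    ∀ v, ricci ∇ᴸ x v = R v := by
  refine ⟨∑ i, TensorialAt.mkHom (I := 𝓡 3) (F := E₃) (fun X : Π x : M, TangentSpace (𝓡 3) x =>
    curvature ∇ᴸ X (extend E₃ (frame (𝓡 3) x i)) (extend E₃ (frame (𝓡 3) x i)) x) x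
    (tensorialAt_curvature (contMDiffAt_extend (𝓡 3) E₃ (frame (𝓡 3) x i))), fun v => ?_⟩
  rw [ricci, sum_apply]
  refine Finset.sum_congr rfl fun i _ => ?_
  have h := TensorialAt.mkHom_apply
    (tensorialAt_curvature (Y := extend E₃ (frame (𝓡 3) x i))
      (contMDiffAt_extend (𝓡 3) E₃ (frame (𝓡 3) x i)))
    (mdifferentiableAt_extend (𝓡 3) E₃ v)
  rw [extend_apply_self] at h
  exact h.symm

/-- The operator norm of `∇ X` is bounded by its Hilbert-Schmidt norm. -/
theorem norm_leviCivita_le (v : TangentSpace (𝓡 3) x) :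
    ‖∇ᴸ X x v‖ ≤ √(normSqNabla X x) * ‖v‖ := by
  set b := frame (𝓡 3) x
  have h1 : ∑ i, ⟪b i, v⟫ ^ 2 = ‖v‖ ^ 2 := b.sum_sq_inner_right v
  calc ‖∇ᴸ X x v‖ = ‖∑ i, ⟪b i, v⟫ • ∇ᴸ X x (b i)‖ := by rw [← apply_eq_sum b]
    _ ≤ ∑ i, |⟪b i, v⟫| * ‖∇ᴸ X x (b i)‖ := by
        refine (norm_sum_le _ _).trans (Finset.sum_le_sum fun i _ => ?_)
        rw [norm_smul, Real.norm_eq_abs]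
    _ ≤ √(∑ i, |⟪b i, v⟫| ^ 2) * √(∑ i, ‖∇ᴸ X x (b i)‖ ^ 2) := Real.sum_mul_le_sqrt_mul_sqrt _ _ _
    _ = √(normSqNabla X x) * ‖v‖ := by
        simp only [sq_abs, h1, Real.sqrt_sq (norm_nonneg v)]
        rw [mul_comm]; rfl

theorem normSqNabla_nonneg : 0 ≤ normSqNabla X x :=
  Finset.sum_nonneg fun _ _ => sq_nonneg _

theorem norm_sq_curl_le : ‖curl o X x‖ ^ 2 ≤ 4 * normSqNabla X x := by
  set b := frame (𝓡 3) x
  have h1 : ∀ v, ‖v‖ = 1 → ‖∇ᴸ X x v‖ ≤ √(normSqNabla X x) := fun v hv => by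
    simpa [hv] using norm_leviCivita_le (X := X) v
  have h2 : ∀ i, -⟪∇ᴸ X x (∇ᴸ X x (b i)), b i⟫ ≤ normSqNabla X x := fun i => by
    have h3 := h1 (b i) (b.norm_eq_one i)
    have h4 := norm_leviCivita_le (X := X) (∇ᴸ X x (b i))
    have h5 := norm_inner_le_norm (𝕜 := ℝ) (∇ᴸ X x (∇ᴸ X x (b i))) (b i)
    rw [b.norm_eq_one, mul_one, Real.norm_eq_abs] at h5
    calc _ ≤ _ := (neg_le_abs _).trans (h5.trans h4)
      _ ≤ √(normSqNabla X x) * √(normSqNabla X x) :=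
        mul_le_mul_of_nonneg_left h3 (Real.sqrt_nonneg _)
      _ = _ := Real.mul_self_sqrt normSqNabla_nonneg
  have h3 : -∑ i, ⟪∇ᴸ X x (∇ᴸ X x (b i)), b i⟫ ≤ 3 * normSqNabla X x := by
    rw [← Finset.sum_neg_distrib]
    refine (Finset.sum_le_sum fun i _ => h2 i).trans_eq ?_
    rw [Finset.sum_const, Finset.card_univ, Fintype.card_fin,
      (Fact.out : finrank ℝ (TangentSpace (𝓡 3) x) = 3)]
    simp
  rw [curl, norm_sq_axial b]
  change normSqNabla X x - _ ≤ _
  linarith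

/-- The right hand side is integrable for a regular solution. -/
theorem norm_enstrophyFlux_le {ν : ℝ} (hν : 0 < ν) :
    ‖enstrophyFlux o ν X W x‖ ≤ (1 / 4 * (‖W x‖ ^ 2 + ‖X x‖ ^ 2 * ‖W x‖ ^ 2)) +
      ν * (5 / 2 * normSqNabla W x + ‖W x‖ ^ 2) := by
  have e : enstrophyFlux o ν X W x = ((1 / 2 : ℝ) * ⟪W x, W x⟫) • X x +
    ν • (cross (o x) (curl o W x) (W x) - ∇ᴸ W x (W x)) := rfl
  rw [e]
  refine (norm_add_le _ _).trans (add_le_add ?_ ?_)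
  · rw [norm_smul, real_inner_self_eq_norm_sq, Real.norm_of_nonneg (by positivity)]
    nlinarith [sq_nonneg (‖W x‖ - ‖X x‖ * ‖W x‖)]
  · rw [norm_smul, Real.norm_of_nonneg hν.le]
    refine mul_le_mul_of_nonneg_left ((norm_sub_le _ _).trans ?_) hν.le
    have h1 := norm_cross_le (o := o x) (curl o W x) (W x)
    have h2 := norm_leviCivita_le (X := W) (W x)
    have h3 := norm_sq_curl_le (o := o) (X := W) (x := x)
    have h4 := Real.sq_sqrt (normSqNabla_nonneg (X := W) (x := x))
    nlinarith [sq_nonneg (‖curl o W x‖ - ‖W x‖), sq_nonneg (√(normSqNabla W x) - ‖W x‖)]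

/-! ### Vorticity as the form of the curl -/

theorem symGrad_const_smul (c : ℝ) (hX : DiffVF X x) (a : TangentSpace (𝓡 3) x) :
    symGrad (c • X) x a = c • symGrad X x a := by
  simp only [symGrad, sharp, leviCivita_const_smul c hX, smul_apply, inner_smul_left, conj_trivial,
    smul_add, Finset.smul_sum, smul_smul, mul_comm, mul_left_comm]

theorem inner_symGrad (a b : TangentSpace (𝓡 3) x) :
    ⟪b, symGrad X x a⟫ = 1 / 2 * (⟪b, ∇ᴸ X x a⟫ + ⟪∇ᴸ X x b, a⟫) := by
  have h := inner_sharp ((innerSL ℝ a).comp (∇ᴸ X x)) b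
  have e : ((innerSL ℝ a).comp (∇ᴸ X x) : TangentSpace (𝓡 3) x → ℝ) = fun Y => ⟪∇ᴸ X x Y, a⟫ := by
    funext Y
    simp [real_inner_comm]
  rw [e, real_inner_comm] at h
  rw [symGrad, inner_smul_right, inner_add_right, h]

/-- The intrinsic Ricci tensor of the drift `-X / (2 ν)`. -/
theorem intrinsicRicci_velocity {ν : ℝ} (hν : ν ≠ 0) (hX : SmoothVF X x)
    (a : TangentSpace (𝓡 3) x) :
    intrinsicRicci (fun y => (-(1 / (2 * ν))) • X y) x a = ricci ∇ᴸ x a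
      + (1 / (2 * ν ^ 2) * ⟪a, X x⟫) • X x - (1 / ν) • symGrad X x a := by
  refine (intrinsicRicci_eq finrank_euclideanSpace_fin (v := (-(1 / (2 * ν))) • X)
    hX.const_smul_section a).trans ?_
  rw [symGrad_const_smul _ (mdiffAt_of_smoothAt hX), Pi.smul_apply, inner_smul_right,
    smul_smul, smul_smul, sub_eq_add_neg, ← neg_smul]
  congr 2
  · congr 1
    field_simp
  · field_simp

theorem sum_inner_apply_mul_inner (A : TangentSpace (𝓡 3) x →L[ℝ] TangentSpace (𝓡 3) x)
    (w : TangentSpace (𝓡 3) x) :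
    ∑ i, ⟪w, A (frame (𝓡 3) x i)⟫ * ⟪w, frame (𝓡 3) x i⟫ = ⟪w, A w⟫ := by
  conv_rhs => rw [apply_eq_sum (frame (𝓡 3) x) A w, inner_sum]
  refine Finset.sum_congr rfl fun i _ => ?_
  rw [inner_smul_right, real_inner_comm w (frame (𝓡 3) x i), mul_comm]

/-- The pairing `⟨(intrinsicRicci)^# ω, ω⟩` for the `1`-form `ω` dual to `w`. The symmetrized
gradient may be replaced by the gradient in the quadratic form. -/
theorem formInner_intrinsicRicci {ν : ℝ} (hν : ν ≠ 0) (hX : SmoothVF X x)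
    (w : TangentSpace (𝓡 3) x) :
    formInner x (fun A => ⟪w, intrinsicRicci (fun y => (-(1 / (2 * ν))) • X y) x A⟫)
      (fun A => ⟪w, A⟫) =
      ⟪ricci ∇ᴸ x w, w⟫ + 1 / (2 * ν ^ 2) * ⟪w, X x⟫ ^ 2 - 1 / ν * ⟪∇ᴸ X x w, w⟫ := by
  obtain ⟨R, hR⟩ := ricci_eq_clm x
  have e1 := sum_inner_apply_mul_inner R w
  have e2 := sum_inner_apply_mul_inner (∇ᴸ X x) w
  have e3 : ∑ i, ⟪frame (𝓡 3) x i, X x⟫ * ⟪w, frame (𝓡 3) x i⟫ = ⟪w, X x⟫ := by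
    rw [← (frame (𝓡 3) x).sum_inner_mul_inner]
    exact Finset.sum_congr rfl fun i _ => mul_comm _ _
  have e4 : ∑ i, ⟪∇ᴸ X x w, frame (𝓡 3) x i⟫ * ⟪w, frame (𝓡 3) x i⟫ = ⟪∇ᴸ X x w, w⟫ := by
    rw [← (frame (𝓡 3) x).sum_inner_mul_inner]
    exact Finset.sum_congr rfl fun i _ => by rw [real_inner_comm w]
  have e5 : ∀ i, ⟪w, intrinsicRicci (fun y => (-(1 / (2 * ν))) • X y) x (frame (𝓡 3) x i)⟫ *
      ⟪w, frame (𝓡 3) x i⟫ = ⟪w, R (frame (𝓡 3) x i)⟫ * ⟪w, frame (𝓡 3) x i⟫ +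
        1 / (2 * ν ^ 2) * ⟪w, X x⟫ * (⟪frame (𝓡 3) x i, X x⟫ * ⟪w, frame (𝓡 3) x i⟫) -
        1 / ν * (1 / 2) * (⟪w, ∇ᴸ X x (frame (𝓡 3) x i)⟫ * ⟪w, frame (𝓡 3) x i⟫) -
        1 / ν * (1 / 2) * (⟪∇ᴸ X x w, frame (𝓡 3) x i⟫ * ⟪w, frame (𝓡 3) x i⟫) := fun i => by
    rw [intrinsicRicci_velocity hν hX, inner_sub_right, inner_add_right, inner_smul_right,
      inner_smul_right, inner_symGrad, hR]
    ring
  simp only [formInner, e5, Finset.sum_sub_distrib, Finset.sum_add_distrib, ← Finset.mul_sum]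
  rw [e1, e2, e3, e4, hR, real_inner_comm w (R w), real_inner_comm w (∇ᴸ X x w)]
  ring

end Smooth

/-! ### Cutoff functions on complete manifolds -/

section HopfRinow

variable {E : Type*} [NormedAddCommGroup E] [NormedSpace ℝ E] {H : Type*} [TopologicalSpace H]
  {M : Type*} [EMetricSpace M] [ChartedSpace H M]

open scoped ENNReal NNReal

/-- A Riemannian manifold is a length space: almost-minimizing paths have points at any intermediate
distance. -/
theorem exists_edist_le_of_edist_lt (I : ModelWithCorners ℝ E H) [IsManifold I ∞ M]
    [RiemannianBundle (fun x : M => TangentSpace I x)]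
    [IsContMDiffRiemannianBundle I ∞ E (fun x : M => TangentSpace I x)]
    [IsRiemannianManifold I M]
    {x y : M} {r s : ℝ≥0∞} (hr : r ≠ ⊤) (h : edist x y < r + s) :
    ∃ z, edist x z ≤ r ∧ edist z y ≤ s := by
  rcases le_or_gt (edist x y) r with hxy | hxy
  · exact ⟨y, hxy, by simp⟩
  rw [IsRiemannianManifold.out (I := I)] at h
  obtain ⟨γ, h0, h1, hγ, hl⟩ := exists_lt_of_riemannianEDist_lt h
  have hc : ContinuousOn (fun t => edist x (γ t)) (Set.Icc 0 1) :=
    (continuous_const.edist continuous_id).comp_continuousOn hγ.continuousOn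
  -- the distance from `x` takes the value `r` along the path, by continuity
  obtain ⟨t, ht, hrt⟩ : r ∈ (fun t => edist x (γ t)) '' Set.Icc 0 1 :=
    intermediate_value_Icc zero_le_one hc ⟨by simp [h0], by simpa [h1] using hxy.le⟩
  refine ⟨γ t, hrt.le, ?_⟩
  have e1 : r ≤ pathELength I γ 0 t := by
    rw [← hrt]
    simp only
    rw [IsRiemannianManifold.out (I := I)]
    exact riemannianEDist_le_pathELength (hγ.mono (Set.Icc_subset_Icc_right ht.2)) h0 rfl ht.1
  have e2 : edist (γ t) y ≤ pathELength I γ t 1 := by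
    rw [IsRiemannianManifold.out (I := I)]
    exact riemannianEDist_le_pathELength (hγ.mono (Set.Icc_subset_Icc_left ht.1)) rfl h1 ht.2
  rw [← pathELength_add ht.1 ht.2] at hl
  refine e2.trans ?_
  have h3 : r + pathELength I γ t 1 ≤ r + s := (add_le_add e1 le_rfl).trans hl.le
  exact (ENNReal.add_le_add_iff_left hr).1 h3

/-- The Hopf-Rinow theorem: in a complete Riemannian manifold, closed balls are compact. The
supremum of the radii of compact balls around `x` is attained, because the manifold is a length
space, and cannot be finite, because the manifold is locally compact. -/
theorem isCompact_closedEBall [FiniteDimensional ℝ E] [CompleteSpace M] (I : ModelWithCorners ℝ E H)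
    [IsManifold I ∞ M]
    [RiemannianBundle (fun x : M => TangentSpace I x)]
    [IsContMDiffRiemannianBundle I ∞ E (fun x : M => TangentSpace I x)]
    [IsRiemannianManifold I M]
    (x : M) (r : ℝ≥0) :
    IsCompact (Metric.closedEBall x r) := by
  haveI : LocallyCompactSpace M := Manifold.locallyCompact_of_finiteDimensional I
  by_contra hr
  set A : Set ℝ≥0 := {s | IsCompact (Metric.closedEBall x s)}
  have hA : ∀ {s t : ℝ≥0}, t ∈ A → s ≤ t → s ∈ A := fun ht hst =>
    IsCompact.of_isClosed_subset ht Metric.isClosed_closedEBall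
      (Metric.closedEBall_subset_closedEBall (by exact_mod_cast hst))
  have hbdd : BddAbove A := ⟨r, fun s hs => by
    by_contra! h
    exact hr (hA hs h.le)⟩
  have h0 : (0 : ℝ≥0) ∈ A := by
    have : Metric.closedEBall x ((0 : ℝ≥0) : ℝ≥0∞) = {x} := by
      ext y; simp
    simp only [A, Set.mem_ofPred_eq, this, isCompact_singleton]
  set R := sSup A
  -- the ball of radius `R` is totally bounded: it is close to a compact ball around `x`
  have hR : IsCompact (Metric.closedEBall x R) := by
    refine isCompact_iff_totallyBounded_isComplete.2
      ⟨EMetric.totallyBounded_iff.2 fun ε hε => ?_, Metric.isClosed_closedEBall.isComplete⟩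
    obtain ⟨δ, hδ0, hδ⟩ := ENNReal.lt_iff_exists_nnreal_btwn.1 (ENNReal.half_pos hε.ne')
    have hδ0' : 0 < δ := by exact_mod_cast hδ0
    obtain ⟨s, hs, hRs⟩ : ∃ s ∈ A, R < s + δ := by
      rcases lt_or_ge R δ with h | h
      · exact ⟨0, h0, by simpa using h⟩
      · have h1 : R - δ < R := tsub_lt_self (hδ0'.trans_le h) hδ0'
        obtain ⟨s, hs, h2⟩ := exists_lt_of_lt_csSup ⟨0, h0⟩ h1
        exact ⟨s, hs, (tsub_lt_iff_right h).1 h2⟩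
    obtain ⟨t, ht, hcov⟩ := EMetric.totallyBounded_iff.1
      (isCompact_iff_totallyBounded_isComplete.1 hs).1 _ (ENNReal.half_pos hε.ne')
    refine ⟨t, ht, fun y hy => ?_⟩
    have hy' : edist x y < s + δ := by
      rw [edist_comm]
      exact lt_of_le_of_lt hy (by exact_mod_cast hRs)
    obtain ⟨z, hz1, hz2⟩ := exists_edist_le_of_edist_lt I ENNReal.coe_ne_top hy'
    obtain ⟨w, hw, hzw⟩ := Set.mem_iUnion₂.1 (hcov (show z ∈ Metric.closedEBall x s by
      rwa [Metric.mem_closedEBall']))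
    refine Set.mem_iUnion₂.2 ⟨w, hw, ?_⟩
    rw [Metric.mem_eball] at hzw ⊢
    calc edist y w ≤ edist y z + edist z w := edist_triangle _ _ _
      _ < ε / 2 + ε / 2 := ENNReal.add_lt_add (by rw [edist_comm]; exact hz2.trans_lt hδ) hzw
      _ = ε := ENNReal.add_halves _
  -- a neighbourhood of the compact ball has compact closure, so a larger radius is in `A`
  obtain ⟨δ, hδ, hK⟩ := hR.exists_isCompact_cthickening
  have h1 : R + (δ / 2).toNNReal ∈ A := by
    refine IsCompact.of_isClosed_subset hK Metric.isClosed_closedEBall fun y hy => ?_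
    have hy' : edist x y < R + ENNReal.ofReal δ := by
      rw [edist_comm]
      refine lt_of_le_of_lt hy ?_
      rw [ENNReal.coe_add]
      refine ENNReal.add_lt_add_left ENNReal.coe_ne_top ?_
      exact (ENNReal.ofReal_lt_ofReal_iff hδ).2 (half_lt_self hδ)
    obtain ⟨z, hz1, hz2⟩ := exists_edist_le_of_edist_lt I ENNReal.coe_ne_top hy'
    refine Metric.mem_cthickening_iff.2 ((Metric.infEDist_le_edist_of_mem (y := z) ?_).trans ?_)
    · rwa [Metric.mem_closedEBall']
    · rwa [edist_comm]
  have h2 := le_csSup hbdd h1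
  have h3 : 0 < (δ / 2).toNNReal := Real.toNNReal_pos.2 (half_pos hδ)
  exact absurd h2 (not_le.2 (lt_add_of_pos_right R h3))

/-- A complete Riemannian manifold has compactly supported cutoff functions with arbitrarily small
Lipschitz constants. The manifold may have infinitely many components, at infinite distance from
each other; therefore the `k`-th cutoff is a function of the distance to the first `k + 1` points of
a dense sequence, instead of one base point. -/
theorem exists_cutoff [FiniteDimensional ℝ E] [CompleteSpace M] (I : ModelWithCorners ℝ E H)
    [IsManifold I ∞ M]
    [RiemannianBundle (fun x : M => TangentSpace I x)]
    [IsContMDiffRiemannianBundle I ∞ E (fun x : M => TangentSpace I x)]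
    [IsRiemannianManifold I M]
    [TopologicalSpace.SeparableSpace M] [Nonempty M] :
    ∃ χ : ℕ → M → ℝ, (∀ k x, 0 ≤ χ k x) ∧ (∀ k x, χ k x ≤ 1) ∧ (∀ k, HasCompactSupport (χ k)) ∧
      (∀ k : ℕ, LipschitzWith ((k : ℝ≥0) + 1)⁻¹ (χ k)) ∧
      ∀ x, Tendsto (fun k => χ k x) atTop (𝓝 1) := by
  let S : ℕ → Set M := fun k => (fun i => TopologicalSpace.denseSeq M i) '' Set.Iic k
  -- the truncation makes the extended distance finite; the cutoff is `1 - g k / (k + 1)`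
  let g : ℕ → M → ℝ := fun k x => (min (Metric.infEDist x (S k)) (k + 1)).toReal
  have hfin : ∀ (k : ℕ) x, min (Metric.infEDist x (S k)) (k + 1) ≠ ⊤ := fun k x =>
    ne_top_of_le_ne_top (by finiteness) (min_le_right _ _)
  have hg : ∀ k, LipschitzWith 1 (g k) := fun k => by
    have key : ∀ x y, edist x y ≠ ⊤ → g k x ≤ g k y + (edist x y).toReal := fun x y hxy => by
      rw [← ENNReal.toReal_add (hfin k y) hxy]
      refine ENNReal.toReal_mono (by finiteness [hfin k y]) ?_
      rw [min_add]
      exact min_le_min Metric.infEDist_le_infEDist_add_edist le_self_add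
    refine LipschitzWith.of_edist_le fun x y => ?_
    rcases eq_or_ne (edist x y) ⊤ with h | h
    · simp [h]
    · rw [edist_dist, Real.dist_eq]
      refine ENNReal.ofReal_le_of_le_toReal (abs_le.2 ⟨?_, ?_⟩)
      · have := key y x (by rwa [edist_comm])
        rw [edist_comm] at this
        linarith
      · linarith [key x y h]
  have hg0 : ∀ k x, 0 ≤ g k x := fun k x => ENNReal.toReal_nonneg
  have hg1 : ∀ (k : ℕ) x, g k x ≤ k + 1 := fun k x =>
    ENNReal.toReal_le_of_le_ofReal (by positivity) ((min_le_right _ _).trans (by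
      rw [ENNReal.ofReal_add (by positivity) (by positivity)]; simp))
  refine ⟨fun k x => 1 - ((k : ℝ) + 1)⁻¹ * g k x, fun k x => ?_, fun k x => ?_, fun k => ?_,
    fun k => ?_, fun x => ?_⟩
  · have : (0 : ℝ) < k + 1 := by positivity
    rw [sub_nonneg, inv_mul_le_iff₀ this]
    simpa using hg1 k x
  · have := hg0 k x
    simp only [sub_le_self_iff]
    positivity
  · have hc : IsCompact (⋃ i ∈ Set.Iic k, Metric.closedEBall (TopologicalSpace.denseSeq M i)
        ((k + 1 : ℝ≥0) : ℝ≥0∞)) :=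
      (Set.finite_Iic k).isCompact_biUnion fun i _ => isCompact_closedEBall I _ _
    refine HasCompactSupport.intro hc fun x hx => ?_
    have h1 : (k + 1 : ℝ≥0∞) ≤ Metric.infEDist x (S k) := by
      rw [Metric.le_infEDist]
      rintro y ⟨i, hi, rfl⟩
      by_contra! h
      refine hx (Set.mem_biUnion hi ?_)
      rw [Metric.mem_closedEBall]
      exact_mod_cast h.le
    have h2 : g k x = k + 1 := by
      simp only [g, min_eq_right h1]
      rw [ENNReal.toReal_add (by finiteness) (by finiteness)]; simp
    have : (k : ℝ) + 1 ≠ 0 := by positivity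
    simp only [h2]
    field_simp
    simp
  · have h1 : LipschitzWith (((k : ℝ≥0) + 1)⁻¹ * 1) (((((k : ℝ) + 1)⁻¹ : ℝ) • ·) ∘ g k) := by
      refine LipschitzWith.comp ?_ (hg k)
      have h2 : ‖((k : ℝ) + 1)⁻¹‖₊ = ((k : ℝ≥0) + 1)⁻¹ := by
        ext
        simp [abs_of_nonneg (show (0 : ℝ) ≤ k + 1 by positivity)]
      rw [← h2]
      exact lipschitzWith_smul _
    simpa using (LipschitzWith.const (1 : ℝ)).sub h1
  · obtain ⟨n, hn⟩ : ∃ n, edist x (TopologicalSpace.denseSeq M n) < 1 := by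
      obtain ⟨n, hn⟩ := (TopologicalSpace.denseRange_denseSeq M).exists_mem_open
        (Metric.isOpen_eball (x := x) (ε := 1)) ⟨x, by simp⟩
      exact ⟨n, by rwa [edist_comm]⟩
    have h1 : Tendsto (fun k : ℕ => 1 - ((k : ℝ) + 1)⁻¹) atTop (𝓝 1) := by
      simpa using (tendsto_inv_atTop_zero.comp
        (tendsto_natCast_atTop_atTop.atTop_add (tendsto_const_nhds (x := (1 : ℝ))))).const_sub 1
    refine tendsto_of_tendsto_of_tendsto_of_le_of_le' h1 tendsto_const_nhds ?_ ?_
    · filter_upwards [eventually_ge_atTop n] with k hk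
      have h2 : g k x ≤ 1 := by
        refine ENNReal.toReal_le_of_le_ofReal zero_le_one ((min_le_left _ _).trans ?_)
        have h3 : TopologicalSpace.denseSeq M n ∈ S k := Set.mem_image_of_mem _ hk
        simpa using (Metric.infEDist_le_edist_of_mem h3).trans hn.le
      have : (0 : ℝ) < ((k : ℝ) + 1)⁻¹ := by positivity
      nlinarith
    · filter_upwards with k
      have := hg0 k x
      simp only [sub_le_self_iff]
      positivity

end HopfRinow

section Complete

variable {M : Type*} [EMetricSpace M] [ChartedSpace (EuclideanSpace ℝ (Fin 3)) M]
  [IsManifold (𝓡 3) ∞ M] [RiemannianBundle (fun x : M => TangentSpace (𝓡 3) x)]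
  [IsContMDiffRiemannianBundle (𝓡 3) ∞ (EuclideanSpace ℝ (Fin 3))
    (fun x : M => TangentSpace (𝓡 3) x)] [IsRiemannianManifold (𝓡 3) M]
  {o : ∀ x : M, Orientation ℝ (TangentSpace (𝓡 3) x) (Fin 3)}
  {V X Y Z W : Π x : M, TangentSpace (𝓡 3) x} {x x₀ : M}

local notation "∇ᴸ" => leviCivita (𝓡 3) M

/-! ### Lipschitz functions in charts -/

/-- The Riemannian distance is bounded by the length of the image of a coordinate segment. -/
theorem edist_chart_symm_le {y w : E₃} {c : ENNReal}
    (h : ∀ s ∈ Set.Icc (0 : ℝ) 1, y + s • w ∈ (chartAt E₃ x₀).target)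
    (hc : ∀ s ∈ Set.Icc (0 : ℝ) 1,
      ‖mfderiv (𝓡 3) (𝓡 3) (chartAt E₃ x₀).symm (y + s • w) w‖ₑ ≤ c) :
    edist ((chartAt E₃ x₀).symm y) ((chartAt E₃ x₀).symm (y + w)) ≤ c := by
  set γ : ℝ → M := fun s => (chartAt E₃ x₀).symm (y + s • w)
  have hl : ∀ s, HasFDerivAt (fun s : ℝ => y + s • w)
      ((ContinuousLinearMap.id ℝ ℝ).smulRight w) s := fun s =>
    ((hasFDerivAt_id s).smul_const w).const_add y
  have hγ : ContMDiffOn 𝓘(ℝ, ℝ) (𝓡 3) 1 γ (Set.Icc 0 1) := by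
    refine ((contMDiffOn_chart_symm (n := ∞) (x := x₀)).of_le (mod_cast le_top)).comp
      (t := (chartAt E₃ x₀).target) ?_ h
    exact ContDiffOn.contMDiffOn (by fun_prop)
  have hder : ∀ s ∈ Set.Icc (0 : ℝ) 1, mfderiv 𝓘(ℝ, ℝ) (𝓡 3) γ s (1 : ℝ) =
      mfderiv (𝓡 3) (𝓡 3) (chartAt E₃ x₀).symm (y + s • w) w := fun s hs => by
    have h1 := mfderiv_comp (I := 𝓘(ℝ, ℝ)) (I' := 𝓡 3) (I'' := 𝓡 3) s
      (g := (chartAt E₃ x₀).symm) (f := fun s : ℝ => y + s • w)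
      ((mdifferentiable_chart (I := 𝓡 3) x₀).mdifferentiableAt_symm (h s hs))
      (hl s).differentiableAt.mdifferentiableAt
    refine (congrArg (fun A => A (1 : ℝ)) h1).trans ?_
    rw [mfderiv_eq_fderiv, (hl s).fderiv]
    exact congrArg (mfderiv (𝓡 3) (𝓡 3) (chartAt E₃ x₀).symm (y + s • w)) (one_smul ℝ w)
  rw [IsRiemannianManifold.out (I := 𝓡 3)]
  refine (Manifold.riemannianEDist_le_pathELength hγ (by simp [γ]) (by simp [γ]) zero_le_one).trans ?_
  rw [Manifold.pathELength_eq_lintegral_mfderiv_Icc]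
  calc _ ≤ ∫⁻ s in Set.Icc (0 : ℝ) 1, c := by
        refine setLIntegral_mono measurable_const fun s hs => ?_
        exact (congrArg (fun v : TangentSpace (𝓡 3) (γ s) => ‖v‖ₑ) (hder s hs)).le.trans (hc s hs)
    _ = c := by simp

/-- The derivative of a Lipschitz function, read in a chart, is bounded by the Riemannian norm. -/
theorem abs_fderiv_le {χ : M → ℝ} {L : NNReal} (hχ : LipschitzWith L χ) {g : E₃ → ℝ} {y : E₃}
    (hy : y ∈ (chartAt E₃ x₀).target) (hg : DifferentiableAt ℝ g y)
    (hgχ : g =ᶠ[𝓝 y] fun z => χ ((chartAt E₃ x₀).symm z)) (w : E₃) :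
    |fderiv ℝ g y w| ≤ L * ‖mfderiv (𝓡 3) (𝓡 3) (chartAt E₃ x₀).symm y w‖ := by
  set n : E₃ → ℝ := fun z => ‖mfderiv (𝓡 3) (𝓡 3) (chartAt E₃ x₀).symm z w‖
  -- near `y` the Riemannian norm of `w` exceeds its value at `y` by at most `δ`, which is
  -- chosen according to `ε`
  refine le_of_forall_pos_le_add fun ε hε => ?_
  have hcont : Tendsto n (𝓝 y) (𝓝 (n y)) := continuousAt_norm_mfderiv_chart_symm hy w
  obtain ⟨δ, hδ, hδn⟩ : ∃ δ > 0, (L : ℝ) * (n y + δ) ≤ L * n y + ε := by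
    refine ⟨ε / (L + 1), by positivity, ?_⟩
    have : (L : ℝ) * (ε / (L + 1)) ≤ ε := by
      rw [mul_div_assoc', div_le_iff₀ (by positivity)]
      nlinarith [L.coe_nonneg]
    linarith
  have hev : ∀ᶠ z in 𝓝 y, z ∈ (chartAt E₃ x₀).target ∧ n z < n y + δ ∧
      g z = χ ((chartAt E₃ x₀).symm z) :=
    Filter.Eventually.and ((chartAt E₃ x₀).open_target.mem_nhds hy)
      ((hcont.eventually_lt_const (by linarith)).and hgχ)
  obtain ⟨r, hr, hball⟩ := Metric.eventually_nhds_iff_ball.1 hev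
  have hslope := (hg.hasFDerivAt.hasLineDerivAt w).tendsto_slope_zero_right
  refine le_of_tendsto (hslope.abs) ?_
  have hsmall : ∀ᶠ s : ℝ in 𝓝[>] 0, y + s • w ∈ Metric.ball y r := by
    have hc : ContinuousAt (fun s : ℝ => y + s • w) 0 := by fun_prop
    exact nhdsWithin_le_nhds (hc (by simpa using Metric.ball_mem_nhds y hr))
  filter_upwards [hsmall, self_mem_nhdsWithin] with s hs hs0
  have hs0 : 0 < s := hs0
  have hseg : ∀ a ∈ Set.Icc (0 : ℝ) 1, y + a • s • w ∈ Metric.ball y r := fun a ha =>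
    (convex_ball y r).add_smul_mem (Metric.mem_ball_self hr) hs ha
  have hd := edist_chart_symm_le (x₀ := x₀) (c := ENNReal.ofReal (s * (n y + δ)))
    (fun a ha => (hball _ (hseg a ha)).1) fun a ha => by
      rw [← ofReal_norm]
      refine ENNReal.ofReal_le_ofReal ?_
      have h1 : mfderiv (𝓡 3) (𝓡 3) (chartAt E₃ x₀).symm (y + a • s • w) (s • w) =
        s • mfderiv (𝓡 3) (𝓡 3) (chartAt E₃ x₀).symm (y + a • s • w) w := map_smul _ _ _
      rw [h1, norm_smul, Real.norm_of_nonneg hs0.le]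
      exact mul_le_mul_of_nonneg_left (hball _ (hseg a ha)).2.1.le hs0.le
  have h2 := (hχ _ _).trans (mul_le_mul_right hd (L : ENNReal))
  rw [edist_dist, ← ENNReal.ofReal_coe_nnreal, ← ENNReal.ofReal_mul L.coe_nonneg,
    ENNReal.ofReal_le_ofReal_iff (mul_nonneg L.coe_nonneg (mul_nonneg hs0.le
      (add_nonneg (norm_nonneg _) hδ.le))),
    dist_comm, Real.dist_eq, ← (hball _ hs).2.2, ← (hball _ (Metric.mem_ball_self hr)).2.2] at h2
  rw [smul_eq_mul, abs_mul, abs_of_pos (inv_pos.2 hs0), inv_mul_le_iff₀ hs0]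
  calc _ ≤ _ := h2
    _ = s * (L * (n y + δ)) := by ring
    _ ≤ _ := mul_le_mul_of_nonneg_left hδn hs0.le

/-! ### The divergence theorem for integrable fields -/

/-- Integration by parts of a Lipschitz function against a compactly supported field on the
coordinate space. By Rademacher's theorem a bound at points of differentiability suffices. -/
theorem abs_integral_mul_sum_fderiv_le {g : E₃ → ℝ} {C : NNReal} (hg : LipschitzWith C g)
    {W : Fin 3 → E₃ → ℝ} (hW : ∀ j, ContDiff ℝ ∞ (W j)) (hWc : ∀ j, HasCompactSupport (W j))
    {B : E₃ → ℝ} (hB : Integrable B)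
    (h : ∀ y, DifferentiableAt ℝ g y →
      |∑ j, W j y * fderiv ℝ g y (EuclideanSpace.single j 1)| ≤ B y) :
    |∫ y, g y * ∑ j, fderiv ℝ (W j) y (EuclideanSpace.single j 1)| ≤ ∫ y, B y := by
  have hWd : ∀ j, Differentiable ℝ (W j) := fun j => (hW j).differentiable (by simp)
  have h1 : ∀ j, ∫ y, g y * fderiv ℝ (W j) y (EuclideanSpace.single j 1) =
      -∫ y, lineDeriv ℝ g y (EuclideanSpace.single j 1) * W j y := fun j => by
    obtain ⟨D, hD⟩ := (hW j).lipschitzWith_of_hasCompactSupport (hWc j) (by simp)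
    rw [hg.integral_lineDeriv_mul_eq hD (hWc j), ← integral_neg]
    refine integral_congr_ae (Eventually.of_forall fun y => ?_)
    simp only [(hWd j y).lineDeriv_eq_fderiv]
    simp [mul_comm]
  have h2 : ∀ j, Integrable fun y => g y * fderiv ℝ (W j) y (EuclideanSpace.single j 1) := fun j =>
    Continuous.integrable_of_hasCompactSupport
      (hg.continuous.mul (((hW j).continuous_fderiv (by simp)).clm_apply continuous_const))
      (((hWc j).fderiv_apply ℝ _).mul_left)
  have h3 : ∀ j, Integrable fun y => lineDeriv ℝ g y (EuclideanSpace.single j 1) * W j y := fun j => by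
    have := (hg.locallyIntegrable_lineDeriv (μ := volume)
      (EuclideanSpace.single j 1)).integrable_smul_left_of_hasCompactSupport (hW j).continuous (hWc j)
    simpa [mul_comm] using this
  simp only [Finset.mul_sum]
  rw [integral_finsetSum _ fun j _ => h2 j]
  simp only [h1]
  rw [Finset.sum_neg_distrib, abs_neg, ← integral_finsetSum _ fun j _ => h3 j]
  refine (abs_integral_le_integral_abs).trans (integral_mono_ae
    (integrable_finsetSum _ fun j _ => h3 j).abs hB ?_)
  filter_upwards [hg.ae_differentiableAt] with y hy
  refine le_of_eq_of_le ?_ (h y hy)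
  congr 1
  refine Finset.sum_congr rfl fun j _ => ?_
  rw [hy.lineDeriv_eq_fderiv, mul_comm]

/-- Around each point the inverse of the chart is Lipschitz on a ball. -/
theorem exists_ball_lipschitzOnWith (x₀ : M) : ∃ r > 0, ∃ C : NNReal,
    Metric.closedBall (chartAt E₃ x₀ x₀) r ⊆ (chartAt E₃ x₀).target ∧
    LipschitzOnWith C (chartAt E₃ x₀).symm (Metric.ball (chartAt E₃ x₀ x₀) r) := by
  have hx := mem_chart_target E₃ x₀
  have hs := mem_chart_source E₃ x₀
  set n : E₃ → ℝ := fun z => ∑ j, ‖coordField x₀ j ((chartAt E₃ x₀).symm z)‖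
  have hn : ContinuousAt n (chartAt E₃ x₀ x₀) := by
    refine tendsto_finsetSum _ fun j _ => ?_
    have h1 := smoothAt_coordField hs j
    have h2 : ContinuousAt (fun y => ‖coordField x₀ j y‖) x₀ := by
      simp only [norm_eq_sqrt_real_inner]
      exact (smoothAt_inner h1 h1).continuousAt.sqrt
    have h3 := (chartAt E₃ x₀).symm.continuousAt hx
    exact ContinuousAt.comp_of_eq (g := fun y => ‖coordField x₀ j y‖) h2 h3
      ((chartAt E₃ x₀).left_inv hs)
  obtain ⟨S, hS⟩ : ∃ S : NNReal, n (chartAt E₃ x₀ x₀) < S :=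
    ⟨⟨n (chartAt E₃ x₀ x₀) + 1, by positivity⟩, lt_add_one _⟩
  have hev : ∀ᶠ z in 𝓝 (chartAt E₃ x₀ x₀), z ∈ (chartAt E₃ x₀).target ∧ n z < S :=
    Filter.Eventually.and ((chartAt E₃ x₀).open_target.mem_nhds hx) (hn.eventually_lt_const hS)
  obtain ⟨r, hr, hball⟩ := Metric.nhds_basis_closedBall.eventually_iff.1 hev
  refine ⟨r, hr, S, fun z hz => (hball hz).1, fun y hy z hz => ?_⟩
  have hseg : ∀ a ∈ Set.Icc (0 : ℝ) 1, y + a • (z - y) ∈ Metric.closedBall (chartAt E₃ x₀ x₀) r :=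
    fun a ha => Metric.ball_subset_closedBall
      ((convex_ball _ r).add_smul_sub_mem hy hz ha)
  have h := edist_chart_symm_le (x₀ := x₀) (y := y) (w := z - y) (c := ENNReal.ofReal (S * ‖z - y‖))
    (fun a ha => (hball (hseg a ha)).1) fun a ha => by
      rw [← ofReal_norm]
      refine ENNReal.ofReal_le_ofReal ?_
      rw [mfderiv_chart_symm_apply (hball (hseg a ha)).1]
      refine (norm_sum_le _ _).trans ?_
      calc _ ≤ ∑ j, ‖z - y‖ * ‖coordField x₀ j ((chartAt E₃ x₀).symm (y + a • (z - y)))‖ := by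
            refine Finset.sum_le_sum fun j _ => ?_
            rw [norm_smul]
            exact mul_le_mul_of_nonneg_right (PiLp.norm_apply_le (z - y) j) (norm_nonneg _)
        _ = ‖z - y‖ * n (y + a • (z - y)) := by rw [Finset.mul_sum]
        _ ≤ ‖z - y‖ * S := mul_le_mul_of_nonneg_left (hball (hseg a ha)).2.le (norm_nonneg _)
        _ = _ := mul_comm _ _
  rw [add_sub_cancel] at h
  refine h.trans_eq ?_
  rw [ENNReal.ofReal_mul S.coe_nonneg, ENNReal.ofReal_coe_nnreal, edist_comm, edist_dist,
    dist_eq_norm]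

variable [MeasurableSpace M] [BorelSpace M]

/-- A weak form of `∫ χ div V = - ∫ dχ(V)` for a Lipschitz function `χ` and a field supported in a
small domain. -/
theorem exists_nhds_abs_integral_mul_divergence_le (ho : IsOrientation o) (x₀ : M) :
    ∃ U : Set M, IsOpen U ∧ x₀ ∈ U ∧ ∀ V : Π x : M, TangentSpace (𝓡 3) x, (∀ y, SmoothVF V y) →
      ∀ A ⊆ U, IsClosed A → (∀ x ∉ A, V x = 0) → ∀ (χ : M → ℝ) (L : NNReal), LipschitzWith L χ →
        |∫ x, χ x * divergence V x ∂(riemannianVolume 3 M)| ≤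
          L * ∫ x, ‖V x‖ ∂(riemannianVolume 3 M) := by
  obtain ⟨r, hr, C, hrt, hC⟩ := exists_ball_lipschitzOnWith x₀
  set φ := chartAt E₃ x₀
  refine ⟨φ.source ∩ φ ⁻¹' Metric.ball (φ x₀) r, φ.isOpen_inter_preimage Metric.isOpen_ball,
    ⟨mem_chart_source E₃ x₀, Metric.mem_ball_self hr⟩, fun V hV A hA hAc hVA χ L hχ => ?_⟩
  set D : E₃ → ℝ := fun y => coordVolume o x₀ (φ.symm y)
  set K : Set E₃ := Metric.closedBall (φ x₀) r ∩ φ.symm ⁻¹' A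
  have hKb : K ⊆ Metric.ball (φ x₀) r := fun y hy => by
    have := (hA hy.2).2
    rwa [Set.mem_preimage, φ.right_inv (hrt hy.1)] at this
  have hKc : IsClosed K := (φ.continuousOn_symm.mono hrt).preimage_isClosed_of_isClosed
    Metric.isClosed_closedBall hAc
  have hK : IsCompact K := (isCompact_closedBall _ _).of_isClosed_subset hKc Set.inter_subset_left
  have hKt : K ⊆ φ.target := Set.inter_subset_left.trans hrt
  have hV0 : ∀ y ∈ φ.target, y ∉ K → V (φ.symm y) = 0 := fun y hy hyK => by
    refine hVA _ fun h => hyK ⟨?_, h⟩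
    have := (hA h).2
    rw [Set.mem_preimage, φ.right_inv hy] at this
    exact Metric.ball_subset_closedBall this
  -- the components of the density `|D| V` in the chart
  set W : Fin 3 → E₃ → ℝ := fun j =>
    φ.target.indicator fun y => |D y| * coordComp x₀ j V (φ.symm y)
  have hW0 : ∀ j, ∀ y ∉ K, W j y = 0 := fun j y hy => by
    by_cases hyt : y ∈ φ.target
    · simp only [W, Set.indicator_of_mem hyt, coordComp, hV0 y hyt hy]
      simp
    · exact Set.indicator_of_notMem hyt _
  have hW0' : ∀ j, ∀ y ∉ K, W j =ᶠ[𝓝 y] fun _ => 0 := fun j y hy => by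
    filter_upwards [hKc.isOpen_compl.mem_nhds hy] with z hz using hW0 j z hz
  have hψ : ∀ y ∈ φ.target, ContMDiffAt (𝓡 3) (𝓡 3) ∞ φ.symm y := fun y hy =>
    (contMDiffOn_chart_symm (n := ∞) (x := x₀)).contMDiffAt (φ.open_target.mem_nhds hy)
  have hDs : ∀ y ∈ φ.target, SmoothFn (fun x => coordVolume o x₀ x) (φ.symm y) := fun y hy =>
    smoothAt_coordVolume ho (φ.map_target hy)
  have hcs : ∀ j, ∀ y ∈ φ.target, SmoothFn (coordComp x₀ j V) (φ.symm y) := fun j y hy =>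
    smoothAt_coordComp (φ.map_target hy) (hV _) j
  have hDc : ∀ y ∈ φ.target, ContDiffAt ℝ ∞ D y := fun y hy =>
    contMDiffAt_iff_contDiffAt.1 (ContMDiffAt.comp y (hDs y hy) (hψ y hy))
  have hD0 : ∀ y ∈ φ.target, D y ≠ 0 := fun y hy => coordVolume_ne_zero o (φ.map_target hy)
  have hWeq : ∀ j, ∀ y ∈ φ.target, W j =ᶠ[𝓝 y] fun z => |D z| * coordComp x₀ j V (φ.symm z) :=
    fun j y hy => by
      filter_upwards [φ.open_target.mem_nhds hy] with z hz using Set.indicator_of_mem hz _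
  have hWs : ∀ j, ContDiff ℝ ∞ (W j) := fun j => contDiff_iff_contDiffAt.2 fun y => by
    by_cases hy : y ∈ φ.target
    · refine ContDiffAt.congr_of_eventuallyEq ?_ (hWeq j y hy)
      exact ((hDc y hy).abs (hD0 y hy)).mul
        (contMDiffAt_iff_contDiffAt.1 (ContMDiffAt.comp y (hcs j y hy) (hψ y hy)))
    · exact contDiffAt_const.congr_of_eventuallyEq (hW0' j y fun h => hy (hKt h))
  have hWc : ∀ j, HasCompactSupport (W j) := fun j => HasCompactSupport.intro hK (hW0 j)
  have hdivW : ∀ y ∈ φ.target, ∑ j, fderiv ℝ (W j) y (EuclideanSpace.single j 1) =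
      |D y| * divergence V (φ.symm y) := fun y hy => by
    have hs := φ.map_target hy
    -- the sign of the continuous function `D` is locally constant
    obtain ⟨σ, hσ⟩ : ∃ σ : ℝ, ∀ᶠ z in 𝓝 y, |D z| = σ * D z := by
      rcases (hD0 y hy).lt_or_gt with h | h
      · refine ⟨-1, ?_⟩
        filter_upwards [(hDc y hy).continuousAt.eventually_lt_const h] with z hz
        rw [abs_of_neg hz, neg_one_mul]
      · refine ⟨1, ?_⟩
        filter_upwards [(hDc y hy).continuousAt.eventually_const_lt h] with z hz
        rw [abs_of_pos hz, one_mul]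
    have hf : ∀ j, DiffFn (fun x => coordVolume o x₀ x * coordComp x₀ j V x) (φ.symm y) := fun j =>
      ((hDs y hy).mul (hcs j y hy)).mdifferentiableAt (by simp)
    have hWσ : ∀ j, W j =ᶠ[𝓝 y] fun z => σ * (D z * coordComp x₀ j V (φ.symm z)) := fun j => by
      filter_upwards [hWeq j y hy, hσ] with z hz hzσ
      rw [hz, hzσ, mul_assoc]
    have hdiff : ∀ j, DifferentiableAt ℝ (fun z => D z * coordComp x₀ j V (φ.symm z)) y := fun j =>
      mdifferentiableAt_iff_differentiableAt.1 (MDifferentiableAt.comp y (hf j)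
        ((hψ y hy).mdifferentiableAt (by simp)))
    rw [hσ.self_of_nhds, mul_assoc, coordVolume_mul_divergence ho hs (hV _), Finset.mul_sum]
    refine Finset.sum_congr rfl fun j _ => ?_
    rw [(hWσ j).fderiv_eq, fderiv_const_mul (hdiff j), ← fderiv_comp_chart_symm hy (hf j)]
    rfl
  have hdivW0 : ∀ y ∉ K, ∑ j, fderiv ℝ (W j) y (EuclideanSpace.single j 1) = 0 := fun y hy => by
    refine Finset.sum_eq_zero fun j _ => ?_
    rw [(hW0' j y hy).fderiv_eq]
    simp
  -- `χ` in the chart agrees near `K` with a function which is Lipschitz on the whole space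
  obtain ⟨g, hg, hgχ⟩ := (hχ.comp_lipschitzOnWith hC).extend_real
  set B : E₃ → ℝ := φ.target.indicator fun y => |D y| * ‖V (φ.symm y)‖
  have hB0 : ∀ y ∉ K, B y = 0 := fun y hy => by
    by_cases hyt : y ∈ φ.target
    · simp only [B, Set.indicator_of_mem hyt, hV0 y hyt hy]
      simp
    · exact Set.indicator_of_notMem hyt _
  have hBi : Integrable B := by
    refine IntegrableOn.integrable_of_forall_notMem_eq_zero (s := K) ?_ hB0
    refine ContinuousOn.integrableOn_compact hK ?_
    have : ContinuousOn (fun y => |D y| * ‖V (φ.symm y)‖) K :=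
      ((continuousOn_coordVolume ho x₀).mono hKt).mul
        ((continuous_norm_section hV).comp_continuousOn (φ.continuousOn_symm.mono hKt))
    exact this.congr fun y hy => Set.indicator_of_mem (hKt hy) _
  have hmain := abs_integral_mul_sum_fderiv_le hg hWs hWc (hBi.const_mul (L : ℝ)) fun y hgy => by
    by_cases hy : y ∈ K
    · have hyt := hKt hy
      have hgχ' : g =ᶠ[𝓝 y] fun z => χ (φ.symm z) := by
        filter_upwards [Metric.isOpen_ball.mem_nhds (hKb hy)] with z hz using (hgχ hz).symm
      -- the field at `y`, read in the chart
      set w : E₃ := WithLp.toLp 2 fun j => coordComp x₀ j V (φ.symm y)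
      have hw : w = ∑ j, w j • (EuclideanSpace.single j (1 : ℝ) : E₃) := by
        refine PiLp.ext fun i => ?_
        simp [Pi.single_apply]
      have h1 := abs_fderiv_le hχ hyt hgy hgχ' w
      rw [mfderiv_chart_symm_apply hyt, ← eq_sum_coordField (X := V) (φ.map_target hyt)] at h1
      have h2 : ∑ j, W j y * fderiv ℝ g y (EuclideanSpace.single j 1) = |D y| * fderiv ℝ g y w := by
        conv_rhs => rw [hw]
        rw [map_sum, Finset.mul_sum]
        refine Finset.sum_congr rfl fun j _ => ?_
        rw [(hWeq j y hyt).self_of_nhds, map_smul, smul_eq_mul, mul_assoc]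
      rw [h2, abs_mul, abs_abs]
      simp only [B, Set.indicator_of_mem hyt]
      calc _ ≤ |D y| * (L * ‖V (φ.symm y)‖) := mul_le_mul_of_nonneg_left h1 (abs_nonneg _)
        _ = _ := by ring
    · rw [hB0 y hy]
      simp [hW0 _ y hy]
  rw [integral_const_mul] at hmain
  have hV0' : ∀ x ∉ φ.source, V x = 0 := fun x hx => hVA x fun h => hx (hA h).1
  have hdiv0 : ∀ x ∉ φ.source, χ x * divergence V x = 0 := fun x hx => by
    rw [divergence_eq_zero_of_eventuallyEq (mdiffAt_of_smoothAt (hV x)), mul_zero]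
    filter_upwards [hAc.isOpen_compl.mem_nhds fun h => hx (hA h).1] with z hz using hVA z hz
  rw [integral_riemannianVolume (x₀ := x₀) (f := fun x => χ x * divergence V x) ho
      (hχ.continuous.mul (continuous_divergence hV)).measurable hdiv0,
    integral_riemannianVolume (x₀ := x₀) ho (continuous_norm_section hV).measurable
      fun x hx => by rw [hV0' x hx, norm_zero],
    ← integral_indicator φ.open_target.measurableSet, ← integral_indicator φ.open_target.measurableSet]
  refine le_of_eq_of_le ?_ hmain
  congr 2
  funext y
  by_cases hyt : y ∈ φ.target
  · rw [Set.indicator_of_mem hyt]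
    by_cases hy : y ∈ K
    · rw [hdivW y hyt, ← hgχ (hKb hy), Function.comp_apply]
      ring
    · have h := hdivW y hyt
      rw [hdivW0 y hy] at h ⊢
      rw [mul_zero, mul_left_comm, ← h, mul_zero]
  · rw [Set.indicator_of_notMem hyt, hdivW0 y fun h => hyt (hKt h), mul_zero]

/-- A weak form of `∫ χ div V = - ∫ dχ(V)` for a compactly supported Lipschitz function `χ`. The
field is split by a partition of unity `ρ`; as `∑ ρ i = 1` near the support of `χ`, the terms `dρ i
(V)` cancel. -/
theorem abs_integral_mul_divergence_le [SecondCountableTopology M] (ho : IsOrientation o)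
    (hV : ∀ y, SmoothVF V y)
    (hVi : Integrable (fun x => ‖V x‖) (riemannianVolume 3 M)) {χ : M → ℝ} {L : NNReal}
    (hχ : LipschitzWith L χ) (hχc : HasCompactSupport χ) :
    |∫ x, χ x * divergence V x ∂(riemannianVolume 3 M)| ≤
      L * ∫ x, ‖V x‖ ∂(riemannianVolume 3 M) := by
  haveI := ChartedSpace.locallyCompactSpace E₃ M
  haveI := isLocallyFiniteMeasure_riemannianVolume ho
  choose U hUo hxU hU using fun x₀ : M => exists_nhds_abs_integral_mul_divergence_le ho x₀
  obtain ⟨K, hK, hχK⟩ := exists_compact_superset (show IsCompact (tsupport χ) from hχc)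
  obtain ⟨t, ht⟩ := hK.elim_finite_subcover U hUo fun x _ => Set.mem_iUnion.2 ⟨x, hxU x⟩
  obtain ⟨ρ, hρ⟩ := SmoothPartitionOfUnity.exists_isSubordinate (𝓡 3) hK.isClosed
    (fun i : t => U i) (fun i => hUo i) fun x hx => by
      obtain ⟨i, hi⟩ := Set.mem_iUnion.1 (ht hx)
      obtain ⟨hit, hxi⟩ := Set.mem_iUnion.1 hi
      exact Set.mem_iUnion.2 ⟨⟨i, hit⟩, hxi⟩
  have hρs : ∀ i x, SmoothFn (ρ i) x := fun i x => (ρ i).contMDiff.contMDiffAt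
  have hρd : ∀ i x, DiffFn (ρ i) x := fun i x => (hρs i x).mdifferentiableAt (by simp)
  set Vi : t → Π x : M, TangentSpace (𝓡 3) x := fun i => (ρ i : M → ℝ) • V
  have hVi_s : ∀ i x, SmoothVF (Vi i) x := fun i x => (hρs i x).smul_section (hV x)
  have hVi_n : ∀ i x, ‖Vi i x‖ = ρ i x * ‖V x‖ := fun i x => by
    simp only [Vi, Pi.smul_apply', norm_smul, Real.norm_of_nonneg (ρ.nonneg i x)]
  have hbound : ∀ i, |∫ x, χ x * divergence (Vi i) x ∂(riemannianVolume 3 M)| ≤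
      L * ∫ x, ‖Vi i x‖ ∂(riemannianVolume 3 M) := fun i =>
    hU i (Vi i) (hVi_s i) _ (hρ i) (isClosed_tsupport _) (fun x hx => by
      simp only [Vi, Pi.smul_apply', image_eq_zero_of_notMem_tsupport hx, zero_smul]) χ L hχ
  have hint : ∀ i, Integrable (fun x => χ x * divergence (Vi i) x) (riemannianVolume 3 M) := fun i =>
    (hχ.continuous.mul (continuous_divergence (hVi_s i))).integrable_of_hasCompactSupport
      hχc.mul_right
  have hsum : ∀ x, χ x * divergence V x = ∑ i, χ x * divergence (Vi i) x := fun x => by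
    by_cases hx : x ∈ tsupport χ
    · have h1 : (fun y => ∑ i, ρ i y) =ᶠ[𝓝 x] fun _ => 1 := by
        filter_upwards [mem_interior_iff_mem_nhds.1 (hχK hx)] with y hy
        rw [← finsum_eq_sum_of_fintype]
        exact ρ.sum_eq_one hy
      have h2 := mvfderiv_congr (I := 𝓡 3) h1
      rw [mvfderiv_fun_sum _ fun i _ => hρd i x, mvfderiv_const] at h2
      have h3 : ∑ i, d₃ (ρ i) x (V x) = 0 := by
        rw [← sum_apply, h2]; rfl
      have h4 : ∀ i, divergence (Vi i) x = ρ i x * divergence V x + d₃ (ρ i) x (V x) := fun i =>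
        divergence_smul (hρd i x) (mdiffAt_of_smoothAt (hV x))
      simp only [h4]
      rw [← Finset.mul_sum, Finset.sum_add_distrib, h3, ← Finset.sum_mul,
        show ∑ i, ρ i x = 1 from h1.self_of_nhds]
      ring
    · simp [image_eq_zero_of_notMem_tsupport hx]
  have hVi_i : ∀ i, Integrable (fun x => ‖Vi i x‖) (riemannianVolume 3 M) := fun i => by
    refine hVi.mono (continuous_norm_section (hVi_s i)).aestronglyMeasurable
      (Eventually.of_forall fun x => ?_)
    rw [norm_norm, norm_norm, hVi_n]
    exact mul_le_of_le_one_left (norm_nonneg _) (ρ.le_one i x)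
  simp only [hsum]
  rw [integral_finsetSum _ fun i _ => hint i]
  calc _ ≤ ∑ i, |∫ x, χ x * divergence (Vi i) x ∂(riemannianVolume 3 M)| :=
        Finset.abs_sum_le_sum_abs _ _
    _ ≤ ∑ i, L * ∫ x, ‖Vi i x‖ ∂(riemannianVolume 3 M) := Finset.sum_le_sum fun i _ => hbound i
    _ = L * ∫ x, ∑ i, ‖Vi i x‖ ∂(riemannianVolume 3 M) := by
        rw [← Finset.mul_sum, integral_finsetSum _ fun i _ => hVi_i i]
    _ ≤ _ := by
        refine mul_le_mul_of_nonneg_left (integral_mono (integrable_finsetSum _ fun i _ => hVi_i i)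
          hVi fun x => ?_) L.coe_nonneg
        simp only [hVi_n, ← Finset.sum_mul]
        refine mul_le_of_le_one_left (norm_nonneg _) ?_
        rw [← finsum_eq_sum_of_fintype]
        exact ρ.sum_le_one x

/-- Stokes' theorem on a complete manifold for an integrable field whose divergence is bounded below
by an integrable function. -/
theorem integrable_divergence_of_le [SecondCountableTopology M] [CompleteSpace M]
    (ho : IsOrientation o) (hV : ∀ y, SmoothVF V y)
    (hVi : Integrable (fun x => ‖V x‖) (riemannianVolume 3 M)) {h : M → ℝ}
    (hh : Integrable h (riemannianVolume 3 M)) (hdiv : ∀ x, -h x ≤ divergence V x) :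
    Integrable (divergence V) (riemannianVolume 3 M) ∧
      ∫ x, divergence V x ∂(riemannianVolume 3 M) = 0 := by
  cases isEmpty_or_nonempty M
  · rw [Measure.eq_zero_of_isEmpty (riemannianVolume 3 M)]
    simp
  haveI := isLocallyFiniteMeasure_riemannianVolume ho
  set μ := riemannianVolume 3 M
  obtain ⟨χ, hχ0, hχ1, hχc, hχL, hχ⟩ := exists_cutoff (𝓡 3) (M := M)
  have hdc := continuous_divergence hV
  have hbound := fun k => abs_integral_mul_divergence_le ho hV hVi (hχL k) (hχc k)
  have hχm : ∀ k, AEStronglyMeasurable (χ k) μ := fun k => (hχL k).continuous.aestronglyMeasurable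
  have hdct : ∀ f : M → ℝ, Integrable f μ →
      Tendsto (fun k => ∫ x, χ k x * f x ∂μ) atTop (𝓝 (∫ x, f x ∂μ)) := fun f hf => by
    refine tendsto_integral_of_dominated_convergence (fun x => ‖f x‖)
      (fun k => (hχm k).mul hf.aestronglyMeasurable) hf.norm
      (fun k => Eventually.of_forall fun x => ?_)
      (Eventually.of_forall fun x => by simpa using (hχ x).mul_const (f x))
    rw [norm_mul, Real.norm_of_nonneg (hχ0 k x)]
    exact mul_le_of_le_one_left (norm_nonneg _) (hχ1 k x)
  have hlim : Tendsto (fun k => ∫ x, χ k x * divergence V x ∂μ) atTop (𝓝 0) := by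
    refine squeeze_zero_norm hbound ?_
    have h1 : Tendsto (fun k : ℕ => (1 / ((k : ℝ) + 1)) * ∫ x, ‖V x‖ ∂μ) atTop (𝓝 0) := by
      simpa using tendsto_one_div_add_atTop_nhds_zero_nat.mul_const (∫ x, ‖V x‖ ∂μ)
    refine h1.congr fun k => ?_
    push_cast
    rw [one_div]
  have hint : ∀ k, Integrable (fun x => χ k x * divergence V x) μ := fun k =>
    ((hχL k).continuous.mul hdc).integrable_of_hasCompactSupport (hχc k).mul_right
  have hinth : ∀ k, Integrable (fun x => χ k x * h x) μ := fun k => by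
    refine hh.mono ((hχm k).mul hh.aestronglyMeasurable) (Eventually.of_forall fun x => ?_)
    rw [norm_mul, Real.norm_of_nonneg (hχ0 k x)]
    exact mul_le_of_le_one_left (norm_nonneg _) (hχ1 k x)
  have hf0 : ∀ x, 0 ≤ divergence V x + h x := fun x => by linarith [hdiv x]
  have hfm : AEMeasurable (fun x => divergence V x + h x) μ :=
    hdc.aestronglyMeasurable.aemeasurable.add hh.aestronglyMeasurable.aemeasurable
  -- Fatou's lemma bounds the integral of the nonnegative function `div V + h`
  have hfi : Integrable (fun x => divergence V x + h x) μ := by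
    refine (lintegral_ofReal_ne_top_iff_integrable hfm.aestronglyMeasurable
      (Eventually.of_forall hf0)).1 (ne_top_of_le_ne_top (ENNReal.ofReal_ne_top
        (r := ∫ x, h x ∂μ)) ?_)
    have hlim2 : Tendsto (fun k => ENNReal.ofReal (∫ x, χ k x * (divergence V x + h x) ∂μ)) atTop
        (𝓝 (ENNReal.ofReal (∫ x, h x ∂μ))) := by
      refine (ENNReal.continuous_ofReal.tendsto _).comp ?_
      have := hlim.add (hdct h hh)
      rw [zero_add] at this
      refine this.congr fun k => ?_
      rw [← integral_add (hint k) (hinth k)]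
      simp only [mul_add]
    calc ∫⁻ x, ENNReal.ofReal (divergence V x + h x) ∂μ
        = ∫⁻ x, liminf (fun k => ENNReal.ofReal (χ k x * (divergence V x + h x))) atTop ∂μ := by
          refine lintegral_congr fun x => ?_
          refine (Tendsto.liminf_eq ?_).symm
          refine (ENNReal.continuous_ofReal.tendsto _).comp ?_
          simpa using (hχ x).mul_const (divergence V x + h x)
      _ ≤ liminf (fun k => ∫⁻ x, ENNReal.ofReal (χ k x * (divergence V x + h x)) ∂μ) atTop :=
          lintegral_liminf_le' fun k => ((hχm k).aemeasurable.mul hfm).ennreal_ofReal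
      _ = liminf (fun k => ENNReal.ofReal (∫ x, χ k x * (divergence V x + h x) ∂μ)) atTop := by
          congr 1
          funext k
          rw [ofReal_integral_eq_lintegral_ofReal]
          · refine ((hint k).add (hinth k)).congr (Eventually.of_forall fun x => ?_)
            exact (mul_add _ _ _).symm
          · exact Eventually.of_forall fun x => mul_nonneg (hχ0 k x) (hf0 x)
      _ = _ := hlim2.liminf_eq
  have hdi : Integrable (divergence V) μ := by
    refine (hfi.sub hh).congr (Eventually.of_forall fun x => ?_)
    exact add_sub_cancel_right _ _
  exact ⟨hdi, tendsto_nhds_unique (hdct _ hdi) hlim⟩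

/-! ### The integrated enstrophy balance -/

/-- The integrated enstrophy balance: the divergence of the enstrophy flux is integrable and
integrates to zero. -/
theorem enstrophy_balance [SecondCountableTopology M] [CompleteSpace M] (ho : IsOrientation o)
    {κ : ℝ} (hRic : ∀ (x : M) (v : TangentSpace (𝓡 3) x), -κ * ‖v‖ ^ 2 ≤ ⟪ricci ∇ᴸ x v, v⟫)
    {ν : ℝ} (hν : 0 < ν) {u u' : Π x : M, TangentSpace (𝓡 3) x} {p : M → ℝ}
    (hu : ∀ y, SmoothVF u y) (hu' : ∀ y, SmoothVF u' y) (hp : ∀ y, SmoothFn p y)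
    (hdiv : ∀ y, divergence u y = 0)
    (h : ∀ y, u' y + ∇ᴸ u y (u y) + ν • hodgeLaplacian u y = -grad p y)
    (h1 : Integrable (fun x => ‖curl o u x‖ ^ 2) (riemannianVolume 3 M))
    (h2 : Integrable (normSqNabla (curl o u)) (riemannianVolume 3 M))
    (h3 : Integrable (fun x => ‖u x‖ ^ 2 * ‖curl o u x‖ ^ 2) (riemannianVolume 3 M))
    (h4 : Integrable (fun x => √(normSqNabla u x) * ‖curl o u x‖ ^ 2) (riemannianVolume 3 M))
    (h5 : Integrable (fun x => ‖curl o u' x‖ ^ 2) (riemannianVolume 3 M)) :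
    Integrable (fun x => ⟪ricci ∇ᴸ x (curl o u x), curl o u x⟫) (riemannianVolume 3 M) ∧
    Integrable (fun x => ⟪∇ᴸ u x (curl o u x), curl o u x⟫) (riemannianVolume 3 M) ∧
    ∫ x, ⟪curl o u' x, curl o u x⟫ ∂(riemannianVolume 3 M) +
        ν * ∫ x, normSqNabla (curl o u) x ∂(riemannianVolume 3 M) =
      ∫ x, ⟪∇ᴸ u x (curl o u x), curl o u x⟫ ∂(riemannianVolume 3 M) -
        ν * ∫ x, ⟪ricci ∇ᴸ x (curl o u x), curl o u x⟫ ∂(riemannianVolume 3 M) := by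
  set μ := riemannianVolume 3 M
  set w := curl o u
  have hw : ∀ y, SmoothVF w y := fun y => smoothAt_curl ho (hu y)
  have hw' : ∀ y, SmoothVF (curl o u') y := fun y => smoothAt_curl ho (hu' y)
  have hG : Integrable (fun x => ⟪∇ᴸ u x (w x), w x⟫) μ := by
    refine h4.mono' (continuous_inner_section (fun y => smoothAt_leviCivita (hw y) (hu y))
      hw).aestronglyMeasurable (Eventually.of_forall fun x => ?_)
    calc _ ≤ ‖∇ᴸ u x (w x)‖ * ‖w x‖ := norm_inner_le_norm _ _
      _ ≤ (√(normSqNabla u x) * ‖w x‖) * ‖w x‖ :=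
        mul_le_mul_of_nonneg_right (norm_leviCivita_le _) (norm_nonneg _)
      _ = _ := by ring
  have hP : Integrable (fun x => ⟪curl o u' x, w x⟫) μ := integrable_inner hw' hw h5 h1
  -- the sign is chosen so that the divergence is bounded below
  set Φ : Π x : M, TangentSpace (𝓡 3) x := (-1 : ℝ) • enstrophyFlux o ν u w
  have hΦs : ∀ y, SmoothVF (enstrophyFlux o ν u w) y := fun y =>
    smoothAt_enstrophyFlux ho ν (hu y) (hw y)
  have hΦ : ∀ y, SmoothVF Φ y := fun y => (hΦs y).const_smul_section
  have hΦi : Integrable (fun x => ‖Φ x‖) μ := by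
    refine Integrable.mono' (((h1.add h3).const_mul (1 / 4)).add
      (((h2.const_mul (5 / 2)).add h1).const_mul ν)) (continuous_norm_section hΦ).aestronglyMeasurable
      (Eventually.of_forall fun x => ?_)
    rw [norm_norm]
    have e : ‖Φ x‖ = ‖enstrophyFlux o ν u w x‖ := by
      simp only [Φ, Pi.smul_apply, norm_smul]
      simp
    rw [e]
    exact norm_enstrophyFlux_le hν
  have hdivΦ : ∀ x, divergence Φ x = ⟪curl o u' x, w x⟫ + ν * normSqNabla w x +
      ν * ⟪ricci ∇ᴸ x (w x), w x⟫ - ⟪∇ᴸ u x (w x), w x⟫ := fun x => by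
    rw [divergence_const_smul _ (mdiffAt_of_smoothAt (hΦs x)),
      divergence_enstrophyFlux ho ν hu (hu' x) (hp x) hdiv h]
    ring
  -- the Ricci bound is what makes the divergence bounded below by an integrable function
  have hI : Integrable (fun x => ⟪∇ᴸ u x (w x), w x⟫ - ⟪curl o u' x, w x⟫ +
      ν * κ * ‖w x‖ ^ 2) μ := (hG.sub hP).add (h1.const_mul (ν * κ))
  obtain ⟨hint, hzero⟩ := integrable_divergence_of_le ho hΦ hΦi hI fun x => by
    have e1 := mul_le_mul_of_nonneg_left (hRic x (w x)) hν.le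
    have e2 := mul_nonneg hν.le (normSqNabla_nonneg (X := w) (x := x))
    rw [hdivΦ]
    linarith
  have hR : Integrable (fun x => ⟪ricci ∇ᴸ x (w x), w x⟫) μ := by
    have e := ((((hint.sub hP).sub (h2.const_mul ν)).add hG).const_mul ν⁻¹)
    refine e.congr (Eventually.of_forall fun x => ?_)
    simp only [Pi.add_apply, Pi.sub_apply, hdivΦ]
    field_simp
    ring
  refine ⟨hR, hG, ?_⟩
  simp only [hdivΦ] at hzero
  have e1 : Integrable (fun x => ⟪curl o u' x, w x⟫ + ν * normSqNabla w x) μ :=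
    hP.add (h2.const_mul ν)
  have e2 : Integrable (fun x => ⟪curl o u' x, w x⟫ + ν * normSqNabla w x +
      ν * ⟪ricci ∇ᴸ x (w x), w x⟫) μ := e1.add (hR.const_mul ν)
  rw [integral_sub e2 hG, integral_add e1 (hR.const_mul ν), integral_add hP (h2.const_mul ν),
    integral_const_mul, integral_const_mul] at hzero
  linarith

end Complete

end Threefold

end RiemannianFluid

end

theorem mainTheorem2 {M : Type*} [EMetricSpace M] [ChartedSpace (EuclideanSpace ℝ (Fin 3)) M]
    [IsManifold (𝓡 3) ∞ M] [RiemannianBundle (fun x : M => TangentSpace (𝓡 3) x)]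
    [IsContMDiffRiemannianBundle (𝓡 3) ∞ (EuclideanSpace ℝ (Fin 3))
      (fun x : M => TangentSpace (𝓡 3) x)]
    [IsRiemannianManifold (𝓡 3) M] [CompleteSpace M] [SecondCountableTopology M]
    [MeasurableSpace M] [BorelSpace M]
    (o : ∀ x : M, Orientation ℝ (TangentSpace (𝓡 3) x) (Fin 3))
    (ho : RiemannianFluid.IsOrientation o)
    (hRic : ∃ κ : ℝ, ∀ (x : M) (v : TangentSpace (𝓡 3) x),
      -κ * ‖v‖ ^ 2 ≤ inner ℝ (RiemannianFluid.ricci (RiemannianFluid.leviCivita (𝓡 3) M) x v) v)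
    (ν : ℝ) (hν : 0 < ν) (J : Set ℝ) (hJ : J.OrdConnected) (hJ' : J.Nontrivial)
    (u : ℝ → (x : M) → TangentSpace (𝓡 3) x) (p : ℝ → M → ℝ)
    (hu : RiemannianFluid.IsRegularSolution o ν J u p) (t : ℝ) (ht : t ∈ J) :
    (∀ (x : M) (X : TangentSpace (𝓡 3) x),
      RiemannianFluid.intrinsicRicci (fun y => (-(1 / (2 * ν))) • u t y) x X =
        RiemannianFluid.ricci (RiemannianFluid.leviCivita (𝓡 3) M) x X
          + (1 / (2 * ν ^ 2) * inner ℝ X (u t x)) • u t x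
          - (1 / ν) • RiemannianFluid.symGrad (u t) x X) ∧
    Integrable (fun x => RiemannianFluid.vorticity o (u t) x (u t x) ^ 2)
      (RiemannianFluid.riemannianVolume 3 M) ∧
    Integrable (fun x => RiemannianFluid.formInner x
        (fun A => RiemannianFluid.vorticity o (u t) x
          (RiemannianFluid.intrinsicRicci (fun y => (-(1 / (2 * ν))) • u t y) x A))
        (RiemannianFluid.vorticity o (u t) x))
      (RiemannianFluid.riemannianVolume 3 M) ∧
    DifferentiableWithinAt ℝ
      (fun s => ∫ x, ‖RiemannianFluid.vorticity o (u s) x‖ ^ 2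
        ∂(RiemannianFluid.riemannianVolume 3 M)) J t ∧
    1 / 2 * derivWithin
        (fun s => ∫ x, ‖RiemannianFluid.vorticity o (u s) x‖ ^ 2
          ∂(RiemannianFluid.riemannianVolume 3 M)) J t
      + ν * ∫ x, RiemannianFluid.normSqNablaOne (RiemannianFluid.vorticity o (u t)) x
          ∂(RiemannianFluid.riemannianVolume 3 M) =
    1 / (2 * ν) * ∫ x, RiemannianFluid.vorticity o (u t) x (u t x) ^ 2
          ∂(RiemannianFluid.riemannianVolume 3 M)
      - ν * ∫ x, RiemannianFluid.formInner x
          (fun A => RiemannianFluid.vorticity o (u t) x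
            (RiemannianFluid.intrinsicRicci (fun y => (-(1 / (2 * ν))) • u t y) x A))
          (RiemannianFluid.vorticity o (u t) x)
          ∂(RiemannianFluid.riemannianVolume 3 M) := by
  open RiemannianFluid in
  obtain ⟨κ, hκ⟩ := hRic
  have hν' : ν ≠ 0 := hν.ne'
  set μ := riemannianVolume 3 M
  have hus : IsSmoothOn J u := hu.contMDiffOn_velocity
  have hsm := fun s (hs : s ∈ J) x => smoothAt_velocity hus hs x
  have hw := fun s (hs : s ∈ J) x => smoothAt_curl ho (hsm s hs x)
  have hu' := smoothAt_timeDeriv hJ hJ' hus ht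
  have hvort : ∀ s ∈ J, ∀ x, vorticity o (u s) x = innerSL ℝ (curl o (u s) x) := fun s hs x =>
    vorticity_eq (mdiffAt_of_smoothAt (hsm s hs x))
  have hnorm : ∀ s ∈ J, ∀ x, ‖vorticity o (u s) x‖ = ‖curl o (u s) x‖ := fun s hs x => by
    rw [hvort s hs, innerSL_apply_norm]
  have hvt : vorticity o (u t) = flat (curl o (u t)) := funext fun x => hvort t ht x
  have hnab : ∀ x, normSqNablaOne (vorticity o (u t)) x = normSqNabla (curl o (u t)) x := fun x => by
    rw [hvt]
    exact normSqNablaOne_flat (mdiffAt_of_smoothAt (hw t ht x))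
  have happ : ∀ x (a : TangentSpace (𝓡 3) x), vorticity o (u t) x a = ⟪curl o (u t) x, a⟫ :=
    fun x a => by rw [hvort t ht x, innerSL_apply_apply]
  have hform : ∀ x, formInner x (fun A => vorticity o (u t) x
      (intrinsicRicci (fun y => (-(1 / (2 * ν))) • u t y) x A)) (vorticity o (u t) x) =
      ⟪ricci (leviCivita (𝓡 3) M) x (curl o (u t) x), curl o (u t) x⟫ +
        1 / (2 * ν ^ 2) * ⟪curl o (u t) x, u t x⟫ ^ 2 -
        1 / ν * ⟪leviCivita (𝓡 3) M (u t) x (curl o (u t) x), curl o (u t) x⟫ := fun x => by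
    rw [← formInner_intrinsicRicci hν' (hsm t ht x)]
    simp only [formInner, happ]
  have h1 : ∀ s ∈ J, Integrable (fun x => ‖curl o (u s) x‖ ^ 2) μ := fun s hs => by
    simpa only [hnorm s hs] using hu.integrable_vorticity s hs
  have h2 : Integrable (normSqNabla (curl o (u t))) μ := by
    simpa only [hnab] using hu.integrable_nabla_vorticity t ht
  have h3 : Integrable (fun x => ‖u t x‖ ^ 2 * ‖curl o (u t) x‖ ^ 2) μ := by
    simpa only [hnorm t ht] using hu.integrable_velocity_vorticity t ht
  have h4 : Integrable (fun x => √(normSqNabla (u t) x) * ‖curl o (u t) x‖ ^ 2) μ := by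
    simpa only [hnorm t ht] using hu.integrable_nabla_velocity_vorticity t ht
  have hJu := (uniqueDiffOn_interval hJ hJ').2.1 t ht
  -- `J` is nondegenerate, so its point `t` is an accumulation point
  haveI : NeBot (𝓝[J \ {t}] t) :=
    accPt_principal_iff_nhdsWithin.1 (uniqueDiffWithinAt_iff_accPt.1 hJu)
  have hlim : Tendsto (fun s => ∫⁻ x, ‖(s - t)⁻¹ • (curl o (u s) x - curl o (u t) x) -
      curl o (timeDeriv J u t) x‖ₑ ^ 2 ∂μ) (𝓝[J \ {t}] t) (𝓝 0) := by
    refine (hu.differentiable_vorticity t ht).congr' ?_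
    filter_upwards [self_mem_nhdsWithin] with s hs
    refine lintegral_congr fun x => ?_
    rw [hvort s hs.1, hvort t ht, derivWithin_vorticity hJ hJ' hus ht, ← map_sub, ← map_smul,
      ← map_sub, ← ofReal_norm, ← ofReal_norm, innerSL_apply_norm]
  obtain ⟨h5, hder⟩ := hasDerivWithinAt_integral_norm_sq hw
    (fun x => smoothAt_curl ho (hu' x)) ht h1 hlim
  have hder' : HasDerivWithinAt (fun s => ∫ x, ‖vorticity o (u s) x‖ ^ 2 ∂μ)
      (2 * ∫ x, ⟪curl o (timeDeriv J u t) x, curl o (u t) x⟫ ∂μ) J t :=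
    hder.congr_of_mem (fun s hs => by simp only [hnorm s hs]) ht
  obtain ⟨hR, hG, hbal⟩ := enstrophy_balance ho hκ hν (hsm t ht) hu'
    (fun y => hu.contMDiff_pressure t ht y) (hu.incompressible t ht) (hu.momentum t ht) (h1 t ht)
    h2 h3 h4 h5
  have hS : Integrable (fun x => ⟪curl o (u t) x, u t x⟫ ^ 2) μ := by
    refine h3.mono' ((continuous_inner_section (hw t ht) (hsm t ht)).pow 2).aestronglyMeasurable
      (Eventually.of_forall fun x => ?_)
    rw [norm_pow, mul_comm, ← mul_pow]
    exact pow_le_pow_left₀ (norm_nonneg _) (norm_inner_le_norm _ _) 2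
  have hRS : Integrable (fun x =>
      ⟪ricci (leviCivita (𝓡 3) M) x (curl o (u t) x), curl o (u t) x⟫ +
        1 / (2 * ν ^ 2) * ⟪curl o (u t) x, u t x⟫ ^ 2) μ := hR.add (hS.const_mul _)
  refine ⟨fun x a => intrinsicRicci_velocity hν' (hsm t ht x) a, ?_, ?_,
    hder'.differentiableWithinAt, ?_⟩
  · simpa only [happ] using hS
  · simp only [hform]
    exact hRS.sub (hG.const_mul _)
  · rw [hder'.derivWithin hJu]
    simp only [hform, hnab]
    simp only [happ]
    rw [integral_sub hRS (hG.const_mul _), integral_add hR (hS.const_mul _), integral_const_mul,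
      integral_const_mul]
    have e : ν * (1 / (2 * ν ^ 2)) = 1 / (2 * ν) := by field_simp
    have e' : ν * (1 / ν) = 1 := by field_simp
    linear_combination hbal + (∫ x, ⟪curl o (u t) x, u t x⟫ ^ 2 ∂μ) * e -
      (∫ x, ⟪leviCivita (𝓡 3) M (u t) x (curl o (u t) x), curl o (u t) x⟫ ∂μ) * e'
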